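/- Let $N\ge 1$ and let $p,q,r:\mathbb{R}^N\to\mathbb{R}$ be positive, Lipschitz continuous and $\mathbb{Z}^N$-periodic functions with $$1<p_-\le p(x)\le p_+<q_-\le q(x)\le r(x)\quad\text{a.e.},\qquad \inf_{x\in\mathbb{R}^N}\bigl(p^*(x)-r(x)\bigr)>0,$$ where $h_-=\operatorname{ess\,inf}h$, $h_+=\operatorname{ess\,sup}h$, and $p^*(x)=Np(x)/(N-p(x))$ if $p(x)<N$, $p^*(x)=+\infty$ if $p(x)\ge N$. Let $\lambda\ge 0$ be real and let $k\ge 1$ be an integer. Let $f,g:\mathbb{R}^N\to[0,\infty)$ be continuous such that $g(k^{-1}x)\to 0$ as $|x|\to\infty$; there are $\ell\ge1$ distinct points $a_1=0,a_2,\dots,a_\ell\in\mathbb{Z}^N$ with $f(a_i)=\max_{\mathbb{R}^N}f=1$ for all $i$; and there is a constant $f_\infty>0$ with $f(x)>f_\infty$ for all $x$ and $f(x)\to f_\infty$ as $|x|\to\infty$. Let $L^{p(x)}(\mathbb{R}^N)$ be the space of measurable functions $u$ with $\int_{\mathbb{R}^N}|u|^{p(x)}\,dx<\infty$ (functions that agree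 a.e. are identified), with the norm $\|u\|_{p(x)}=\inf\{t>0:\int_{\mathbb{R}^N}|u/t|^{p(x)}\,dx\le1\}$, and likewise for vector-valued functions. Let $W^{1,p(x)}(\mathbb{R}^N)$ be the space of all $u\in W^{1,1}_{\rm loc}(\mathbb{R}^N)$ with $u,|\nabla u|\in L^{p(x)}(\mathbb{R}^N)$, with the norm $\|u\|_{p(x)}+\|\nabla u\|_{p(x)}$. Let $J_{\lambda,k}:W^{1,p(x)}(\mathbb{R}^N)\to\mathbb{R}$, $$J_{\lambda,k}(u)=\int_{\mathbb{R}^N}\frac{1}{p(x)}\bigl(|\nabla u|^{p(x)}+|u|^{p(x)}\bigr)dx-\lambda\int_{\mathbb{R}^N}\frac{g(k^{-1}x)}{q(x)}|u|^{q(x)}dx-\int_{\mathbb{R}^N}\frac{f(k^{-1}x)}{r(x)}|u|^{r(x)}dx,$$ and let $J'_{\lambda,k}$ be its Fréchet derivative. Suppose that $u_n\rightharpoonup u$ weakly in $W^{1,p(x)}(\mathbb{R}^N)$ and that $J'_{\lambda,k}(u_n)\to0$ in the norm of the dual space. Then there is a subsequence $(u_{n_j})$ with $\nabla u_{n_j}(x)\to\nabla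 u(x)$ for almost every $x\in\mathbb{R}^N$. Moreover $J_{\lambda,k}$ is Fréchet differentiable at $u$ with $J'_{\lambda,k}(u)=0$, and $u$ is a weak solution of $$-\operatorname{div}\bigl(|\nabla u|^{p(x)-2}\nabla u\bigr)+|u|^{p(x)-2}u=\lambda g(k^{-1}x)|u|^{q(x)-2}u+f(k^{-1}x)|u|^{r(x)-2}u\quad\text{in }\mathbb{R}^N,$$ that is, for every $v\in W^{1,p(x)}(\mathbb{R}^N)$ the following integrals converge absolutely and $$\int_{\mathbb{R}^N}\bigl(|\nabla u|^{p(x)-2}\nabla u\cdot\nabla v+|u|^{p(x)-2}uv\bigr)dx=\lambda\int_{\mathbb{R}^N} g(k^{-1}x)|u|^{q(x)-2}uv\,dx+\int_{\mathbb{R}^N} f(k^{-1}x)|u|^{r(x)-2}uv\,dx.$$ -/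

import Mathlib

open MeasureTheory Filter Set Topology
open scoped ENNReal ContDiff

set_option linter.unusedSectionVars false

noncomputable section

/-- The Euclidean space `ℝ^N`. -/
abbrev RN (N : ℕ) : Type := EuclideanSpace ℝ (Fin N)

/-- A variable exponent: a measurable, essentially bounded function on `ℝ^N` that is at least `1`
almost everywhere. -/
structure VarExponent (N : ℕ) where
  /-- the underlying function -/
  toFun : RN N → ℝ
  measurable' : Measurable toFun
  one_le' : ∀ᵐ x, 1 ≤ toFun x
  bdd' : ∃ M : ℝ, ∀ᵐ x, toFun x ≤ M

instance (N : ℕ) : CoeFun (VarExponent N) (fun _ => RN N → ℝ) := ⟨VarExponent.toFun⟩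

section Lebesgue

variable {N : ℕ} {F : Type*} [NormedAddCommGroup F] [NormedSpace ℝ F]

/-- The modular `∫ |u(x)|^{h(x)} dx`, with values in `[0, ∞]`. -/
def modular (h : VarExponent N) (u : RN N → F) : ℝ≥0∞ :=
  ∫⁻ x, ‖u x‖ₑ ^ (h x)

theorem modular_congr (h : VarExponent N) {u v : RN N → F} (huv : u =ᵐ[volume] v) :
    modular h u = modular h v :=
  lintegral_congr_ae (huv.mono fun x hx => by simp only [hx])

theorem modular_zero (h : VarExponent N) : modular h (fun _ => (0 : F)) = 0 := by
  unfold modular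
  rw [lintegral_congr_ae (g := fun _ => 0), lintegral_zero]
  filter_upwards [h.one_le'] with x hx
  rw [enorm_zero, ENNReal.zero_rpow_of_pos (by linarith)]

theorem aemeasurable_modular (h : VarExponent N) {u : RN N → F}
    (hu : AEStronglyMeasurable u volume) : AEMeasurable (fun x => ‖u x‖ₑ ^ (h x)) volume :=
  hu.enorm.pow h.measurable'.aemeasurable

/-- Convexity of the modular. -/
theorem modular_convex (h : VarExponent N) {u v : RN N → F}
    (hu : AEStronglyMeasurable u volume) {a b : ℝ}
    (ha : 0 ≤ a) (hb : 0 ≤ b) (hab : a + b = 1) :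
    modular h (fun x => a • u x + b • v x) ≤
      ENNReal.ofReal a * modular h u + ENNReal.ofReal b * modular h v := by
  unfold modular
  rw [← lintegral_const_mul'' _ (aemeasurable_modular h hu),
    ← lintegral_const_mul' _ _ ENNReal.ofReal_ne_top,
    ← lintegral_add_left' ((aemeasurable_modular h hu).const_mul _)]
  refine lintegral_mono_ae ?_
  filter_upwards [h.one_le'] with x hx
  have h1 : ‖a • u x + b • v x‖ₑ ≤
      ENNReal.ofReal a * ‖u x‖ₑ + ENNReal.ofReal b * ‖v x‖ₑ := by
    refine (enorm_add_le _ _).trans ?_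
    rw [enorm_smul, enorm_smul, Real.enorm_of_nonneg ha, Real.enorm_of_nonneg hb]
  refine (ENNReal.rpow_le_rpow h1 (by linarith)).trans ?_
  refine ENNReal.rpow_arith_mean_le_arith_mean2_rpow _ _ _ _ ?_ hx
  rw [← ENNReal.ofReal_add ha hb, hab, ENNReal.ofReal_one]

theorem modular_smul_le (h : VarExponent N) {u : RN N → F}
    (hu : AEStronglyMeasurable u volume) {a : ℝ} (ha : 0 ≤ a) (ha1 : a ≤ 1) :
    modular h (fun x => a • u x) ≤ ENNReal.ofReal a * modular h u := by
  have := modular_convex h (v := fun _ => (0 : F)) hu ha (sub_nonneg.2 ha1) (by ring)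
  simpa [modular_zero h] using this

theorem modular_smul_lt_top (h : VarExponent N) {u : RN N → F} (hu : modular h u < ⊤) (c : ℝ) :
    modular h (fun x => c • u x) < ⊤ := by
  obtain ⟨M, hM⟩ := h.bdd'
  have hC : (max 1 ‖c‖ₑ) ^ M ≠ ⊤ := by
    have h1 : (1 : ℝ≥0∞) ≤ max 1 ‖c‖ₑ := le_max_left _ _
    refine ENNReal.rpow_ne_top_of_ne_zero ?_ ?_
    · exact (zero_lt_one.trans_le h1).ne'
    · simp
  refine lt_of_le_of_lt ?_ (ENNReal.mul_lt_top hC.lt_top hu)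
  unfold modular
  rw [← lintegral_const_mul' _ _ hC]
  refine lintegral_mono_ae ?_
  filter_upwards [h.one_le', hM] with x hx hx'
  rw [enorm_smul, ENNReal.mul_rpow_of_nonneg _ _ (by linarith)]
  gcongr ?_ * _
  exact (ENNReal.rpow_le_rpow (le_max_right _ _) (by linarith)).trans
    (ENNReal.rpow_le_rpow_of_exponent_le (le_max_left _ _) hx')

theorem modular_add_lt_top (h : VarExponent N) {u v : RN N → F}
    (hum : AEStronglyMeasurable u volume)
    (hu : modular h u < ⊤) (hv : modular h v < ⊤) :
    modular h (fun x => u x + v x) < ⊤ := by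
  have h1 := modular_convex h (v := fun x => (2 : ℝ) • v x) (hum.const_smul (2 : ℝ))
    (a := 1 / 2) (b := 1 / 2) (by norm_num) (by norm_num) (by norm_num)
  have h2 : (fun x => (1 / 2 : ℝ) • ((2 : ℝ) • u) x + (1 / 2 : ℝ) • ((2 : ℝ) • v x)) =
      fun x => u x + v x := by
    funext x
    simp [smul_smul]
  rw [h2] at h1
  refine h1.trans_lt (ENNReal.add_lt_top.2 ⟨?_, ?_⟩)
  · exact ENNReal.mul_lt_top ENNReal.ofReal_lt_top (modular_smul_lt_top h hu 2)
  · exact ENNReal.mul_lt_top ENNReal.ofReal_lt_top (modular_smul_lt_top h hv 2)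

/-- `L^{h(x)}(ℝ^N; F)` as a subspace of the classes of measurable functions: those with finite
modular. -/
def varLpSubmodule (h : VarExponent N) (F : Type*) [NormedAddCommGroup F] [NormedSpace ℝ F] :
    Submodule ℝ (RN N →ₘ[volume] F) where
  carrier := {u | modular h u < ⊤}
  zero_mem' := by
    have h0 : modular h ((0 : RN N →ₘ[volume] F) : RN N → F) = 0 := by
      rw [modular_congr h (AEEqFun.coeFn_zero (α := RN N) (β := F))]
      exact modular_zero h
    simp [h0]
  add_mem' := by
    intro u v hu hv
    have := modular_add_lt_top h u.aestronglyMeasurable hu hv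
    exact (modular_congr h (AEEqFun.coeFn_add u v)).trans_lt this
  smul_mem' := by
    intro c u hu
    have := modular_smul_lt_top h hu c
    exact (modular_congr h (AEEqFun.coeFn_smul c u)).trans_lt this

/-- The variable exponent Lebesgue space `L^{h(x)}(ℝ^N; F)`. -/
def VarLp (h : VarExponent N) (F : Type*) [NormedAddCommGroup F] [NormedSpace ℝ F] : Type _ :=
  varLpSubmodule h F

instance (h : VarExponent N) : AddCommGroup (VarLp h F) :=
  inferInstanceAs (AddCommGroup (varLpSubmodule h F))

instance (h : VarExponent N) : Module ℝ (VarLp h F) :=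
  inferInstanceAs (Module ℝ (varLpSubmodule h F))

/-- A representative of `u ∈ L^{h(x)}(ℝ^N; F)`. -/
def VarLp.fn {h : VarExponent N} (u : VarLp h F) : RN N → F := (u.1 : RN N →ₘ[volume] F)

theorem VarLp.aestronglyMeasurable {h : VarExponent N} (u : VarLp h F) :
    AEStronglyMeasurable u.fn volume := AEEqFun.aestronglyMeasurable _

theorem VarLp.modular_lt_top {h : VarExponent N} (u : VarLp h F) : modular h u.fn < ⊤ := u.2

theorem VarLp.fn_add {h : VarExponent N} (u v : VarLp h F) :
    (u + v).fn =ᵐ[volume] u.fn + v.fn := AEEqFun.coeFn_add _ _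

theorem VarLp.fn_smul {h : VarExponent N} (c : ℝ) (u : VarLp h F) :
    (c • u).fn =ᵐ[volume] c • u.fn := AEEqFun.coeFn_smul _ _

theorem VarLp.fn_zero {h : VarExponent N} : (0 : VarLp h F).fn =ᵐ[volume] 0 :=
  AEEqFun.coeFn_zero

theorem VarLp.ext_ae {h : VarExponent N} {u v : VarLp h F} (huv : u.fn =ᵐ[volume] v.fn) :
    u = v := Subtype.ext (AEEqFun.ext huv)

/-- The Luxemburg norm `inf {t > 0 : ∫ |u(x)/t|^{h(x)} dx ≤ 1}`. -/
def luxNorm (h : VarExponent N) (u : RN N → F) : ℝ :=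
  sInf {t : ℝ | 0 < t ∧ modular h (fun x => t⁻¹ • u x) ≤ 1}

/-- The unit ball of the modular. -/
def modularBall (h : VarExponent N) (F : Type*) [NormedAddCommGroup F] [NormedSpace ℝ F] :
    Set (VarLp h F) := {u | modular h u.fn ≤ 1}

theorem modular_coe_smul (h : VarExponent N) (c : ℝ) (u : VarLp h F) :
    modular h (c • u).fn =
      modular h (fun x => c • u.fn x) :=
  modular_congr h (VarLp.fn_smul c u)

theorem luxNorm_eq_gauge (h : VarExponent N) (u : VarLp h F) :
    luxNorm h u.fn = gauge (modularBall h F) u := by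
  rw [gauge_def', luxNorm]
  congr 1
  ext t
  simp only [Set.mem_ofPred_eq, Set.mem_Ioi, modularBall, modular_coe_smul]

theorem convex_modularBall (h : VarExponent N) : Convex ℝ (modularBall h F) := by
  intro u hu v hv a b ha hb hab
  have h1 := modular_convex h (u := u.fn) (v := v.fn)
    u.aestronglyMeasurable ha hb hab
  have h2 : modular h (a • u + b • v).fn =
      modular h (fun x => a • u.fn x + b • v.fn x) := by
    refine modular_congr h ?_
    filter_upwards [VarLp.fn_add (a • u) (b • v), VarLp.fn_smul a u, VarLp.fn_smul b v]
      with x h3 h4 h5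
    simp only [h3, Pi.add_apply, h4, h5, Pi.smul_apply]
  change modular h _ ≤ 1
  rw [h2]
  refine h1.trans ?_
  calc _ ≤ ENNReal.ofReal a * 1 + ENNReal.ofReal b * 1 := by gcongr <;> assumption
    _ = 1 := by rw [mul_one, mul_one, ← ENNReal.ofReal_add ha hb, hab, ENNReal.ofReal_one]

theorem balanced_modularBall (h : VarExponent N) : Balanced ℝ (modularBall h F) := by
  rw [balanced_iff_smul_mem]
  intro a ha u hu
  change modular h _ ≤ 1
  rw [modular_coe_smul]
  refine le_trans ?_ (show modular h u.fn ≤ 1 from hu)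
  refine lintegral_mono_ae ?_
  filter_upwards [h.one_le'] with x hx
  refine ENNReal.rpow_le_rpow ?_ (by linarith)
  rw [enorm_smul]
  refine mul_le_of_le_one_left' ?_
  rw [← ofReal_norm]
  exact ENNReal.ofReal_le_one.2 ha

theorem absorbent_modularBall (h : VarExponent N) : Absorbent ℝ (modularBall h F) := by
  refine absorbent_iff_eventually_nhdsNE_zero.2 fun u => ?_
  have hfin : modular h u.fn < ⊤ := u.modular_lt_top
  set M : ℝ := (modular h u.fn).toReal with hM
  have hM0 : 0 ≤ M := ENNReal.toReal_nonneg
  have hpos : (0 : ℝ) < 1 + M := by linarith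
  have hinv : (1 + M)⁻¹ ≤ 1 := inv_le_one_of_one_le₀ (by linarith)
  have hmem : ((1 + M)⁻¹ : ℝ) • u ∈ modularBall h F := by
    change modular h _ ≤ 1
    rw [modular_coe_smul]
    refine (modular_smul_le h u.aestronglyMeasurable
      (inv_nonneg.2 hpos.le) hinv).trans ?_
    rw [← ENNReal.ofReal_toReal hfin.ne, ← ENNReal.ofReal_mul (inv_nonneg.2 hpos.le), ← hM]
    refine ENNReal.ofReal_le_one.2 ?_
    rw [inv_mul_le_iff₀ hpos]
    linarith
  have hev : ∀ᶠ c : ℝ in 𝓝 0, ‖c * (1 + M)‖ < 1 := by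
    have hc : Continuous fun c : ℝ => ‖c * (1 + M)‖ := by fun_prop
    exact hc.continuousAt.eventually (gt_mem_nhds (by simp))
  filter_upwards [hev.filter_mono nhdsWithin_le_nhds] with c hc
  have := balanced_iff_smul_mem.1 (balanced_modularBall (F := F) h) hc.le hmem
  rwa [smul_smul, mul_assoc, mul_inv_cancel₀ hpos.ne', mul_one] at this

/-- The Luxemburg norm as a seminorm on `L^{h(x)}`. -/
def luxSeminorm (h : VarExponent N) (F : Type*) [NormedAddCommGroup F] [NormedSpace ℝ F] :
    Seminorm ℝ (VarLp h F) :=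
  gaugeSeminorm (balanced_modularBall h) (convex_modularBall h) (absorbent_modularBall h)

theorem luxSeminorm_apply (h : VarExponent N) (u : VarLp h F) :
    luxSeminorm h F u = luxNorm h u.fn :=
  (luxNorm_eq_gauge h u).symm

theorem eq_zero_of_luxNorm (h : VarExponent N) (u : VarLp h F)
    (hu : luxNorm h u.fn = 0) : u = 0 := by
  rw [luxNorm_eq_gauge] at hu
  have hle : ∀ ε : ℝ, 0 < ε → modular h u.fn ≤ ENNReal.ofReal ε := by
    intro ε hε
    have hlt : gauge (modularBall h F) u < min ε 1 := hu.trans_lt (lt_min hε one_pos)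
    obtain ⟨b, hb0, hb, hmem⟩ := exists_lt_of_gauge_lt (absorbent_modularBall h) hlt
    obtain ⟨v, hv, hvu⟩ := Set.mem_smul_set.1 hmem
    rw [← hvu, modular_coe_smul]
    refine (modular_smul_le h v.aestronglyMeasurable hb0.le
      (hb.le.trans (min_le_right _ _))).trans ?_
    calc _ ≤ ENNReal.ofReal b * 1 := by gcongr; exact hv
      _ ≤ ENNReal.ofReal ε := by
        rw [mul_one]
        exact ENNReal.ofReal_le_ofReal (hb.le.trans (min_le_left _ _))
  have h0 : modular h u.fn = 0 := by
    refine le_antisymm (ENNReal.le_of_forall_pos_le_add fun ε hε _ => ?_) bot_le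
    simpa using hle ε (by exact_mod_cast hε)
  have h1 := (lintegral_eq_zero_iff' (aemeasurable_modular h
    u.aestronglyMeasurable)).1 h0
  refine VarLp.ext_ae ?_
  filter_upwards [h1, h.one_le', VarLp.fn_zero (F := F) (h := h)] with x hx hx1 hx0
  have hx2 : ‖u.fn x‖ₑ = 0 := by
    have := (ENNReal.rpow_eq_zero_iff_of_pos (by linarith)).1 hx
    exact this
  rw [enorm_eq_zero.1 hx2]
  exact hx0.symm

end Lebesgue

section Sobolev

variable {N : ℕ}

/-- `G` is the weak gradient of `u ∈ W^{1,1}_loc(ℝ^N)`: both functions are locally integrable and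
`∫ u ∂ᵢφ = - ∫ Gᵢ φ` for all `φ ∈ C_c^∞(ℝ^N)` and all `i`. -/
def HasWeakGradient (u : RN N → ℝ) (G : RN N → RN N) : Prop :=
  LocallyIntegrable u ∧ LocallyIntegrable G ∧
    ∀ φ : RN N → ℝ, ContDiff ℝ ∞ φ → HasCompactSupport φ → ∀ i : Fin N,
      ∫ x, u x * fderiv ℝ φ x (EuclideanSpace.single i 1) = - ∫ x, G x i * φ x

theorem HasWeakGradient.congr {u u' : RN N → ℝ} {G G' : RN N → RN N}
    (hu : u =ᵐ[volume] u') (hG : G =ᵐ[volume] G') (h : HasWeakGradient u G) :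
    HasWeakGradient u' G' := by
  refine ⟨h.1.congr hu, h.2.1.congr hG, fun φ hφ hφc i => ?_⟩
  have h1 : ∫ x, u' x * fderiv ℝ φ x (EuclideanSpace.single i 1) =
      ∫ x, u x * fderiv ℝ φ x (EuclideanSpace.single i 1) :=
    integral_congr_ae (hu.mono fun x hx => by simp only [hx])
  have h2 : ∫ x, G' x i * φ x = ∫ x, G x i * φ x :=
    integral_congr_ae (hG.mono fun x hx => by simp only [hx])
  rw [h1, h2, h.2.2 φ hφ hφc i]

theorem locallyIntegrable_coord {G : RN N → RN N} (hG : LocallyIntegrable G) (i : Fin N) :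
    LocallyIntegrable (fun x => G x i) := by
  intro x
  obtain ⟨s, hs, hi⟩ := hG x
  exact ⟨s, hs, (EuclideanSpace.proj (𝕜 := ℝ) i).integrable_comp hi⟩

theorem integrable_coord_mul {G : RN N → RN N} (hG : LocallyIntegrable G) (i : Fin N)
    {φ : RN N → ℝ} (hφ : ContDiff ℝ ∞ φ) (hφc : HasCompactSupport φ) :
    Integrable (fun x => G x i * φ x) :=
  (locallyIntegrable_coord hG i).integrable_smul_right_of_hasCompactSupport hφ.continuous hφc

theorem integrable_mul_fderiv {u : RN N → ℝ} (hu : LocallyIntegrable u) (i : Fin N)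
    {φ : RN N → ℝ} (hφ : ContDiff ℝ ∞ φ) (hφc : HasCompactSupport φ) :
    Integrable (fun x => u x * fderiv ℝ φ x (EuclideanSpace.single i 1)) :=
  hu.integrable_smul_right_of_hasCompactSupport
    ((hφ.continuous_fderiv (by simp)).clm_apply continuous_const) (hφc.fderiv_apply ℝ _)

theorem HasWeakGradient.add {u v : RN N → ℝ} {G H : RN N → RN N}
    (hu : HasWeakGradient u G) (hv : HasWeakGradient v H) : HasWeakGradient (u + v) (G + H) := by
  refine ⟨hu.1.add hv.1, hu.2.1.add hv.2.1, fun φ hφ hφc i => ?_⟩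
  simp only [Pi.add_apply, PiLp.add_apply, add_mul]
  rw [integral_add (integrable_mul_fderiv hu.1 i hφ hφc) (integrable_mul_fderiv hv.1 i hφ hφc),
    integral_add (integrable_coord_mul hu.2.1 i hφ hφc) (integrable_coord_mul hv.2.1 i hφ hφc),
    hu.2.2 φ hφ hφc i, hv.2.2 φ hφ hφc i]
  ring

theorem HasWeakGradient.smul {u : RN N → ℝ} {G : RN N → RN N} (c : ℝ)
    (hu : HasWeakGradient u G) : HasWeakGradient (c • u) (c • G) := by
  refine ⟨hu.1.smul c, hu.2.1.smul c, fun φ hφ hφc i => ?_⟩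
  simp only [Pi.smul_apply, PiLp.smul_apply, smul_eq_mul, mul_assoc]
  rw [integral_const_mul, integral_const_mul, hu.2.2 φ hφ hφc i]
  ring

theorem hasWeakGradient_zero : HasWeakGradient (0 : RN N → ℝ) (0 : RN N → RN N) := by
  refine ⟨locallyIntegrable_zero, locallyIntegrable_zero, fun φ hφ hφc i => ?_⟩
  simp

/-- Weak gradients are unique almost everywhere. -/
theorem HasWeakGradient.unique {u : RN N → ℝ} {G H : RN N → RN N}
    (hG : HasWeakGradient u G) (hH : HasWeakGradient u H) : G =ᵐ[volume] H := by
  have key : ∀ i : Fin N, ∀ᵐ x, G x i - H x i = 0 := by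
    intro i
    refine ae_eq_zero_of_integral_contDiff_smul_eq_zero
      ((locallyIntegrable_coord hG.2.1 i).sub (locallyIntegrable_coord hH.2.1 i)) ?_
    intro φ hφ hφc
    have h1 := hG.2.2 φ hφ hφc i
    rw [hH.2.2 φ hφ hφc i, neg_inj] at h1
    calc ∫ x, φ x • (G x i - H x i) = ∫ x, (G x i * φ x - H x i * φ x) := by
          refine integral_congr_ae (Eventually.of_forall fun x => ?_)
          simp only [smul_eq_mul]
          ring
      _ = 0 := by
          rw [integral_sub (integrable_coord_mul hG.2.1 i hφ hφc)
            (integrable_coord_mul hH.2.1 i hφ hφc), h1, sub_self]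
  filter_upwards [ae_all_iff.2 key] with x hx
  ext i
  exact sub_eq_zero.1 (hx i)

/-- `W^{1,h(x)}(ℝ^N)` as a subspace of the classes of measurable functions: those
`u ∈ L^{h(x)}(ℝ^N) ∩ W^{1,1}_loc(ℝ^N)` whose weak gradient belongs to `L^{h(x)}`. -/
def varSobolevSubmodule (h : VarExponent N) : Submodule ℝ (RN N →ₘ[volume] ℝ) where
  carrier := {u | u ∈ varLpSubmodule h ℝ ∧ ∃ G ∈ varLpSubmodule h (RN N), HasWeakGradient u G}
  zero_mem' := ⟨zero_mem _, 0, zero_mem _,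
    hasWeakGradient_zero.congr AEEqFun.coeFn_zero.symm AEEqFun.coeFn_zero.symm⟩
  add_mem' := by
    rintro u v ⟨hu, G, hG, huG⟩ ⟨hv, H, hH, hvH⟩
    exact ⟨add_mem hu hv, G + H, add_mem hG hH, (huG.add hvH).congr
      (AEEqFun.coeFn_add _ _).symm (AEEqFun.coeFn_add _ _).symm⟩
  smul_mem' := by
    rintro c u ⟨hu, G, hG, huG⟩
    exact ⟨Submodule.smul_mem _ c hu, c • G, Submodule.smul_mem _ c hG, (huG.smul c).congr
      (AEEqFun.coeFn_smul _ _).symm (AEEqFun.coeFn_smul _ _).symm⟩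

/-- The variable exponent Sobolev space `W^{1,h(x)}(ℝ^N)`. -/
def VarSobolev (h : VarExponent N) : Type := varSobolevSubmodule h

namespace VarSobolev

variable {h : VarExponent N}

instance : AddCommGroup (VarSobolev h) := inferInstanceAs (AddCommGroup (varSobolevSubmodule h))

instance : Module ℝ (VarSobolev h) := inferInstanceAs (Module ℝ (varSobolevSubmodule h))

/-- The inclusion `W^{1,h(x)} → L^{h(x)}`. -/
def toLp : VarSobolev h →ₗ[ℝ] VarLp h ℝ where
  toFun u := ⟨u.1, u.2.1⟩
  map_add' _ _ := rfl
  map_smul' _ _ := rfl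

theorem toLp_injective : Function.Injective (toLp (h := h)) := fun _ _ huv =>
  Subtype.ext (congrArg (fun w : VarLp h ℝ => w.1) huv)

/-- A representative of `u ∈ W^{1,h(x)}(ℝ^N)`. -/
def fn (u : VarSobolev h) : RN N → ℝ := (toLp u).fn

theorem fn_add (u v : VarSobolev h) : (u + v).fn =ᵐ[volume] u.fn + v.fn := by
  rw [fn, map_add]
  exact VarLp.fn_add _ _

theorem fn_smul (c : ℝ) (u : VarSobolev h) : (c • u).fn =ᵐ[volume] c • u.fn := by
  rw [fn, map_smul]
  exact VarLp.fn_smul _ _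

theorem exists_grad (u : VarSobolev h) : ∃ G : VarLp h (RN N),
    HasWeakGradient u.fn G.fn := by
  obtain ⟨G, hG, huG⟩ := u.2.2
  exact ⟨⟨G, hG⟩, huG⟩

theorem eq_of_hasWeakGradient {u : RN N → ℝ} {G H : VarLp h (RN N)}
    (hG : HasWeakGradient u G.fn)
    (hH : HasWeakGradient u H.fn) : G = H :=
  VarLp.ext_ae (hG.unique hH)

/-- The weak gradient, as a linear map `W^{1,h(x)} → L^{h(x)}(ℝ^N; ℝ^N)`. -/
def gradLp : VarSobolev h →ₗ[ℝ] VarLp h (RN N) where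
  toFun u := u.exists_grad.choose
  map_add' u v := by
    refine eq_of_hasWeakGradient (u + v).exists_grad.choose_spec ?_
    exact (u.exists_grad.choose_spec.add v.exists_grad.choose_spec).congr
      (fn_add u v).symm (VarLp.fn_add _ _).symm
  map_smul' c u := by
    refine eq_of_hasWeakGradient (c • u).exists_grad.choose_spec ?_
    exact (u.exists_grad.choose_spec.smul c).congr
      (fn_smul c u).symm (VarLp.fn_smul _ _).symm

/-- (A representative of) the weak gradient `∇u` of `u ∈ W^{1,h(x)}(ℝ^N)`. -/
def grad (u : VarSobolev h) : RN N → RN N := (gradLp u).fn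

theorem hasWeakGradient (u : VarSobolev h) : HasWeakGradient u.fn u.grad :=
  u.exists_grad.choose_spec

/-- The norm `‖u‖_{h(x)} + ‖∇u‖_{h(x)}`. -/
instance : Norm (VarSobolev h) := ⟨fun u => luxNorm h u.fn + luxNorm h u.grad⟩

theorem norm_def (u : VarSobolev h) : ‖u‖ = luxNorm h u.fn + luxNorm h u.grad := rfl

theorem norm_eq_seminorm (u : VarSobolev h) :
    ‖u‖ = luxSeminorm h ℝ (toLp u) + luxSeminorm h (RN N) (gradLp u) := by
  rw [luxSeminorm_apply, luxSeminorm_apply]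
  rfl

theorem normedSpaceCore : NormedSpace.Core ℝ (VarSobolev h) where
  norm_nonneg u := by
    rw [norm_eq_seminorm]
    positivity
  norm_smul c u := by
    simp only [norm_eq_seminorm, map_smul, map_smul_eq_mul, mul_add]
  norm_triangle u v := by
    simp only [norm_eq_seminorm, map_add]
    linarith [map_add_le_add (luxSeminorm h ℝ) (toLp u) (toLp v),
      map_add_le_add (luxSeminorm h (RN N)) (gradLp u) (gradLp v)]
  norm_eq_zero_iff u := by
    constructor
    · intro hu
      rw [norm_eq_seminorm] at hu
      have h1 : luxSeminorm h ℝ (toLp u) = 0 := by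
        linarith [apply_nonneg (luxSeminorm h ℝ) (toLp u),
          apply_nonneg (luxSeminorm h (RN N)) (gradLp u)]
      rw [luxSeminorm_apply] at h1
      have h2 := eq_zero_of_luxNorm h _ h1
      exact toLp_injective (h2.trans (map_zero _).symm)
    · rintro rfl
      simp [norm_eq_seminorm]

instance : NormedAddCommGroup (VarSobolev h) := NormedAddCommGroup.ofCore normedSpaceCore

instance : NormedSpace ℝ (VarSobolev h) := NormedSpace.ofCore normedSpaceCore

end VarSobolev

end Sobolev

section Problem

variable {N : ℕ}

/-- The point of `ℝ^N` with integer coordinates `z`. -/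
def latticePoint (z : Fin N → ℤ) : RN N := WithLp.toLp 2 fun i => (z i : ℝ)

/-- `ℤ^N`-periodic functions. -/
def IsZPeriodic (h : RN N → ℝ) : Prop :=
  ∀ (x : RN N) (z : Fin N → ℤ), h (x + latticePoint z) = h x

/-- The critical Sobolev exponent `p^*(x)`, equal to `+∞` where `p(x) ≥ N`. -/
def critExponent (p : RN N → ℝ) (x : RN N) : EReal :=
  if p x < N then ((N * p x / (N - p x) : ℝ) : EReal) else ⊤

/-- The standing assumptions on the exponents: `p, q, r` are positive, Lipschitz continuous and
`ℤ^N`-periodic, and `1 < p₋ ≤ p ≤ p₊ < q₋ ≤ q ≤ r ≪ p^*`, where `r ≪ p^*` means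
`inf (p^* - r) > 0`. -/
structure ExponentAssumptions (p q r : RN N → ℝ) : Prop where
  pos : ∀ x, 0 < p x ∧ 0 < q x ∧ 0 < r x
  lipschitz_p : ∃ K, LipschitzWith K p
  lipschitz_q : ∃ K, LipschitzWith K q
  lipschitz_r : ∃ K, LipschitzWith K r
  periodic_p : IsZPeriodic p
  periodic_q : IsZPeriodic q
  periodic_r : IsZPeriodic r
  one_lt : 1 < essInf p volume
  p_lt_q : essSup p volume < essInf q volume
  q_le_r : ∀ᵐ x, q x ≤ r x
  r_ll : 0 < ⨅ x, (critExponent p x - (r x : EReal))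

/-- The assumptions on `g`: nonnegative, continuous and `g(k⁻¹x) → 0` as `|x| → ∞`. -/
structure GAssumptions (k : ℕ) (g : RN N → ℝ) : Prop where
  nonneg : ∀ x, 0 ≤ g x
  continuous : Continuous g
  tendsto : Tendsto (fun x => g ((k : ℝ)⁻¹ • x)) (Bornology.cobounded (RN N)) (𝓝 0)

/-- The assumptions on `f`: nonnegative and continuous; there are `ℓ ≥ 1` points of `ℤ^N`, the
first of them `0`, where `f` attains its maximum `1`; and `0 < f_∞ < f(x) → f_∞` as
`|x| → ∞`. -/
structure FAssumptions (f : RN N → ℝ) : Prop where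
  nonneg : ∀ x, 0 ≤ f x
  continuous : Continuous f
  max_points : ∃ (ℓ : ℕ) (a : Fin (ℓ + 1) → Fin N → ℤ), Function.Injective a ∧ a 0 = 0 ∧
    ∀ i, f (latticePoint (a i)) = 1 ∧ ∀ x, f x ≤ f (latticePoint (a i))
  limit : ∃ fInf : ℝ, 0 < fInf ∧ (∀ x, fInf < f x) ∧
    Tendsto f (Bornology.cobounded (RN N)) (𝓝 fInf)

/-- The energy functional `J_{λ,k}` on `W^{1,p(x)}(ℝ^N)`. -/
def energy (p : VarExponent N) (q r f g : RN N → ℝ) (lam : ℝ) (k : ℕ) (u : VarSobolev p) : ℝ :=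
  (∫ x, 1 / p x * (‖u.grad x‖ ^ p x + |u.fn x| ^ p x))
    - lam * (∫ x, g ((k : ℝ)⁻¹ • x) / q x * |u.fn x| ^ q x)
    - ∫ x, f ((k : ℝ)⁻¹ • x) / r x * |u.fn x| ^ r x

/-- `u ∈ W^{1,p(x)}(ℝ^N)` is a weak solution of
`-Δ_{p(x)} u + |u|^{p(x)-2} u = λ g(k⁻¹x) |u|^{q(x)-2} u + f(k⁻¹x) |u|^{r(x)-2} u` in `ℝ^N`: for
every test function `v ∈ W^{1,p(x)}(ℝ^N)` the integrals of the weak formulation converge and the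
identity holds. -/
def IsWeakSolution (p : VarExponent N) (q r f g : RN N → ℝ) (lam : ℝ) (k : ℕ)
    (u : VarSobolev p) : Prop :=
  ∀ v : VarSobolev p,
    Integrable (fun x => ‖u.grad x‖ ^ (p x - 2) * inner ℝ (u.grad x) (v.grad x)
      + |u.fn x| ^ (p x - 2) * u.fn x * v.fn x) ∧
    Integrable (fun x => g ((k : ℝ)⁻¹ • x) * |u.fn x| ^ (q x - 2) * u.fn x * v.fn x) ∧
    Integrable (fun x => f ((k : ℝ)⁻¹ • x) * |u.fn x| ^ (r x - 2) * u.fn x * v.fn x) ∧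
    (∫ x, (‖u.grad x‖ ^ (p x - 2) * inner ℝ (u.grad x) (v.grad x)
        + |u.fn x| ^ (p x - 2) * u.fn x * v.fn x)) =
      lam * (∫ x, g ((k : ℝ)⁻¹ • x) * |u.fn x| ^ (q x - 2) * u.fn x * v.fn x)
        + ∫ x, f ((k : ℝ)⁻¹ • x) * |u.fn x| ^ (r x - 2) * u.fn x * v.fn x

end Problem

end

/-! ### Elementary inequalities for the map `a ↦ ‖a‖ ^ (s - 2) • a` -/

section Elementary

/-! Write `powMap s a` for `‖a‖ ^ (s - 2) • a`. The derivative of the energy is a sum of pairings of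
`powMap` terms with a test function, and the issue is to pass to the limit in the nonlinear gradient
term, where only weak convergence is available. The method is monotonicity after localisation.

A weakly convergent sequence is bounded (`exists_norm_le_of_weak_tendsto`), so its modulars with
exponents `p`, `q`, `r` and a slightly larger `s = r + ε` are bounded, by the subcritical embedding
`ExponentAssumptions.exists_embedding`. On balls `u n → u₀` in `L¹`
(`VarSobolev.tendsto_setLIntegral_ball`), and interpolation with the bound for `s` upgrades this to
the exponents `p`, `q`, `r`. Test the derivative at `u n` with `χ (u n - u₀)`, where `χ` is a
cutoff. The lower order terms and the term containing `∇χ` vanish by the local convergence, and the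
term with `∇u₀` frozen vanishes by weak convergence. What remains is that the integral of `χ` times
`⟨powMap p (∇u n) - powMap p (∇u₀), ∇u n - ∇u₀⟩` tends to `0`
(`tendsto_setLIntegral_inner_powMap_sub`). This integrand is nonnegative, so along a subsequence it
tends to `0` almost everywhere, and strict monotonicity (`tendsto_of_inner_powMap_sub`) gives `∇u n
→ ∇u₀` almost everywhere.

Boundedness together with almost everywhere convergence makes every `powMap` term converge weakly
(`tendsto_energyDeriv_of_ae`). For a fixed test function the derivative at `u n` therefore tends
both to the derivative at `u₀` and to `0`. Differentiability of the energy comes from a uniform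
first order estimate for `‖a‖ ^ s / s` (`hasFDerivAt_integral_mul_norm_rpow`).

The embedding and the local compactness both rest on one pointwise bound: the mean oscillation of a
Sobolev function over a ball of radius `δ` is controlled by a truncated Riesz potential of its
gradient (`HasWeakGradient.ae_lintegral_ball_enorm_sub_le`). A Young-type inequality for the
potential gives the embedding, since on small balls a Lipschitz exponent may be replaced by a
constant lower bound at a small loss, which strict subcriticality absorbs. The mass of the kernel
tends to `0` with `δ`, which gives compactness. -/

theorem Real.rpow_sub_one_mul_self {x s : ℝ} (hx : 0 ≤ x) (hs : 1 < s) :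
    x ^ (s - 1) * x = x ^ s := by
  nth_rewrite 2 [← Real.rpow_one x]
  rw [← Real.rpow_add_of_nonneg hx (by linarith) zero_le_one]
  congr 1
  ring

/-- Young's inequality with a small constant in front of the first factor. -/
theorem exists_rpow_sub_one_mul_le_left (S : ℝ) {δ : ℝ} (hδ : 0 < δ) :
    ∃ C : ℝ, 0 ≤ C ∧ ∀ s x y : ℝ, 1 < s → s ≤ S → 0 ≤ x → 0 ≤ y →
      x ^ (s - 1) * y ≤ δ * x ^ s + C * y ^ s := by
  -- Split at `y = δ x`. Above it, `x ≤ δ⁻¹ y` costs `δ⁻¹` to the power `s - 1`, and `max 1 δ⁻¹ ^ S`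
  -- dominates this for all `s ≤ S`.
  refine ⟨max 1 δ⁻¹ ^ S, by positivity, fun s x y h1 hS hx hy => ?_⟩
  have hC : 0 ≤ max 1 δ⁻¹ ^ S * y ^ s := by positivity
  have hxs : 0 ≤ δ * x ^ s := by positivity
  rcases le_or_gt y (δ * x) with h | h
  · calc x ^ (s - 1) * y ≤ x ^ (s - 1) * (δ * x) := by gcongr
      _ = δ * x ^ s := by rw [← Real.rpow_sub_one_mul_self hx h1]; ring
      _ ≤ _ := by linarith
  · have h2 : x ≤ max 1 δ⁻¹ * y := by
      have : x ≤ δ⁻¹ * y := by rw [le_inv_mul_iff₀ hδ]; exact h.le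
      exact this.trans (by gcongr; exact le_max_right _ _)
    calc x ^ (s - 1) * y ≤ (max 1 δ⁻¹ * y) ^ (s - 1) * y := by
          gcongr
      _ = max 1 δ⁻¹ ^ (s - 1) * y ^ s := by
          rw [Real.mul_rpow (by positivity) hy, ← Real.rpow_sub_one_mul_self hy h1]; ring
      _ ≤ max 1 δ⁻¹ ^ S * y ^ s := by
          gcongr
          · exact le_max_left _ _
          · linarith
      _ ≤ _ := by linarith

/-- Young's inequality with a small constant in front of the second factor. -/
theorem exists_rpow_sub_one_mul_le_right {σ : ℝ} (hσ : 1 < σ) {δ : ℝ} (hδ : 0 < δ) :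
    ∃ C : ℝ, 0 ≤ C ∧ ∀ s x y : ℝ, σ ≤ s → 0 ≤ x → 0 ≤ y →
      x ^ (s - 1) * y ≤ δ * y ^ s + C * x ^ s := by
  -- The threshold `D` must satisfy `D ^ (s - 1) ≥ δ⁻¹` for all `s ≥ σ`; this is why the exponents
  -- have to stay away from `1`, whereas no upper bound on them is needed.
  refine ⟨max 1 δ⁻¹ ^ (σ - 1)⁻¹, by positivity, fun s x y h1 hx hy => ?_⟩
  set D := max 1 δ⁻¹ ^ (σ - 1)⁻¹ with hD
  have hs : 1 < s := by linarith
  have hC : 0 ≤ D * x ^ s := by positivity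
  have hys : 0 ≤ δ * y ^ s := by positivity
  have hD1 : 1 ≤ D := Real.one_le_rpow (le_max_left _ _) (by rw [inv_nonneg]; linarith)
  rcases le_or_gt y (D * x) with h | h
  · calc x ^ (s - 1) * y ≤ x ^ (s - 1) * (D * x) := by gcongr
      _ = D * x ^ s := by rw [← Real.rpow_sub_one_mul_self hx hs]; ring
      _ ≤ _ := by linarith
  · have h2 : δ⁻¹ ≤ D ^ (s - 1) := by
      calc δ⁻¹ ≤ max 1 δ⁻¹ := le_max_right _ _
        _ = D ^ (σ - 1) := by
          rw [hD, ← Real.rpow_mul (by positivity), inv_mul_cancel₀ (by linarith), Real.rpow_one]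
        _ ≤ D ^ (s - 1) := Real.rpow_le_rpow_of_exponent_le hD1 (by linarith)
    have h3 : δ⁻¹ * x ^ (s - 1) ≤ y ^ (s - 1) := by
      calc δ⁻¹ * x ^ (s - 1) ≤ D ^ (s - 1) * x ^ (s - 1) := by gcongr
        _ = (D * x) ^ (s - 1) := by rw [Real.mul_rpow (by positivity) hx]
        _ ≤ y ^ (s - 1) := by gcongr
    rw [inv_mul_le_iff₀ hδ] at h3
    calc x ^ (s - 1) * y ≤ δ * y ^ (s - 1) * y := by gcongr
      _ = δ * y ^ s := by rw [← Real.rpow_sub_one_mul_self hy hs]; ring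
      _ ≤ _ := by linarith

/-- Interpolation of an intermediate power between a higher power and the first power. -/
theorem exists_rpow_le_add {S ε : ℝ} (hε : 0 < ε) {η : ℝ} (hη : 0 < η) :
    ∃ C : ℝ, 0 ≤ C ∧ ∀ s t y : ℝ, 1 ≤ t → t + ε ≤ s → s ≤ S → 0 ≤ y →
      y ^ t ≤ η * y ^ s + C * y := by
  -- Beyond the threshold `Y`, `y ^ (s - t) ≥ y ^ ε ≥ η⁻¹`, so the higher power wins; below it, `y ^
  -- (t - 1)` is bounded by `Y ^ S`.
  set Y := max 1 η⁻¹ ^ ε⁻¹ with hY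
  have hY1 : 1 ≤ Y := Real.one_le_rpow (le_max_left _ _) (by positivity)
  refine ⟨Y ^ S, by positivity, fun s t y ht hts hs hy => ?_⟩
  have ha : 0 ≤ Y ^ S * y := by positivity
  have hb : 0 ≤ η * y ^ s := by positivity
  rcases le_or_gt y Y with h | h
  · calc y ^ t = y ^ (t - 1) * y := by
          nth_rewrite 3 [← Real.rpow_one y]
          rw [← Real.rpow_add_of_nonneg hy (by linarith) zero_le_one]
          congr 1; ring
      _ ≤ Y ^ (t - 1) * y := by gcongr
      _ ≤ Y ^ S * y := by
          gcongr
          linarith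
      _ ≤ _ := by linarith
  · have hy0 : 0 < y := by linarith
    have h1 : η⁻¹ ≤ y ^ (s - t) := by
      calc η⁻¹ ≤ max 1 η⁻¹ := le_max_right _ _
        _ = Y ^ ε := by
          rw [hY, ← Real.rpow_mul (by positivity), inv_mul_cancel₀ hε.ne', Real.rpow_one]
        _ ≤ y ^ ε := by gcongr
        _ ≤ y ^ (s - t) := Real.rpow_le_rpow_of_exponent_le (by linarith) (by linarith)
    have h2 : η⁻¹ * y ^ t ≤ y ^ s := by
      calc η⁻¹ * y ^ t ≤ y ^ (s - t) * y ^ t := by gcongr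
        _ = y ^ s := by rw [← Real.rpow_add hy0]; congr 1; ring
    rw [inv_mul_le_iff₀ hη] at h2
    linarith

variable {F : Type*} [NormedAddCommGroup F] [InnerProductSpace ℝ F]

/-- The duality map `a ↦ ‖a‖ ^ (s - 2) • a`. -/
noncomputable def powMap (s : ℝ) (a : F) : F := ‖a‖ ^ (s - 2) • a

theorem norm_powMap {s : ℝ} (hs : 1 < s) (a : F) : ‖powMap s a‖ = ‖a‖ ^ (s - 1) := by
  rw [powMap, norm_smul, Real.norm_of_nonneg (by positivity)]
  rcases eq_or_ne a 0 with rfl | ha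
  · simp [Real.zero_rpow (show s - 1 ≠ 0 by linarith)]
  · have : 0 < ‖a‖ := norm_pos_iff.2 ha
    nth_rewrite 2 [← Real.rpow_one ‖a‖]
    rw [← Real.rpow_add this]
    congr 1; ring

theorem inner_powMap_self {s : ℝ} (hs : 1 < s) (a : F) :
    inner ℝ (powMap s a) a = ‖a‖ ^ s := by
  rw [powMap, real_inner_smul_left, real_inner_self_eq_norm_sq]
  rcases eq_or_ne a 0 with rfl | ha
  · simp [Real.zero_rpow (show s ≠ 0 by linarith)]
  · have : 0 < ‖a‖ := norm_pos_iff.2 ha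
    rw [← Real.rpow_natCast, ← Real.rpow_add this]
    congr 1; push_cast; ring

theorem abs_inner_powMap_le {s : ℝ} (hs : 1 < s) (a b : F) :
    |inner ℝ (powMap s a) b| ≤ ‖a‖ ^ (s - 1) * ‖b‖ :=
  (abs_real_inner_le_norm _ _).trans_eq (by rw [norm_powMap hs])

/-- Convexity of `a ↦ ‖a‖ ^ s / s`. -/
theorem rpow_div_add_inner_powMap_le {s : ℝ} (hs : 1 < s) (a b : F) :
    ‖a‖ ^ s / s + inner ℝ (powMap s a) (b - a) ≤ ‖b‖ ^ s / s := by
  have h1 := (le_abs_self _).trans (abs_inner_powMap_le hs a b)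
  have hc : (Real.conjExponent s).HolderConjugate s :=
    (Real.HolderConjugate.conjExponent hs).symm
  have h2 := Real.young_inequality_of_nonneg (a := ‖a‖ ^ (s - 1)) (b := ‖b‖)
    (by positivity) (by positivity) hc
  have h3 : (‖a‖ ^ (s - 1)) ^ (Real.conjExponent s) = ‖a‖ ^ s := by
    rw [← Real.rpow_mul (by positivity), Real.conjExponent, mul_div_cancel₀ _ (by linarith)]
  have h4 : ‖a‖ ^ s / Real.conjExponent s = ‖a‖ ^ s - ‖a‖ ^ s / s := by
    have : s - 1 ≠ 0 := by linarith
    rw [Real.conjExponent]; field_simp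
  rw [inner_sub_right, inner_powMap_self hs]
  rw [h3, h4] at h2
  linarith

/-- The first order remainder of `a ↦ ‖a‖ ^ s / s`. -/
theorem abs_rpow_div_remainder_le {s : ℝ} (hs : 1 < s) (a h : F) :
    |‖a + h‖ ^ s / s - ‖a‖ ^ s / s - inner ℝ (powMap s a) h| ≤
      ‖powMap s (a + h) - powMap s a‖ * ‖h‖ := by
  -- The tangent inequality at `a` makes the remainder nonnegative; the one at `a + h` bounds it by
  -- `⟨powMap s (a + h) - powMap s a, h⟩`.
  have h1 := rpow_div_add_inner_powMap_le hs a (a + h)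
  have h2 := rpow_div_add_inner_powMap_le hs (a + h) a
  have h3 : inner ℝ (powMap s (a + h) - powMap s a) h ≤
    ‖powMap s (a + h) - powMap s a‖ * ‖h‖ := real_inner_le_norm _ _
  rw [add_sub_cancel_left] at h1
  rw [sub_add_cancel_left, inner_neg_right] at h2
  rw [inner_sub_left] at h3
  rw [abs_of_nonneg (by linarith)]
  linarith

/-- By homogeneity only the ratio of `‖h‖` to `‖a‖` matters. If `‖h‖ ≤ η ‖a‖`, the relative change
of `powMap s` is small, uniformly in `s ∈ (1, S]`; if `‖h‖ > η ‖a‖`, both values are bounded by a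
multiple of `‖h‖ ^ (s - 1)`. One constant serving all exponents is what permits integration in `x`
later. -/
theorem exists_norm_powMap_add_sub_le (S : ℝ) {ε : ℝ} (hε : 0 < ε) :
    ∃ C : ℝ, 0 ≤ C ∧ ∀ (s : ℝ) (a h : F), 1 < s → s ≤ S →
      ‖powMap s (a + h) - powMap s a‖ ≤ ε * ‖a‖ ^ (s - 1) + C * ‖h‖ ^ (s - 1) := by
  set m := |S| + 2 with hm
  have hm0 : 0 < m := by positivity
  -- With `τ = ‖a + h‖ / ‖a‖ ∈ [1 - η, 1 + η]` and `|s - 2| ≤ m`, the power `τ ^ (s - 2)` lies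
  -- between `(1 - η) ^ m` and `(1 - η) ^ (-m)`. The displayed function adds both deviations from
  -- `1` and so dominates the relative change.
  have hlim : Tendsto (fun η : ℝ => ((1 - η) ^ (-m) - 1) * (1 + η) + η +
      ((1 - (1 - η) ^ m) * (1 + η) + η)) (𝓝 0) (𝓝 0) := by
    have : ContinuousAt (fun η : ℝ => ((1 - η) ^ (-m) - 1) * (1 + η) + η +
      ((1 - (1 - η) ^ m) * (1 + η) + η)) 0 := by
      have h1 : ContinuousAt (fun η : ℝ => (1 - η) ^ (-m)) 0 :=
        ContinuousAt.rpow_const (by fun_prop) (Or.inl (by norm_num))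
      have h2 : ContinuousAt (fun η : ℝ => (1 - η) ^ m) 0 :=
        ContinuousAt.rpow_const (by fun_prop) (Or.inl (by norm_num))
      fun_prop
    simpa [ContinuousAt] using this
  have hev := (hlim.eventually (gt_mem_nhds hε)).filter_mono (nhdsWithin_le_nhds (s := Ioi 0))
  have hev2 : ∀ᶠ η : ℝ in 𝓝[>] 0, η < 1 / 2 :=
    (gt_mem_nhds (by norm_num)).filter_mono nhdsWithin_le_nhds
  obtain ⟨η, ⟨hηε, hη1⟩, hη0⟩ := ((hev.and hev2).and self_mem_nhdsWithin).exists
  have hη0 : 0 < η := hη0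
  refine ⟨2 * (1 + η⁻¹) ^ m, by positivity, fun s a h hs hsS => ?_⟩
  have hS : S ≤ |S| := le_abs_self S
  rcases le_or_gt ‖h‖ (η * ‖a‖) with hh | hh
  · have hC : 0 ≤ 2 * (1 + η⁻¹) ^ m * ‖h‖ ^ (s - 1) := by positivity
    suffices ‖powMap s (a + h) - powMap s a‖ ≤ ε * ‖a‖ ^ (s - 1) by linarith
    rcases eq_or_ne a 0 with rfl | ha
    · have : h = 0 := by simpa using hh
      subst this
      simp; positivity
    have ha0 : 0 < ‖a‖ := norm_pos_iff.2 ha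
    have hup : ‖a + h‖ ≤ (1 + η) * ‖a‖ := by linarith [norm_add_le a h]
    have hlo : (1 - η) * ‖a‖ ≤ ‖a + h‖ := by
      have := norm_sub_le (a + h) h
      rw [add_sub_cancel_right] at this
      linarith
    set τ := ‖a + h‖ / ‖a‖ with hτ
    have hτa : ‖a + h‖ = τ * ‖a‖ := by rw [hτ]; field_simp
    have hτ1 : 1 - η ≤ τ := by rw [hτ, le_div_iff₀ ha0]; exact hlo
    have hτ2 : τ ≤ 1 + η := by rw [hτ, div_le_iff₀ ha0]; exact hup
    have hτ0 : 0 < τ := by linarith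
    have hinv : 1 + η ≤ (1 - η)⁻¹ := by
      rw [← one_div, le_div_iff₀ (by linarith)]
      nlinarith
    have h1η : (1:ℝ) ≤ (1 - η)⁻¹ := by linarith
    have hP1 : τ ^ (s - 2) ≤ (1 - η) ^ (-m) := by
      rcases le_total 0 (s - 2) with h2 | h2
      · calc τ ^ (s - 2) ≤ ((1 - η)⁻¹) ^ (s - 2) := by gcongr; linarith
          _ ≤ ((1 - η)⁻¹) ^ m := Real.rpow_le_rpow_of_exponent_le h1η (by linarith)
          _ = _ := by rw [Real.rpow_neg (by linarith), Real.inv_rpow (by linarith)]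
      · calc τ ^ (s - 2) ≤ (1 - η) ^ (s - 2) :=
            Real.rpow_le_rpow_of_nonpos (by linarith) hτ1 h2
          _ ≤ (1 - η) ^ (-m) := Real.rpow_le_rpow_of_exponent_ge (by linarith) (by linarith)
              (by linarith [abs_nonneg S])
    have hP2 : (1 - η) ^ m ≤ τ ^ (s - 2) := by
      rcases le_total 0 (s - 2) with h2 | h2
      · calc (1 - η) ^ m ≤ (1 - η) ^ (s - 2) :=
            Real.rpow_le_rpow_of_exponent_ge (by linarith) (by linarith) (by linarith)
          _ ≤ _ := by gcongr; linarith
      · calc (1 - η) ^ m ≤ (1 - η) ^ (-(s - 2)) :=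
            Real.rpow_le_rpow_of_exponent_ge (by linarith) (by linarith)
              (by linarith [abs_nonneg S])
          _ = ((1 - η)⁻¹) ^ (s - 2) := by
            rw [Real.rpow_neg (by linarith), Real.inv_rpow (by linarith)]
          _ ≤ _ := Real.rpow_le_rpow_of_nonpos hτ0 (by linarith) h2
    have hle1 : (1 - η) ^ m ≤ 1 := Real.rpow_le_one (by linarith) (by linarith) hm0.le
    have hge1 : 1 ≤ (1 - η) ^ (-m) :=
      Real.one_le_rpow_of_pos_of_le_one_of_nonpos (by linarith) (by linarith) (by linarith)
    have key : |τ ^ (s - 2) - 1| * (1 + η) + η ≤ ε := by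
      have : |τ ^ (s - 2) - 1| ≤ ((1 - η) ^ (-m) - 1) + (1 - (1 - η) ^ m) := by
        rw [abs_le]; constructor <;> linarith
      nlinarith
    have hexp : powMap s (a + h) - powMap s a =
        ‖a‖ ^ (s - 2) • ((τ ^ (s - 2) - 1) • (a + h) + h) := by
      rw [powMap, powMap, hτa, Real.mul_rpow hτ0.le ha0.le, mul_comm]
      module
    rw [hexp, norm_smul, Real.norm_of_nonneg (by positivity)]
    calc ‖a‖ ^ (s - 2) * ‖(τ ^ (s - 2) - 1) • (a + h) + h‖
        ≤ ‖a‖ ^ (s - 2) * (|τ ^ (s - 2) - 1| * ((1 + η) * ‖a‖) + η * ‖a‖) := by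
          gcongr
          refine (norm_add_le _ _).trans ?_
          rw [norm_smul, Real.norm_eq_abs]
          gcongr
      _ = (|τ ^ (s - 2) - 1| * (1 + η) + η) * (‖a‖ ^ (s - 2) * ‖a‖) := by ring
      _ ≤ ε * (‖a‖ ^ (s - 2) * ‖a‖) := by gcongr
      _ = ε * ‖a‖ ^ (s - 1) := by
          congr 1
          nth_rewrite 2 [← Real.rpow_one ‖a‖]
          rw [← Real.rpow_add ha0]; congr 1; ring
  · have hE : 0 ≤ ε * ‖a‖ ^ (s - 1) := by positivity
    have ha : ‖a‖ ≤ η⁻¹ * ‖h‖ := by rw [le_inv_mul_iff₀ hη0]; exact hh.le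
    have h1 : ‖a + h‖ ≤ (1 + η⁻¹) * ‖h‖ := by linarith [norm_add_le a h]
    have h2 : ‖a‖ ≤ (1 + η⁻¹) * ‖h‖ := by linarith [norm_nonneg h]
    have hb : ((1 + η⁻¹) * ‖h‖) ^ (s - 1) ≤ (1 + η⁻¹) ^ m * ‖h‖ ^ (s - 1) := by
      rw [Real.mul_rpow (by positivity) (by positivity)]
      gcongr
      · simp; positivity
      · linarith
    calc ‖powMap s (a + h) - powMap s a‖ ≤ ‖a + h‖ ^ (s - 1) + ‖a‖ ^ (s - 1) := by
          rw [← norm_powMap hs, ← norm_powMap hs]; exact norm_sub_le _ _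
      _ ≤ ((1 + η⁻¹) * ‖h‖) ^ (s - 1) + ((1 + η⁻¹) * ‖h‖) ^ (s - 1) := by
          gcongr
      _ ≤ _ := by linarith

/-- Young's inequality applied twice to the previous estimate multiplied by `‖e‖`. Keeping the
direction `e` separate from the increment `h` allows the choice `h = τ • e` with `τ` small, as
needed for differentiability. -/
theorem exists_norm_powMap_add_sub_mul_le {σ : ℝ} (hσ : 1 < σ) (S : ℝ) {ε : ℝ} (hε : 0 < ε) :
    ∃ C : ℝ, 0 ≤ C ∧ ∀ (s : ℝ) (a h e : F), σ ≤ s → s ≤ S →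
      ‖powMap s (a + h) - powMap s a‖ * ‖e‖ ≤ ε * (‖a‖ ^ s + ‖e‖ ^ s) + C * ‖h‖ ^ s := by
  obtain ⟨C₁, hC₁, h₁⟩ := exists_rpow_sub_one_mul_le_right hσ (one_pos)
  obtain ⟨C₂, hC₂, h₂⟩ := exists_norm_powMap_add_sub_le (F := F) S
    (show 0 < ε / (2 * (1 + C₁)) by positivity)
  obtain ⟨C₃, hC₃, h₃⟩ := exists_rpow_sub_one_mul_le_right hσ
    (show 0 < ε / (2 * (1 + C₂)) by positivity)
  refine ⟨C₂ * C₃, by positivity, fun s a h e hs hS => ?_⟩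
  have e1 := h₁ s ‖a‖ ‖e‖ hs (by positivity) (by positivity)
  have e2 := h₂ s a h (by linarith) hS
  have e3 := h₃ s ‖h‖ ‖e‖ hs (by positivity) (by positivity)
  have hA : 0 ≤ ‖a‖ ^ s := by positivity
  have hE : 0 ≤ ‖e‖ ^ s := by positivity
  calc ‖powMap s (a + h) - powMap s a‖ * ‖e‖
      ≤ (ε / (2 * (1 + C₁)) * ‖a‖ ^ (s - 1) + C₂ * ‖h‖ ^ (s - 1)) * ‖e‖ := by gcongr
    _ = ε / (2 * (1 + C₁)) * (‖a‖ ^ (s - 1) * ‖e‖) + C₂ * (‖h‖ ^ (s - 1) * ‖e‖) := by ring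
    _ ≤ ε / (2 * (1 + C₁)) * (1 * ‖e‖ ^ s + C₁ * ‖a‖ ^ s) +
        C₂ * (ε / (2 * (1 + C₂)) * ‖e‖ ^ s + C₃ * ‖h‖ ^ s) := by gcongr
    _ ≤ ε / (2 * (1 + C₁)) * ((1 + C₁) * ‖e‖ ^ s + (1 + C₁) * ‖a‖ ^ s) +
        ((1 + C₂) * (ε / (2 * (1 + C₂)) * ‖e‖ ^ s) + C₂ * (C₃ * ‖h‖ ^ s)) := by
        rw [mul_add C₂]
        gcongr <;> nlinarith
    _ ≤ _ := by
        have : ε / (2 * (1 + C₁)) * ((1 + C₁) * ‖e‖ ^ s + (1 + C₁) * ‖a‖ ^ s) +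
          (1 + C₂) * (ε / (2 * (1 + C₂)) * ‖e‖ ^ s) = ε * (‖e‖ ^ s + ‖a‖ ^ s / 2) := by
          field_simp; ring
        nlinarith

theorem continuous_powMap {s : ℝ} (hs : 1 < s) : Continuous (powMap s : F → F) := by
  rw [continuous_iff_continuousAt]
  intro a
  rw [ContinuousAt, tendsto_iff_norm_sub_tendsto_zero]
  refine Metric.tendsto_nhds.2 fun ε hε => ?_
  obtain ⟨C, hC, h⟩ := exists_norm_powMap_add_sub_le (F := F) s
    (show 0 < ε / (2 * (1 + ‖a‖ ^ (s - 1))) by positivity)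
  have h0 : Tendsto (fun b : F => C * ‖b - a‖ ^ (s - 1)) (𝓝 a) (𝓝 0) := by
    have : Continuous fun b : F => C * ‖b - a‖ ^ (s - 1) := by
      have : Continuous fun b : F => ‖b - a‖ := by fun_prop
      exact continuous_const.mul (this.rpow_const fun _ => Or.inr (by linarith))
    simpa [Real.zero_rpow (show s - 1 ≠ 0 by linarith)] using this.tendsto a
  filter_upwards [h0.eventually (gt_mem_nhds (show 0 < ε / 2 by positivity))] with b hb
  have := h s a (b - a) hs le_rfl
  rw [add_sub_cancel] at this
  rw [Real.dist_eq, sub_zero, abs_of_nonneg (by positivity)]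
  have h2 : ε / (2 * (1 + ‖a‖ ^ (s - 1))) * ‖a‖ ^ (s - 1) ≤ ε / 2 := by
    have : 0 ≤ ‖a‖ ^ (s - 1) := by positivity
    rw [div_mul_eq_mul_div, div_le_div_iff₀ (by positivity) (by positivity)]
    nlinarith
  linarith

/-- Splits the monotonicity form into a radial part, measuring the difference of the norms, and an
angular part, the defect in the Cauchy–Schwarz inequality. Both are nonnegative, hence both are
controlled by their sum. -/
theorem inner_powMap_sub_eq {s : ℝ} (hs : 1 < s) (a b : F) :
    inner ℝ (powMap s a - powMap s b) (a - b) =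
      (‖a‖ ^ (s - 1) - ‖b‖ ^ (s - 1)) * (‖a‖ - ‖b‖) +
        (‖a‖ ^ (s - 2) + ‖b‖ ^ (s - 2)) * (‖a‖ * ‖b‖ - inner ℝ a b) := by
  have key : ∀ c : F, ‖c‖ ^ (s - 1) = ‖c‖ ^ (s - 2) * ‖c‖ := fun c => by
    rw [← norm_powMap hs, powMap, norm_smul, Real.norm_of_nonneg (by positivity)]
  rw [key, key, inner_sub_left, inner_sub_right, inner_sub_right, powMap, powMap]
  simp only [real_inner_smul_left, real_inner_self_eq_norm_sq]
  rw [real_inner_comm b a]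
  ring

theorem rpow_sub_mul_sub_nonneg {t x y : ℝ} (ht : 0 ≤ t) (hx : 0 ≤ x) (hy : 0 ≤ y) :
    0 ≤ (x ^ t - y ^ t) * (x - y) := by
  rcases le_total x y with h | h
  · exact mul_nonneg_of_nonpos_of_nonpos (by linarith [Real.rpow_le_rpow hx h ht]) (by linarith)
  · exact mul_nonneg (by linarith [Real.rpow_le_rpow hy h ht]) (by linarith)

theorem inner_powMap_sub_nonneg {s : ℝ} (hs : 1 < s) (a b : F) :
    0 ≤ inner ℝ (powMap s a - powMap s b) (a - b) := by
  rw [inner_powMap_sub_eq hs]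
  have h1 := rpow_sub_mul_sub_nonneg (t := s - 1) (by linarith) (norm_nonneg a) (norm_nonneg b)
  have h2 := real_inner_le_norm a b
  have : 0 ≤ (‖a‖ ^ (s - 2) + ‖b‖ ^ (s - 2)) * (‖a‖ * ‖b‖ - inner ℝ a b) :=
    mul_nonneg (by positivity) (by linarith)
  linarith

/-- Since `x ↦ x ^ t` is strictly increasing, the product is bounded below by a positive constant as
soon as `x n` is at distance at least `ε` from `y`, on either side. -/
theorem tendsto_of_rpow_sub_mul_sub {t : ℝ} (ht : 0 < t) {x : ℕ → ℝ} {y : ℝ}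
    (hx : ∀ n, 0 ≤ x n) (hy : 0 ≤ y)
    (h : Tendsto (fun n => (x n ^ t - y ^ t) * (x n - y)) atTop (𝓝 0)) :
    Tendsto x atTop (𝓝 y) := by
  refine Metric.tendsto_nhds.2 fun ε hε => ?_
  have hup : 0 < ((y + ε) ^ t - y ^ t) * ε :=
    mul_pos (by linarith [Real.rpow_lt_rpow hy (by linarith : y < y + ε) ht]) hε
  have e1 := h.eventually (gt_mem_nhds hup)
  have e2 : ∀ᶠ n in atTop, y - ε < x n := by
    rcases lt_or_ge y ε with h' | h'
    · exact Eventually.of_forall fun n => by linarith [hx n]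
    have hlo : 0 < (y ^ t - (y - ε) ^ t) * ε :=
      mul_pos (by linarith [Real.rpow_lt_rpow (by linarith) (by linarith : y - ε < y) ht]) hε
    filter_upwards [h.eventually (gt_mem_nhds hlo)] with n hn
    by_contra! hc
    have h1 := Real.rpow_le_rpow (hx n) hc ht.le
    have h2 : (y ^ t - (y - ε) ^ t) * ε ≤ (y ^ t - x n ^ t) * (y - x n) :=
      mul_le_mul (by linarith) (by linarith) hε.le
        (by linarith [Real.rpow_le_rpow (hx n) (by linarith : x n ≤ y) ht.le])
    linarith
  filter_upwards [e1, e2] with n h1 h2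
  rw [Real.dist_eq, abs_lt]
  refine ⟨by linarith, ?_⟩
  by_contra! hc
  have h3 := Real.rpow_le_rpow (by linarith) (by linarith : y + ε ≤ x n) ht.le
  have h4 : ((y + ε) ^ t - y ^ t) * ε ≤ (x n ^ t - y ^ t) * (x n - y) :=
    mul_le_mul (by linarith) hc hε.le
      (by linarith [Real.rpow_le_rpow hy (by linarith : y ≤ x n) ht.le])
  linarith

/-- Strict monotonicity of `powMap s`, in sequential form. -/
theorem tendsto_of_inner_powMap_sub {s : ℝ} (hs : 1 < s) {a : ℕ → F} {b : F}
    (h : Tendsto (fun n => inner ℝ (powMap s (a n) - powMap s b) (a n - b)) atTop (𝓝 0)) :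
    Tendsto a atTop (𝓝 b) := by
  simp only [inner_powMap_sub_eq hs] at h
  have p1 : ∀ n, 0 ≤ (‖a n‖ ^ (s - 1) - ‖b‖ ^ (s - 1)) * (‖a n‖ - ‖b‖) := fun n =>
    rpow_sub_mul_sub_nonneg (by linarith) (norm_nonneg _) (norm_nonneg _)
  have p2 : ∀ n, 0 ≤ ‖a n‖ * ‖b‖ - inner ℝ (a n) b := fun n => by
    linarith [real_inner_le_norm (a n) b]
  -- The radial part alone forces the norms to converge.
  have hn : Tendsto (fun n => ‖a n‖) atTop (𝓝 ‖b‖) := by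
    refine tendsto_of_rpow_sub_mul_sub (t := s - 1) (by linarith) (fun _ => norm_nonneg _)
      (norm_nonneg _) (squeeze_zero p1 (fun n => ?_) h)
    have : 0 ≤ (‖a n‖ ^ (s - 2) + ‖b‖ ^ (s - 2)) * (‖a n‖ * ‖b‖ - inner ℝ (a n) b) :=
      mul_nonneg (by positivity) (p2 n)
    linarith
  rcases eq_or_ne b 0 with rfl | hb
  · rw [tendsto_zero_iff_norm_tendsto_zero]; simpa using hn
  have hb0 : 0 < ‖b‖ ^ (s - 2) := Real.rpow_pos_of_pos (norm_pos_iff.2 hb) _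
  -- The coefficient of the angular part is at least `‖b‖ ^ (s - 2) > 0`, so the Cauchy–Schwarz
  -- defect tends to `0`; with the convergence of norms this gives `‖a n - b‖ → 0`.
  have hi : Tendsto (fun n => ‖a n‖ * ‖b‖ - inner ℝ (a n) b) atTop (𝓝 0) := by
    have h' := h.const_mul ((‖b‖ ^ (s - 2))⁻¹)
    rw [mul_zero] at h'
    refine squeeze_zero p2 (fun n => ?_) h'
    rw [le_inv_mul_iff₀ hb0]
    have : 0 ≤ ‖a n‖ ^ (s - 2) := by positivity
    nlinarith [p1 n, p2 n]
  rw [tendsto_iff_norm_sub_tendsto_zero]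
  have hsq : Tendsto (fun n => ‖a n - b‖ ^ 2) atTop (𝓝 0) := by
    have e : ∀ n, ‖a n - b‖ ^ 2 =
        (‖a n‖ - ‖b‖) ^ 2 + 2 * (‖a n‖ * ‖b‖ - inner ℝ (a n) b) := fun n => by
      rw [norm_sub_sq_real]; ring
    simp only [e]
    simpa using ((hn.sub_const ‖b‖).pow 2).add (hi.const_mul 2)
  have := hsq.sqrt
  simpa [Real.sqrt_sq (norm_nonneg _)] using this

end Elementary

/-! ### Integral functionals on variable exponent Lebesgue spaces -/

section Functionals

theorem rpow_sub_one_mul_le_add {s x y : ℝ} (hs : 1 < s) (hx : 0 ≤ x) (hy : 0 ≤ y) :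
    x ^ (s - 1) * y ≤ x ^ s + y ^ s := by
  have h1 : 0 ≤ x ^ s := by positivity
  have h2 : 0 ≤ y ^ s := by positivity
  rcases le_total x y with h | h
  · calc x ^ (s - 1) * y ≤ y ^ (s - 1) * y := by gcongr
      _ = y ^ s := Real.rpow_sub_one_mul_self hy hs
      _ ≤ _ := by linarith
  · calc x ^ (s - 1) * y ≤ x ^ (s - 1) * x := by gcongr
      _ = x ^ s := Real.rpow_sub_one_mul_self hx hs
      _ ≤ _ := by linarith

variable {N : ℕ} {F : Type*} [NormedAddCommGroup F] [InnerProductSpace ℝ F]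

theorem modular_eq_lintegral_ofReal (s : VarExponent N) (w : RN N → F) :
    modular s w = ∫⁻ x, ENNReal.ofReal (‖w x‖ ^ s x) := by
  refine lintegral_congr_ae ?_
  filter_upwards [s.one_le'] with x hx
  rw [← ofReal_norm, ENNReal.ofReal_rpow_of_nonneg (norm_nonneg _) (by linarith)]

theorem aestronglyMeasurable_norm_rpow (s : VarExponent N) {w : RN N → F}
    (hw : AEStronglyMeasurable w volume) :
    AEStronglyMeasurable (fun x => ‖w x‖ ^ s x) volume :=
  (hw.norm.aemeasurable.pow s.measurable'.aemeasurable).aestronglyMeasurable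

theorem integrable_norm_rpow_iff (s : VarExponent N) {w : RN N → F}
    (hw : AEStronglyMeasurable w volume) :
    Integrable (fun x => ‖w x‖ ^ s x) ↔ modular s w < ⊤ := by
  rw [modular_eq_lintegral_ofReal, ← hasFiniteIntegral_iff_ofReal
    (Eventually.of_forall fun x => by positivity)]
  exact ⟨fun h => h.2, fun h => ⟨aestronglyMeasurable_norm_rpow s hw, h⟩⟩

theorem integral_norm_rpow_eq_toReal (s : VarExponent N) {w : RN N → F}
    (hw : AEStronglyMeasurable w volume) :
    ∫ x, ‖w x‖ ^ s x = (modular s w).toReal := by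
  rw [modular_eq_lintegral_ofReal, integral_eq_lintegral_of_nonneg_ae
    (Eventually.of_forall fun x => by positivity) (aestronglyMeasurable_norm_rpow s hw)]

theorem VarLp.stronglyMeasurable {s : VarExponent N} (u : VarLp s F) : StronglyMeasurable u.fn :=
  AEEqFun.stronglyMeasurable _

theorem VarLp.integrable_norm_rpow {s : VarExponent N} (u : VarLp s F) :
    Integrable (fun x => ‖u.fn x‖ ^ s x) :=
  (integrable_norm_rpow_iff s u.aestronglyMeasurable).2 u.modular_lt_top

theorem aestronglyMeasurable_powMap (s : VarExponent N) {w : RN N → F}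
    (hw : AEStronglyMeasurable w volume) :
    AEStronglyMeasurable (fun x => powMap (s x) (w x)) volume :=
  (hw.norm.aemeasurable.pow
    (s.measurable'.sub_const 2).aemeasurable).aestronglyMeasurable.smul hw

variable {s : VarExponent N} {σ : ℝ} {c : RN N → ℝ} {K : ℝ}

theorem abs_mul_inner_powMap_le {t : ℝ} (ht : 1 < t) {c K : ℝ} (hc : |c| ≤ K) (a b : F) :
    |c * inner ℝ (powMap t a) b| ≤ K * (‖a‖ ^ (t - 1) * ‖b‖) := by
  rw [abs_mul]
  exact mul_le_mul hc (abs_inner_powMap_le ht a b) (abs_nonneg _) ((abs_nonneg _).trans hc)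

theorem integrable_mul_inner_powMap (hσ : 1 < σ) (hs : ∀ᵐ x, σ ≤ s x)
    (hc : Measurable c) (hcK : ∀ x, |c x| ≤ K) {w b : RN N → F}
    (hwm : AEStronglyMeasurable w volume) (hw : Integrable fun x => ‖w x‖ ^ s x)
    (hbm : AEStronglyMeasurable b volume) (hb : Integrable fun x => ‖b x‖ ^ s x) :
    Integrable fun x => c x * inner ℝ (powMap (s x) (w x)) (b x) := by
  refine ((hw.add hb).const_mul K).mono'
    (hc.aestronglyMeasurable.mul ((aestronglyMeasurable_powMap s hwm).inner hbm)) ?_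
  filter_upwards [hs] with x hx
  have hK : 0 ≤ K := (abs_nonneg _).trans (hcK x)
  refine (abs_mul_inner_powMap_le (by linarith) (hcK x) _ _).trans ?_
  exact mul_le_mul_of_nonneg_left
    (rpow_sub_one_mul_le_add (by linarith) (norm_nonneg _) (norm_nonneg _)) hK

theorem abs_integral_mul_inner_powMap_le (hσ : 1 < σ) (hs : ∀ᵐ x, σ ≤ s x)
    (hcK : ∀ x, |c x| ≤ K) {w b : RN N → F}
    (hw : Integrable fun x => ‖w x‖ ^ s x) (hb : Integrable fun x => ‖b x‖ ^ s x) :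
    |∫ x, c x * inner ℝ (powMap (s x) (w x)) (b x)| ≤
      K * ((∫ x, ‖w x‖ ^ s x) + ∫ x, ‖b x‖ ^ s x) := by
  rw [← integral_add hw hb, ← integral_const_mul, ← Real.norm_eq_abs]
  refine norm_integral_le_of_norm_le ((hw.add hb).const_mul K) ?_
  filter_upwards [hs] with x hx
  have hK : 0 ≤ K := (abs_nonneg _).trans (hcK x)
  refine (abs_mul_inner_powMap_le (by linarith) (hcK x) _ _).trans ?_
  exact mul_le_mul_of_nonneg_left
    (rpow_sub_one_mul_le_add (by linarith) (norm_nonneg _) (norm_nonneg _)) hK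

variable {X : Type*} [NormedAddCommGroup X] [NormedSpace ℝ X]

/-- Rescale to norm `1 / 2`. Only the open unit ball is used because there the Luxemburg norm bounds
the modular by `1` directly, without asking whether the defining infimum is attained. -/
theorem LinearMap.exists_bound_of_abs_le_on_ball (L : X →ₗ[ℝ] ℝ) {C : ℝ}
    (h : ∀ v, ‖v‖ < 1 → |L v| ≤ C) : ∃ D, ∀ v, ‖L v‖ ≤ D * ‖v‖ := by
  refine ⟨2 * C, fun v => ?_⟩
  rcases eq_or_ne v 0 with rfl | hv
  · simp
  have hv0 : 0 < ‖v‖ := norm_pos_iff.2 hv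
  have h1 := h ((2 * ‖v‖)⁻¹ • v) (by
    rw [norm_smul, Real.norm_of_nonneg (by positivity)]
    field_simp; norm_num)
  rw [map_smul, smul_eq_mul, abs_mul, abs_of_nonneg (by positivity : 0 ≤ (2 * ‖v‖)⁻¹),
    inv_mul_le_iff₀ (by positivity)] at h1
  rw [Real.norm_eq_abs]
  linarith

/-- The functional `v ↦ ∫ c ⟨‖w‖ ^ (s - 2) w, T v⟩` is bounded. -/
theorem exists_clm_integral_mul_inner_powMap (hσ : 1 < σ) (hs : ∀ᵐ x, σ ≤ s x)
    (hc : Measurable c) (hcK : ∀ x, |c x| ≤ K) (T : X →ₗ[ℝ] VarLp s F) {B : ℝ}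
    (hT : ∀ v, ‖v‖ < 1 → ∫ x, ‖(T v).fn x‖ ^ s x ≤ B) (w : VarLp s F) :
    ∃ L : X →L[ℝ] ℝ, ∀ v, L v = ∫ x, c x * inner ℝ (powMap (s x) (w.fn x)) ((T v).fn x) := by
  have hi : ∀ v : VarLp s F,
      Integrable fun x => c x * inner ℝ (powMap (s x) (w.fn x)) (v.fn x) := fun v =>
    integrable_mul_inner_powMap hσ hs hc hcK w.aestronglyMeasurable w.integrable_norm_rpow
      v.aestronglyMeasurable v.integrable_norm_rpow
  let L : X →ₗ[ℝ] ℝ :=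
    { toFun := fun v => ∫ x, c x * inner ℝ (powMap (s x) (w.fn x)) ((T v).fn x)
      map_add' := fun v v' => by
        rw [← integral_add (hi _) (hi _)]
        refine integral_congr_ae ?_
        filter_upwards [VarLp.fn_add (T v) (T v')] with x hx
        rw [map_add, hx, Pi.add_apply, inner_add_right, mul_add]
      map_smul' := fun a v => by
        rw [RingHom.id_apply, smul_eq_mul, ← integral_const_mul]
        refine integral_congr_ae ?_
        filter_upwards [VarLp.fn_smul a (T v)] with x hx
        rw [map_smul, hx, Pi.smul_apply, real_inner_smul_right]
        ring }
  have hK : 0 ≤ K := (abs_nonneg _).trans (hcK 0)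
  have hb : ∀ v, ‖v‖ < 1 → |L v| ≤ K * ((∫ x, ‖w.fn x‖ ^ s x) + B) := fun v hv => by
    refine (abs_integral_mul_inner_powMap_le hσ hs hcK w.integrable_norm_rpow
      (T v).integrable_norm_rpow).trans ?_
    gcongr
    exact hT v hv
  exact ⟨L.mkContinuousOfExistsBound (L.exists_bound_of_abs_le_on_ball hb), fun v => rfl⟩

theorem integrable_mul_norm_rpow_div (hσ : 1 < σ) (hs : ∀ᵐ x, σ ≤ s x)
    (hc : Measurable c) (hcK : ∀ x, |c x| ≤ K) (w : VarLp s F) :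
    Integrable fun x => c x / s x * ‖w.fn x‖ ^ s x := by
  refine (w.integrable_norm_rpow.const_mul K).mono'
    ((hc.div s.measurable').aestronglyMeasurable.mul
      (aestronglyMeasurable_norm_rpow s w.aestronglyMeasurable)) ?_
  filter_upwards [hs] with x hx
  rw [norm_mul, Real.norm_of_nonneg (by positivity : 0 ≤ ‖w.fn x‖ ^ s x)]
  gcongr
  rw [norm_div, Real.norm_eq_abs, Real.norm_of_nonneg (by linarith : 0 ≤ s x)]
  exact (div_le_self (abs_nonneg _) (by linarith)).trans (hcK x)

/-- Fréchet differentiability of `u ↦ ∫ c / s ‖T u‖ ^ s`. -/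
theorem hasFDerivAt_integral_mul_norm_rpow (hσ : 1 < σ) (hs : ∀ᵐ x, σ ≤ s x)
    (hc : Measurable c) (hcK : ∀ x, |c x| ≤ K) (T : X →ₗ[ℝ] VarLp s F) {B : ℝ}
    (hT : ∀ v, ‖v‖ < 1 → ∫ x, ‖(T v).fn x‖ ^ s x ≤ B) (u : X) (L : X →L[ℝ] ℝ)
    (hL : ∀ v, L v = ∫ x, c x * inner ℝ (powMap (s x) ((T u).fn x)) ((T v).fn x)) :
    HasFDerivAt (fun u => ∫ x, c x / s x * ‖(T u).fn x‖ ^ s x) L u := by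
  rw [hasFDerivAt_iff_isLittleO_nhds_zero, Asymptotics.isLittleO_iff]
  intro γ hγ
  obtain ⟨S, hS⟩ := s.bdd'
  have hK : 0 ≤ K := (abs_nonneg _).trans (hcK 0)
  have hB : 0 ≤ B := (integral_nonneg fun x => by positivity).trans (hT 0 (by simp))
  set A := ∫ x, ‖(T u).fn x‖ ^ s x with hA
  have hA0 : 0 ≤ A := integral_nonneg fun x => by positivity
  -- This parameter makes the contribution of the fixed function `T u` at most `γ / 4` per unit of
  -- `τ`; the summands `1` keep the denominator positive.
  obtain ⟨C, hC, hCle⟩ := exists_norm_powMap_add_sub_mul_le (F := F) hσ S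
    (show 0 < γ / (4 * ((1 + K) * (1 + A + B))) by positivity)
  set ε := γ / (4 * ((1 + K) * (1 + A + B))) with hε
  have hsmall : ∀ᶠ h : X in 𝓝 0, 2 * ‖h‖ < min 1 (γ / (4 * ((1 + K) * (1 + C * B)))) := by
    have : Continuous fun h : X => 2 * ‖h‖ := by fun_prop
    exact this.continuousAt.eventually (gt_mem_nhds (by simp; positivity))
  filter_upwards [hsmall] with h hh
  rcases eq_or_ne h 0 with rfl | hh0
  · simp
  have ht0 : 0 < ‖h‖ := norm_pos_iff.2 hh0
  -- The factor `2` gives `e = h / τ` norm `1 / 2`, so `hT` applies to `e`. One factor `τ` comes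
  -- from the increment in the remainder estimate, and a second from `τ ^ s ≤ τ`; the latter makes
  -- the `C` term small.
  set τ := 2 * ‖h‖ with hτ
  have hτ0 : 0 < τ := by positivity
  have hτ1 : τ ≤ 1 := (hh.trans_le (min_le_left _ _)).le
  have hτ2 : τ ≤ γ / (4 * ((1 + K) * (1 + C * B))) := (hh.trans_le (min_le_right _ _)).le
  set e := τ⁻¹ • h with he
  have hhe : h = τ • e := by rw [he, smul_smul, mul_inv_cancel₀ hτ0.ne', one_smul]
  have hen : ‖e‖ < 1 := by
    rw [he, norm_smul, Real.norm_of_nonneg (by positivity), hτ]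
    field_simp; norm_num
  have hTe := hT e hen
  have hiu := integrable_mul_norm_rpow_div hσ hs hc hcK (T u)
  have hiuh := integrable_mul_norm_rpow_div hσ hs hc hcK (T (u + h))
  have hil : Integrable fun x => c x * inner ℝ (powMap (s x) ((T u).fn x)) ((T h).fn x) :=
    integrable_mul_inner_powMap hσ hs hc hcK (T u).aestronglyMeasurable
      (T u).integrable_norm_rpow (T h).aestronglyMeasurable (T h).integrable_norm_rpow
  have hisub : Integrable fun x => c x / s x * ‖(T (u + h)).fn x‖ ^ s x -
      c x / s x * ‖(T u).fn x‖ ^ s x := hiuh.sub hiu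
  rw [hL, ← integral_sub hiuh hiu, ← integral_sub hisub hil]
  have hmaj₁ : Integrable fun x => ε * (‖(T u).fn x‖ ^ s x + ‖(T e).fn x‖ ^ s x) :=
    ((T u).integrable_norm_rpow.add (T e).integrable_norm_rpow).const_mul ε
  have hmaj₂ : Integrable fun x => C * (τ * ‖(T e).fn x‖ ^ s x) :=
    ((T e).integrable_norm_rpow.const_mul τ).const_mul C
  have hmaj : Integrable fun x => K * (τ * (ε * (‖(T u).fn x‖ ^ s x + ‖(T e).fn x‖ ^ s x)
      + C * (τ * ‖(T e).fn x‖ ^ s x))) :=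
    ((hmaj₁.add hmaj₂).const_mul τ).const_mul K
  refine (norm_integral_le_of_norm_le hmaj ?_).trans ?_
  · filter_upwards [hs, hS, VarLp.fn_add (T u) (T h), VarLp.fn_smul τ (T e)] with x h1 h2 h3 h4
    have hx1 : 1 < s x := by linarith
    rw [map_add, h3, hhe, map_smul, Pi.add_apply, h4, Pi.smul_apply]
    set a := (T u).fn x
    set b := (T e).fn x
    have e1 : c x / s x * ‖a + τ • b‖ ^ s x - c x / s x * ‖a‖ ^ s x -
        c x * inner ℝ (powMap (s x) a) (τ • b) =
        c x * (‖a + τ • b‖ ^ s x / s x - ‖a‖ ^ s x / s x - inner ℝ (powMap (s x) a) (τ • b)) := by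
      ring
    rw [e1, norm_mul, Real.norm_eq_abs, Real.norm_eq_abs]
    refine mul_le_mul (hcK x) ?_ (abs_nonneg _) hK
    refine (abs_rpow_div_remainder_le hx1 a (τ • b)).trans ?_
    rw [norm_smul, Real.norm_of_nonneg hτ0.le, mul_left_comm]
    refine mul_le_mul_of_nonneg_left ?_ hτ0.le
    refine (hCle (s x) a (τ • b) b h1 h2).trans ?_
    gcongr
    rw [norm_smul, Real.norm_of_nonneg hτ0.le, Real.mul_rpow hτ0.le (norm_nonneg _)]
    gcongr
    calc τ ^ s x ≤ τ ^ (1 : ℝ) := Real.rpow_le_rpow_of_exponent_ge hτ0 hτ1 hx1.le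
      _ = τ := Real.rpow_one τ
  · rw [integral_const_mul, integral_const_mul, integral_add hmaj₁ hmaj₂, integral_const_mul,
      integral_add (T u).integrable_norm_rpow (T e).integrable_norm_rpow, integral_const_mul,
      integral_const_mul]
    set E := ∫ x, ‖(T e).fn x‖ ^ s x
    have b1 : (1 + K) * (ε * (A + E)) ≤ γ / 4 := by
      calc (1 + K) * (ε * (A + E)) ≤ (1 + K) * (ε * (1 + A + B)) := by gcongr; linarith
        _ = γ / 4 := by rw [hε]; field_simp
    have b2 : (1 + K) * (C * (τ * E)) ≤ γ / 4 := by
      calc (1 + K) * (C * (τ * E)) ≤ (1 + K) * (C * (τ * B)) := by gcongr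
        _ = (1 + K) * (τ * (C * B)) := by ring
        _ ≤ (1 + K) * (γ / (4 * ((1 + K) * (1 + C * B))) * (1 + C * B)) := by gcongr; linarith
        _ = γ / 4 := by field_simp
    have hE : 0 ≤ E := integral_nonneg fun x => by positivity
    calc K * (τ * (ε * (A + E) + C * (τ * E)))
        ≤ (1 + K) * (τ * (ε * (A + E) + C * (τ * E))) := by gcongr; linarith
      _ = τ * ((1 + K) * (ε * (A + E)) + (1 + K) * (C * (τ * E))) := by ring
      _ ≤ τ * (γ / 4 + γ / 4) := by gcongr
      _ = γ * ‖h‖ := by rw [hτ]; ring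

/-- If `∫ ‖w n‖ ^ s` is bounded and `∫ ‖b n‖ ^ s → 0` then
`∫ c ⟨‖w n‖ ^ (s - 2) w n, b n⟩ → 0`. -/
theorem tendsto_integral_mul_inner_powMap_zero (hσ : 1 < σ) (hs : ∀ᵐ x, σ ≤ s x)
    (hcK : ∀ x, |c x| ≤ K) {w b : ℕ → RN N → F} {M : ℝ}
    (hw : ∀ n, Integrable fun x => ‖w n x‖ ^ s x) (hM : ∀ n, ∫ x, ‖w n x‖ ^ s x ≤ M)
    (hb : ∀ n, Integrable fun x => ‖b n x‖ ^ s x)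
    (hb0 : Tendsto (fun n => ∫ x, ‖b n x‖ ^ s x) atTop (𝓝 0)) :
    Tendsto (fun n => ∫ x, c x * inner ℝ (powMap (s x) (w n x)) (b n x)) atTop (𝓝 0) := by
  obtain ⟨S, hS⟩ := s.bdd'
  have hK : 0 ≤ K := (abs_nonneg _).trans (hcK 0)
  have hM0 : 0 ≤ M := (integral_nonneg fun x => by positivity).trans (hM 0)
  refine Metric.tendsto_nhds.2 fun ε hε => ?_
  obtain ⟨C, hC, hY⟩ := exists_rpow_sub_one_mul_le_left S
    (show 0 < ε / (2 * ((1 + K) * (1 + M))) by positivity)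
  set δ := ε / (2 * ((1 + K) * (1 + M))) with hδ
  have hlim : Tendsto (fun n => K * (C * ∫ x, ‖b n x‖ ^ s x)) atTop (𝓝 0) := by
    simpa using (hb0.const_mul C).const_mul K
  filter_upwards [hlim.eventually (gt_mem_nhds (show 0 < ε / 2 by positivity))] with n hn
  rw [dist_zero_right]
  have hmaj := (((hw n).const_mul δ).add ((hb n).const_mul C)).const_mul K
  refine (norm_integral_le_of_norm_le hmaj ?_).trans_lt ?_
  · filter_upwards [hs, hS] with x h1 h2
    refine (abs_mul_inner_powMap_le (by linarith) (hcK x) _ _).trans ?_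
    exact mul_le_mul_of_nonneg_left
      (hY _ _ _ (by linarith) h2 (norm_nonneg _) (norm_nonneg _)) hK
  · rw [integral_const_mul]
    simp only [Pi.add_apply]
    rw [integral_add ((hw n).const_mul δ) ((hb n).const_mul C),
      integral_const_mul, integral_const_mul, mul_add]
    have : K * (δ * ∫ x, ‖w n x‖ ^ s x) ≤ ε / 2 := by
      calc K * (δ * ∫ x, ‖w n x‖ ^ s x) ≤ (1 + K) * (δ * (1 + M)) := by
            have := hM n
            have : 0 ≤ ∫ x, ‖w n x‖ ^ s x := integral_nonneg fun x => by positivity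
            have hδ0 : 0 < δ := by positivity
            gcongr <;> linarith
        _ = ε / 2 := by rw [hδ]; field_simp
    linarith

/-- If `∫ ‖w n‖ ^ s` is bounded and `w n → w` almost everywhere then
`‖w n‖ ^ (s - 2) w n` converges weakly. -/
theorem tendsto_integral_mul_inner_powMap_of_ae (hσ : 1 < σ) (hs : ∀ᵐ x, σ ≤ s x)
    (hc : Measurable c) (hcK : ∀ x, |c x| ≤ K) {w : ℕ → VarLp s F} {w₀ : VarLp s F} {M : ℝ}
    (hM : ∀ n, ∫ x, ‖(w n).fn x‖ ^ s x ≤ M)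
    (hlim : ∀ᵐ x, Tendsto (fun n => (w n).fn x) atTop (𝓝 (w₀.fn x))) (b : VarLp s F) :
    Tendsto (fun n => ∫ x, c x * inner ℝ (powMap (s x) ((w n).fn x)) (b.fn x)) atTop
      (𝓝 (∫ x, c x * inner ℝ (powMap (s x) (w₀.fn x)) (b.fn x))) := by
  obtain ⟨S, hS⟩ := s.bdd'
  have hK : 0 ≤ K := (abs_nonneg _).trans (hcK 0)
  have hM0 : 0 ≤ M := (integral_nonneg fun x => by positivity).trans (hM 0)
  have hi : ∀ v : VarLp s F,
      Integrable fun x => c x * inner ℝ (powMap (s x) (v.fn x)) (b.fn x) := fun v =>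
    integrable_mul_inner_powMap hσ hs hc hcK v.aestronglyMeasurable v.integrable_norm_rpow
      b.aestronglyMeasurable b.integrable_norm_rpow
  set M₀ := ∫ x, ‖w₀.fn x‖ ^ s x with hM₀
  have hM₀0 : 0 ≤ M₀ := integral_nonneg fun x => by positivity
  set D : ℕ → RN N → ℝ := fun n x =>
    ‖powMap (s x) ((w n).fn x) - powMap (s x) (w₀.fn x)‖ * ‖b.fn x‖ with hD
  have hDm : ∀ n, AEStronglyMeasurable (D n) volume := fun n =>
    ((aestronglyMeasurable_powMap s (w n).aestronglyMeasurable).sub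
      (aestronglyMeasurable_powMap s w₀.aestronglyMeasurable)).norm.mul
        b.aestronglyMeasurable.norm
  rw [tendsto_iff_norm_sub_tendsto_zero]
  refine Metric.tendsto_nhds.2 fun ε hε => ?_
  obtain ⟨C, hC, hY⟩ := exists_rpow_sub_one_mul_le_left S
    (show 0 < ε / (2 * ((1 + K) * (1 + M + M₀))) by positivity)
  set δ := ε / (2 * ((1 + K) * (1 + M + M₀))) with hδ
  have hδ0 : 0 < δ := by positivity
  set Q : ℕ → RN N → ℝ := fun n x => δ * (‖(w n).fn x‖ ^ s x + ‖w₀.fn x‖ ^ s x) with hQ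
  have hQi : ∀ n, Integrable (Q n) := fun n =>
    ((w n).integrable_norm_rpow.add w₀.integrable_norm_rpow).const_mul δ
  have hDQ : ∀ n, ∀ᵐ x, D n x - Q n x ≤ 2 * C * ‖b.fn x‖ ^ s x := fun n => by
    filter_upwards [hs, hS] with x h1 h2
    have hx : 1 < s x := by linarith
    have e1 := hY (s x) ‖(w n).fn x‖ ‖b.fn x‖ hx h2 (norm_nonneg _) (norm_nonneg _)
    have e2 := hY (s x) ‖w₀.fn x‖ ‖b.fn x‖ hx h2 (norm_nonneg _) (norm_nonneg _)
    have e3 : D n x ≤ (‖(w n).fn x‖ ^ (s x - 1) + ‖w₀.fn x‖ ^ (s x - 1)) * ‖b.fn x‖ := by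
      simp only [hD]
      rw [← norm_powMap hx, ← norm_powMap hx]
      gcongr
      exact norm_sub_le _ _
    simp only [hQ]
    linarith
  -- The excess of `D n` over `Q n` is dominated by a fixed multiple of `‖b‖ ^ s`, so dominated
  -- convergence applies to it, although no dominating function for `D n` itself is known. The
  -- integral of `Q n` is uniformly small by the choice of `δ`.
  set P : ℕ → RN N → ℝ := fun n x => max (D n x - Q n x) 0 with hP
  have hPm : ∀ n, AEStronglyMeasurable (P n) volume := fun n =>
    ((hDm n).sub (hQi n).aestronglyMeasurable).sup aestronglyMeasurable_const
  have hPb : ∀ n, ∀ᵐ x, ‖P n x‖ ≤ 2 * C * ‖b.fn x‖ ^ s x := fun n => by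
    filter_upwards [hDQ n] with x hx
    rw [Real.norm_of_nonneg (le_max_right _ _)]
    exact max_le hx (by positivity)
  have hmajb := b.integrable_norm_rpow.const_mul (2 * C)
  have hPi : ∀ n, Integrable (P n) := fun n => hmajb.mono' (hPm n) (hPb n)
  have hPlim : Tendsto (fun n => ∫ x, P n x) atTop (𝓝 0) := by
    have := tendsto_integral_of_dominated_convergence (f := fun _ => (0 : ℝ)) _ hPm hmajb hPb (by
      filter_upwards [hs, hlim] with x h1 h2
      have hx : 1 < s x := by linarith
      have h3 : Tendsto (fun n => D n x) atTop (𝓝 0) := by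
        have := ((continuous_powMap hx).tendsto (w₀.fn x)).comp h2
        rw [tendsto_iff_norm_sub_tendsto_zero] at this
        simpa [hD] using this.mul_const ‖b.fn x‖
      refine squeeze_zero (fun n => le_max_right _ _) (fun n => ?_) h3
      exact max_le (sub_le_self _ (by positivity)) (by positivity))
    simpa using this
  have hPK : Tendsto (fun n => K * ∫ x, P n x) atTop (𝓝 0) := by simpa using hPlim.const_mul K
  filter_upwards [hPK.eventually (gt_mem_nhds (show 0 < ε / 2 by positivity))] with n hn
  rw [Real.dist_eq, sub_zero, abs_of_nonneg (norm_nonneg _), ← integral_sub (hi _) (hi _)]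
  refine (norm_integral_le_of_norm_le (((hQi n).add (hPi n)).const_mul K) ?_).trans_lt ?_
  · refine Eventually.of_forall fun x => ?_
    rw [← mul_sub, ← inner_sub_left, norm_mul, Real.norm_eq_abs]
    refine mul_le_mul (hcK x) ?_ (norm_nonneg _) hK
    calc _ ≤ D n x := norm_inner_le_norm _ _
      _ ≤ Q n x + P n x := by
        have := le_max_left (D n x - Q n x) 0
        simp only [hP]; linarith
  · rw [integral_const_mul]
    simp only [Pi.add_apply]
    rw [integral_add (hQi n) (hPi n), mul_add]
    have e : ∫ x, Q n x ≤ δ * (1 + M + M₀) := by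
      simp only [hQ]
      rw [integral_const_mul, integral_add (w n).integrable_norm_rpow w₀.integrable_norm_rpow]
      gcongr
      linarith [hM n]
    have : K * ∫ x, Q n x ≤ ε / 2 := by
      calc K * ∫ x, Q n x ≤ K * (δ * (1 + M + M₀)) := by gcongr
        _ ≤ (1 + K) * (δ * (1 + M + M₀)) := by gcongr; linarith
        _ = ε / 2 := by rw [hδ]; field_simp
    linarith

end Functionals

/-! ### A pointwise estimate of Sobolev functions by Riesz potentials of their gradients -/

section Representation

open Metric Convolution

variable {N : ℕ}

theorem lintegral_comp_smul_RN (F : RN N → ℝ≥0∞) {t : ℝ} (ht : 0 < t) :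
    ∫⁻ w, F (t • w) = ENNReal.ofReal (t ^ (-(N : ℝ))) * ∫⁻ z, F z := by
  have h1 := (Homeomorph.smulOfNeZero (α := RN N) t ht.ne').measurableEmbedding.lintegral_map
    (μ := volume) F
  have h2 : Measure.map (Homeomorph.smulOfNeZero (α := RN N) t ht.ne') volume =
      ENNReal.ofReal (t ^ (-(N : ℝ))) • (volume : Measure (RN N)) := by
    have := Measure.map_addHaar_smul (volume : Measure (RN N)) ht.ne'
    rw [finrank_euclideanSpace_fin, abs_of_nonneg (by positivity)] at this
    rw [Real.rpow_neg ht.le, Real.rpow_natCast]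
    exact this
  rw [h2, lintegral_smul_measure] at h1
  exact h1.symm

theorem lintegral_Ioc_inv_rpow_le (hN : 0 < N) {a : ℝ} (ha : 0 < a) :
    ∫⁻ t in Ioi a, ENNReal.ofReal (t ^ (-(N : ℝ) - 1)) ≤ ENNReal.ofReal (a ^ (-(N : ℝ))) := by
  have hN' : (1 : ℝ) ≤ N := by exact_mod_cast hN
  have h1 : (-(N : ℝ) - 1) < -1 := by linarith
  rw [← ofReal_integral_eq_lintegral_ofReal (integrableOn_Ioi_rpow_of_lt h1 ha),
    integral_Ioi_rpow_of_lt h1 ha]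
  · refine ENNReal.ofReal_le_ofReal ?_
    rw [sub_add_cancel, neg_div_neg_eq]
    exact div_le_self (by positivity) hN'
  · filter_upwards [ae_restrict_mem measurableSet_Ioi] with t ht
    have : 0 < t := ha.trans ht
    simp only [Pi.zero_apply]
    positivity

/-- The truncated kernel obtained by integrating over dilations. -/
theorem lintegral_dilation_kernel_le (hN : 0 < N) {δ : ℝ} (hδ : 0 < δ) {z : RN N} (hz : z ≠ 0) :
    ∫⁻ t in Ioc (0 : ℝ) 1, (ball (0 : RN N) δ).indicator 1 (t⁻¹ • z) *
      ENNReal.ofReal (t ^ (-(N : ℝ) - 1)) ≤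
    (ball (0 : RN N) δ).indicator 1 z *
      (ENNReal.ofReal (δ ^ (N : ℝ)) * ‖z‖ₑ ^ (-(N : ℝ))) := by
  have hz0 : 0 < ‖z‖ := norm_pos_iff.2 hz
  by_cases hzδ : z ∈ ball (0 : RN N) δ
  · rw [indicator_of_mem hzδ, Pi.one_apply, one_mul]
    have hval : ENNReal.ofReal (δ ^ (N : ℝ)) * ‖z‖ₑ ^ (-(N : ℝ)) =
        ENNReal.ofReal ((‖z‖ / δ) ^ (-(N : ℝ))) := by
      rw [← ofReal_norm, ENNReal.ofReal_rpow_of_pos hz0, ← ENNReal.ofReal_mul (by positivity),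
        Real.div_rpow hz0.le hδ.le, Real.rpow_neg hδ.le, div_inv_eq_mul, mul_comm]
    rw [hval]
    refine le_trans ?_ (lintegral_Ioc_inv_rpow_le hN (div_pos hz0 hδ))
    rw [← lintegral_indicator measurableSet_Ioc, ← lintegral_indicator measurableSet_Ioi]
    refine lintegral_mono fun t => ?_
    by_cases ht : t ∈ Ioc (0 : ℝ) 1
    · rw [indicator_of_mem ht]
      by_cases hb : t⁻¹ • z ∈ ball (0 : RN N) δ
      · rw [indicator_of_mem hb, Pi.one_apply, one_mul, indicator_of_mem]
        rw [mem_ball_zero_iff, norm_smul, Real.norm_of_nonneg (inv_nonneg.2 ht.1.le),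
          inv_mul_lt_iff₀ ht.1] at hb
        rw [mem_Ioi, div_lt_iff₀ hδ]
        exact hb
      · rw [indicator_of_notMem hb, zero_mul]; exact zero_le
    · rw [indicator_of_notMem ht]; exact zero_le
  · rw [indicator_of_notMem hzδ, zero_mul, nonpos_iff_eq_zero]
    rw [← nonpos_iff_eq_zero, ← lintegral_zero (μ := volume.restrict (Ioc (0:ℝ) 1))]
    refine setLIntegral_mono measurable_zero fun t ht => ?_
    rw [indicator_of_notMem, zero_mul]
    intro hb
    rw [mem_ball_zero_iff, norm_smul, Real.norm_of_nonneg (inv_nonneg.2 ht.1.le),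
      inv_mul_lt_iff₀ ht.1] at hb
    rw [mem_ball_zero_iff, not_lt] at hzδ
    nlinarith [ht.2]

theorem enorm_sub_le_lintegral_fderiv {v : RN N → ℝ} (hv : ContDiff ℝ 1 v) {h : RN N → ℝ≥0∞}
    (hvh : ∀ x w, ‖fderiv ℝ v x w‖ₑ ≤ h x * ‖w‖ₑ) (x w : RN N) :
    ‖v x - v (x - w)‖ₑ ≤ ∫⁻ t in Ioc (0 : ℝ) 1, h (x - t • w) * ‖w‖ₑ := by
  have hd : ∀ t : ℝ, HasDerivAt (fun t : ℝ => x - t • w) (-w) t := fun t => by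
    simpa using ((hasDerivAt_id t).smul_const w).const_sub x
  have h1 := enorm_sub_le_lintegral_deriv_of_contDiffOn_Icc (f := fun t : ℝ => v (x - t • w))
    (a := 0) (b := 1) (by fun_prop) zero_le_one
  simp only [one_smul, zero_smul, sub_zero] at h1
  rw [← enorm_neg, neg_sub, restrict_Ioc_eq_restrict_Icc]
  refine h1.trans (lintegral_mono fun t => ?_)
  have h2 := ((hv.differentiable one_ne_zero (x - t • w)).hasFDerivAt).comp_hasDerivAt t (hd t)
  have h3 : deriv (fun t : ℝ => v (x - t • w)) t = fderiv ℝ v (x - t • w) (-w) := h2.deriv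
  rw [h3]
  simpa using hvh (x - t • w) (-w)

/-- Integrate the derivative along the segment from `x` to `x - w`, exchange the integrals,
substitute `z = t • w` and integrate in `t` first: the dilations produce the kernel `‖z‖ ^ (1 - N)`.
The majorant `h` is left abstract so that it can be the mollification of `‖G‖`. -/
theorem lintegral_ball_enorm_sub_le_of_contDiff (hN : 0 < N) {δ : ℝ} (hδ : 0 < δ)
    {v : RN N → ℝ} (hv : ContDiff ℝ 1 v) {h : RN N → ℝ≥0∞} (hh : Measurable h)
    (hvh : ∀ x w, ‖fderiv ℝ v x w‖ₑ ≤ h x * ‖w‖ₑ) (x : RN N) :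
    ∫⁻ w in ball (0 : RN N) δ, ‖v x - v (x - w)‖ₑ ≤
      ENNReal.ofReal (δ ^ (N : ℝ)) *
        ∫⁻ w in ball (0 : RN N) δ, ‖w‖ₑ ^ (1 - (N : ℝ)) * h (x - w) := by
  set I : RN N → ℝ≥0∞ := (ball (0 : RN N) δ).indicator 1 with hI
  have hIm : Measurable I := measurable_one.indicator measurableSet_ball
  have hball : ∀ F : RN N → ℝ≥0∞, ∫⁻ w in ball (0 : RN N) δ, F w = ∫⁻ w, I w * F w := fun F => by
    rw [← lintegral_indicator measurableSet_ball]
    refine lintegral_congr fun w => ?_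
    by_cases hw : w ∈ ball (0 : RN N) δ <;> simp [hI, hw]
  have : Nonempty (Fin N) := ⟨⟨0, hN⟩⟩
  have hne : ∀ᵐ z : RN N, z ≠ 0 := by
    rw [ae_iff]; simp
  calc ∫⁻ w in ball (0 : RN N) δ, ‖v x - v (x - w)‖ₑ
      ≤ ∫⁻ w, I w * ∫⁻ t in Ioc (0 : ℝ) 1, h (x - t • w) * ‖w‖ₑ := by
        rw [hball]
        gcongr with w
        exact enorm_sub_le_lintegral_fderiv hv hvh x w
    _ = ∫⁻ w, ∫⁻ t in Ioc (0 : ℝ) 1, I w * (h (x - t • w) * ‖w‖ₑ) := by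
        refine lintegral_congr fun w => ?_
        rw [lintegral_const_mul]
        fun_prop
    _ = ∫⁻ t in Ioc (0 : ℝ) 1, ∫⁻ w, I w * (h (x - t • w) * ‖w‖ₑ) := by
        refine lintegral_lintegral_swap ?_
        apply Measurable.aemeasurable
        unfold Function.uncurry
        fun_prop
    -- The Jacobian of `z = t • w` contributes `t ^ (-N)` and `‖w‖ = t⁻¹ ‖z‖` one further power.
    _ = ∫⁻ t in Ioc (0 : ℝ) 1, ∫⁻ z, I (t⁻¹ • z) * ENNReal.ofReal (t ^ (-(N : ℝ) - 1)) *
          (h (x - z) * ‖z‖ₑ) := by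
        refine setLIntegral_congr_fun measurableSet_Ioc fun t ht => ?_
        have ht0 : 0 < t := ht.1
        have e := lintegral_comp_smul_RN
          (fun z : RN N => I (t⁻¹ • z) * (h (x - z) * ‖t⁻¹ • z‖ₑ)) ht0
        simp only [smul_smul, inv_mul_cancel₀ ht0.ne', one_smul] at e
        rw [e, ← lintegral_const_mul' _ _ ENNReal.ofReal_ne_top]
        refine lintegral_congr fun z => ?_
        rw [enorm_smul, Real.enorm_of_nonneg (inv_nonneg.2 ht0.le), Real.rpow_sub ht0,
          Real.rpow_one, div_eq_mul_inv, ENNReal.ofReal_mul (by positivity)]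
        ring
    _ = ∫⁻ z, ∫⁻ t in Ioc (0 : ℝ) 1, I (t⁻¹ • z) * ENNReal.ofReal (t ^ (-(N : ℝ) - 1)) *
          (h (x - z) * ‖z‖ₑ) := by
        refine lintegral_lintegral_swap ?_
        apply Measurable.aemeasurable
        unfold Function.uncurry
        fun_prop
    _ ≤ ∫⁻ z, I z * (ENNReal.ofReal (δ ^ (N : ℝ)) * ‖z‖ₑ ^ (-(N : ℝ))) * (h (x - z) * ‖z‖ₑ) := by
        refine lintegral_mono_ae ?_
        filter_upwards [hne] with z hz
        rw [lintegral_mul_const _ (by fun_prop)]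
        gcongr
        exact lintegral_dilation_kernel_le hN hδ hz
    _ = _ := by
        rw [hball, ← lintegral_const_mul' _ _ ENNReal.ofReal_ne_top]
        refine lintegral_congr_ae ?_
        filter_upwards [hne] with z hz
        rw [show 1 - (N : ℝ) = -N + 1 by ring, ENNReal.rpow_add _ _ (by simpa using hz) (by simp),
          ENNReal.rpow_one]
        ring

/-- In polar coordinates the integrand becomes `y ^ (N - 1 - a)`, integrable at `0` because `a < N`.
-/
theorem lintegral_ball_enorm_rpow_lt_top (hN : 0 < N) {a : ℝ} (ha : a < N) (δ : ℝ) :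
    ∫⁻ w in ball (0 : RN N) δ, ‖w‖ₑ ^ (-a) < ⊤ := by
  have : Nonempty (Fin N) := ⟨⟨0, hN⟩⟩
  have h1 : IntegrableOn (fun x : RN N => ‖x‖ ^ (-a)) (ball 0 δ) := by
    rw [integrableOn_fun_norm_addHaar (E := RN N) volume (f := fun y => y ^ (-a)),
      finrank_euclideanSpace_fin]
    rcases le_or_gt δ 0 with hδ | hδ
    · simp [Ioo_eq_empty (not_lt.2 hδ)]
    have h2 : IntegrableOn (fun y : ℝ => y ^ ((N : ℝ) - 1 - a)) (Ioo 0 δ) :=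
      ((intervalIntegral.intervalIntegrable_rpow' (by linarith)).1).mono_set
        (by rw [← Ioo_union_right hδ]; exact subset_union_left)
    refine h2.congr_fun (fun y hy => ?_) measurableSet_Ioo
    simp only [smul_eq_mul]
    rw [← Real.rpow_natCast, ← Real.rpow_add hy.1, Nat.cast_sub hN, Nat.cast_one]
    congr 1
  have h2 := h1.2
  rw [hasFiniteIntegral_iff_ofReal (Eventually.of_forall fun x => by positivity)] at h2
  refine lt_of_le_of_lt (lintegral_mono_ae ?_) h2
  refine ae_restrict_of_ae ?_
  have hne : ∀ᵐ z : RN N, z ≠ 0 := by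
    rw [ae_iff]; simp
  filter_upwards [hne] with z hz
  rw [← ofReal_norm, ENNReal.ofReal_rpow_of_pos (norm_pos_iff.2 hz)]

end Representation

/-! ### From smooth functions to Sobolev functions by mollification. -/

section Mollification

open Metric Convolution

variable {N : ℕ}

/-- The derivative falls on the smooth kernel, and `y ↦ ρ (x - y)` is a test function in the
definition of the weak gradient; the sign from the reflection cancels the one from integration by
parts. -/
theorem fderiv_convolution_eq_integral {u : RN N → ℝ} {G : RN N → RN N}
    (h : HasWeakGradient u G) {ρ : RN N → ℝ} (hρ : ContDiff ℝ ∞ ρ) (hρc : HasCompactSupport ρ)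
    (x w : RN N) :
    fderiv ℝ (ρ ⋆[ContinuousLinearMap.lsmul ℝ ℝ, volume] u) x w =
      ∫ y, ρ (x - y) * inner ℝ (G y) w := by
  have hρ1 : ContDiff ℝ 1 ρ := hρ.of_le (by norm_cast)
  have hcoord : ∀ i : Fin N,
      fderiv ℝ (ρ ⋆[ContinuousLinearMap.lsmul ℝ ℝ, volume] u) x (EuclideanSpace.single i 1) =
        ∫ y, G y i * ρ (x - y) := by
    intro i
    rw [← convolution_flip]
    rw [(hρc.hasFDerivAt_convolution_right _ h.1 hρ1 x).fderiv,
      convolution_precompR_apply _ h.1 (hρc.fderiv ℝ) (hρ1.continuous_fderiv one_ne_zero),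
      convolution_def]
    have hφ : ContDiff ℝ ∞ (fun y => ρ (x - y)) := hρ.comp (contDiff_const.sub contDiff_id)
    have hφc : HasCompactSupport (fun y => ρ (x - y)) :=
      hρc.comp_homeomorph (Homeomorph.subLeft x)
    have key := h.2.2 _ hφ hφc i
    rw [← neg_inj, neg_neg] at key
    rw [← key, ← integral_neg]
    refine integral_congr_ae (Eventually.of_forall fun y => ?_)
    have h1 : HasFDerivAt (fun y => ρ (x - y)) ((fderiv ℝ ρ (x - y)).comp
        (-ContinuousLinearMap.id ℝ (RN N))) y :=
      ((hρ1.differentiable one_ne_zero (x - y)).hasFDerivAt).comp y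
        ((hasFDerivAt_id y).const_sub x)
    simp only [h1.fderiv]
    simp [mul_comm]
  have hw : w = ∑ i, w i • EuclideanSpace.single i (1 : ℝ) := by
    have := ((EuclideanSpace.basisFun (Fin N) ℝ).sum_repr w).symm
    simpa using this
  have hin : ∀ y, ρ (x - y) * inner ℝ (G y) w = ∑ i, w i * (G y i * ρ (x - y)) := by
    intro y
    rw [PiLp.inner_apply, Finset.mul_sum]
    refine Finset.sum_congr rfl fun i _ => ?_
    simp
    ring
  have hint : ∀ i, Integrable fun y => G y i * ρ (x - y) := fun i =>
    integrable_coord_mul h.2.1 i (hρ.comp (contDiff_const.sub contDiff_id))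
      (hρc.comp_homeomorph (Homeomorph.subLeft x))
  simp only [hin]
  rw [integral_finsetSum _ fun i _ => (hint i).const_mul _]
  conv_lhs => rw [hw]
  rw [map_sum]
  refine Finset.sum_congr rfl fun i _ => ?_
  rw [map_smul, hcoord, integral_const_mul, smul_eq_mul]

theorem enorm_fderiv_convolution_le {u : RN N → ℝ} {G : RN N → RN N}
    (h : HasWeakGradient u G) {ρ : RN N → ℝ} (hρ : ContDiff ℝ ∞ ρ) (hρc : HasCompactSupport ρ)
    (hρ0 : ∀ x, 0 ≤ ρ x) (x w : RN N) :
    ‖fderiv ℝ (ρ ⋆[ContinuousLinearMap.lsmul ℝ ℝ, volume] u) x w‖ₑ ≤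
      (∫⁻ z, ENNReal.ofReal (ρ z) * ‖G (x - z)‖ₑ) * ‖w‖ₑ := by
  rw [fderiv_convolution_eq_integral h hρ hρc,
    ← lintegral_sub_left_eq_self (fun z => ENNReal.ofReal (ρ z) * ‖G (x - z)‖ₑ) x,
    ← lintegral_mul_const' _ _ (by simp)]
  refine (enorm_integral_le_lintegral_enorm _).trans (lintegral_mono fun y => ?_)
  rw [enorm_mul, Real.enorm_of_nonneg (hρ0 _), sub_sub_cancel, mul_assoc]
  gcongr
  rw [← ofReal_norm, ← ofReal_norm, ← ofReal_norm, ← ENNReal.ofReal_mul (norm_nonneg _)]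
  exact ENNReal.ofReal_le_ofReal (norm_inner_le_norm _ _)

/-- The truncated Riesz potential of order one of `‖G‖`. -/
noncomputable def rieszPot (δ : ℝ) (U : RN N → ℝ≥0∞) (x : RN N) : ℝ≥0∞ :=
  ∫⁻ w in ball (0 : RN N) δ, ‖w‖ₑ ^ (1 - (N : ℝ)) * U (x - w)

theorem measurable_rieszPot (δ : ℝ) {U : RN N → ℝ≥0∞} (hU : Measurable U) :
    Measurable (rieszPot δ U) := by
  unfold rieszPot
  apply Measurable.lintegral_prod_right'
    (f := fun q : RN N × RN N => ‖q.2‖ₑ ^ (1 - (N : ℝ)) * U (q.1 - q.2))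
  fun_prop

/-- Tonelli and translation invariance: shifting by `w` with `‖w‖ < δ` enlarges the ball by `δ`. It
yields finiteness almost everywhere of the potential, and smallness as `δ → 0`. -/
theorem setLIntegral_ball_rieszPot_le (δ R : ℝ) {U : RN N → ℝ≥0∞} (hU : Measurable U)
    (x₀ : RN N) :
    ∫⁻ x in ball x₀ R, rieszPot δ U x ≤
      (∫⁻ w in ball (0 : RN N) δ, ‖w‖ₑ ^ (1 - (N : ℝ))) * ∫⁻ x in ball x₀ (R + δ), U x := by
  unfold rieszPot
  rw [lintegral_lintegral_swap (by
    apply Measurable.aemeasurable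
    unfold Function.uncurry
    fun_prop), ← lintegral_mul_const _ (by fun_prop)]
  refine setLIntegral_mono (by fun_prop) fun w hw => ?_
  rw [lintegral_const_mul _ (by fun_prop)]
  refine mul_le_mul_right ?_ _
  rw [← lintegral_indicator measurableSet_ball, ← lintegral_indicator measurableSet_ball,
    ← lintegral_sub_right_eq_self ((ball x₀ (R + δ)).indicator U) w]
  refine lintegral_mono fun x => ?_
  by_cases hx : x ∈ ball x₀ R
  · rw [indicator_of_mem hx, indicator_of_mem]
    rw [mem_ball, dist_eq_norm] at hx ⊢
    rw [mem_ball_zero_iff] at hw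
    calc ‖x - w - x₀‖ = ‖(x - x₀) - w‖ := by congr 1; abel
      _ ≤ ‖x - x₀‖ + ‖w‖ := norm_sub_le _ _
      _ < R + δ := by linarith
  · rw [indicator_of_notMem hx]; exact zero_le

theorem setLIntegral_ball_enorm_lt_top {E : Type*} [NormedAddCommGroup E] {G : RN N → E}
    (hG : LocallyIntegrable G) (x₀ : RN N) (R : ℝ) : ∫⁻ x in ball x₀ R, ‖G x‖ₑ < ⊤ :=
  ((hG.integrableOn_isCompact (isCompact_closedBall x₀ R)).mono_set ball_subset_closedBall).2

theorem setLIntegral_ball_rieszPot_lt_top (hN : 0 < N) {G : RN N → RN N}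
    (hG : LocallyIntegrable G) (hGm : Measurable G) (δ R : ℝ) (x₀ : RN N) :
    ∫⁻ x in ball x₀ R, rieszPot δ (fun y => ‖G y‖ₑ) x < ⊤ := by
  refine (setLIntegral_ball_rieszPot_le δ R (by fun_prop) x₀).trans_lt (ENNReal.mul_lt_top ?_
    (setLIntegral_ball_enorm_lt_top hG _ _))
  have := lintegral_ball_enorm_rpow_lt_top hN (a := (N : ℝ) - 1) (by linarith) δ
  simpa using this

/-- A sequence of bump functions shrinking to the origin. -/
noncomputable def shrinkingBump (N n : ℕ) : ContDiffBump (0 : RN N) where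
  rIn := 1 / ((n : ℝ) + 1)
  rOut := 2 * (1 / ((n : ℝ) + 1))
  rIn_pos := by positivity
  rIn_lt_rOut := by
    have : 0 < 1 / ((n : ℝ) + 1) := by positivity
    linarith

theorem ae_tendsto_shrinkingBump_convolution {g : RN N → ℝ} (hg : LocallyIntegrable g) :
    ∀ᵐ x, Tendsto (fun n => ((shrinkingBump N n).normed volume
      ⋆[ContinuousLinearMap.lsmul ℝ ℝ, volume] g) x) atTop (𝓝 (g x)) := by
  refine ContDiffBump.ae_convolution_tendsto_right_of_locallyIntegrable (K := 2) ?_ ?_ hg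
  · simpa [shrinkingBump] using tendsto_one_div_add_atTop_nhds_zero_nat.const_mul (2 : ℝ)
  · exact Eventually.of_forall fun n => le_rfl

/-- Turns the mollification of an extended-valued potential into a Bochner convolution, to which the
almost everywhere convergence of mollifiers applies. -/
theorem lintegral_ofReal_mul_eq_ofReal_convolution {Φ : RN N → ℝ≥0∞}
    (hΦ : LocallyIntegrable fun x => (Φ x).toReal) (hfin : ∀ᵐ x, Φ x < ⊤)
    {ρ : RN N → ℝ} (hρ : Continuous ρ) (hρc : HasCompactSupport ρ) (hρ0 : ∀ x, 0 ≤ ρ x)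
    (x : RN N) :
    ∫⁻ z, ENNReal.ofReal (ρ z) * Φ (x - z) = ENNReal.ofReal
      ((ρ ⋆[ContinuousLinearMap.lsmul ℝ ℝ, volume] fun y => (Φ y).toReal) x) := by
  rw [convolution_def, ofReal_integral_eq_lintegral_ofReal]
  · refine lintegral_congr_ae ?_
    filter_upwards [(quasiMeasurePreserving_sub_left_of_right_invariant volume x).ae hfin]
      with z hz
    rw [ContinuousLinearMap.lsmul_apply, smul_eq_mul, ENNReal.ofReal_mul (hρ0 _),
      ENNReal.ofReal_toReal hz.ne]
  · exact hρc.convolutionExists_left (ContinuousLinearMap.lsmul ℝ ℝ) hρ hΦ x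
  · exact Eventually.of_forall fun z => mul_nonneg (hρ0 _) ENNReal.toReal_nonneg

/-- Mean oscillation estimate for Sobolev functions. -/
theorem HasWeakGradient.ae_lintegral_ball_enorm_sub_le (hN : 0 < N) {u : RN N → ℝ}
    {G : RN N → RN N} (h : HasWeakGradient u G) (hGm : Measurable G) {δ : ℝ} (hδ : 0 < δ) :
    ∀ᵐ x, ∫⁻ w in ball (0 : RN N) δ, ‖u x - u (x - w)‖ₑ ≤
      ENNReal.ofReal (δ ^ (N : ℝ)) * rieszPot δ (fun y => ‖G y‖ₑ) x := by
  set Φ := rieszPot δ (fun y => ‖G y‖ₑ) with hΦ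
  have hΦm : Measurable Φ := measurable_rieszPot δ (by fun_prop)
  have hΦfin : ∀ᵐ x, Φ x < ⊤ := by
    have h1 : ∀ n : ℕ, ∀ᵐ x, x ∈ ball (0 : RN N) n → Φ x < ⊤ := fun n => by
      rw [← ae_restrict_iff' measurableSet_ball]
      exact ae_lt_top hΦm (setLIntegral_ball_rieszPot_lt_top hN h.2.1 hGm δ n 0).ne
    filter_upwards [ae_all_iff.2 h1] with x hx
    obtain ⟨n, hn⟩ := exists_nat_gt ‖x‖
    exact hx n (by simpa using hn)
  have hΦi : LocallyIntegrable fun x => (Φ x).toReal := fun x =>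
    ⟨ball x 1, ball_mem_nhds x one_pos, integrable_toReal_of_lintegral_ne_top hΦm.aemeasurable
      (setLIntegral_ball_rieszPot_lt_top hN h.2.1 hGm δ 1 x).ne⟩
  set ρ : ℕ → RN N → ℝ := fun n => (shrinkingBump N n).normed volume with hρ
  have hρs : ∀ n, ContDiff ℝ ∞ (ρ n) := fun n => (shrinkingBump N n).contDiff_normed
  have hρc : ∀ n, HasCompactSupport (ρ n) := fun n => (shrinkingBump N n).hasCompactSupport_normed
  have hρ0 : ∀ n x, 0 ≤ ρ n x := fun n => (shrinkingBump N n).nonneg_normed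
  set v : ℕ → RN N → ℝ := fun n => ρ n ⋆[ContinuousLinearMap.lsmul ℝ ℝ, volume] u with hv
  have hvs : ∀ n, ContDiff ℝ 1 (v n) := fun n =>
    (hρc n).contDiff_convolution_left (n := 1) _ ((hρs n).of_le (by norm_cast)) h.1
  have hρm : ∀ n, Measurable (ρ n) := fun n => (hρs n).continuous.measurable
  -- Mollification commutes with the Riesz potential, so the smooth estimate for `v n` has the
  -- mollified potential of `G` on its right-hand side.
  have hvle : ∀ n x, ∫⁻ w in ball (0 : RN N) δ, ‖v n x - v n (x - w)‖ₑ ≤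
      ENNReal.ofReal (δ ^ (N : ℝ)) * ENNReal.ofReal
      ((ρ n ⋆[ContinuousLinearMap.lsmul ℝ ℝ, volume] fun y => (Φ y).toReal) x) := by
    intro n x
    have hm := hρm n
    have hhm : Measurable fun x => ∫⁻ z, ENNReal.ofReal (ρ n z) * ‖G (x - z)‖ₑ := by
      apply Measurable.lintegral_prod_right'
        (f := fun q : RN N × RN N => ENNReal.ofReal (ρ n q.2) * ‖G (q.1 - q.2)‖ₑ)
      fun_prop
    refine (lintegral_ball_enorm_sub_le_of_contDiff hN hδ (hvs n) hhm
      (enorm_fderiv_convolution_le h (hρs n) (hρc n) (hρ0 n)) x).trans ?_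
    gcongr
    rw [← lintegral_ofReal_mul_eq_ofReal_convolution hΦi hΦfin (hρs n).continuous (hρc n) (hρ0 n)]
    refine le_of_eq ?_
    calc ∫⁻ w in ball (0 : RN N) δ, ‖w‖ₑ ^ (1 - (N : ℝ)) *
          ∫⁻ z, ENNReal.ofReal (ρ n z) * ‖G (x - w - z)‖ₑ
        = ∫⁻ w in ball (0 : RN N) δ, ∫⁻ z, ‖w‖ₑ ^ (1 - (N : ℝ)) *
          (ENNReal.ofReal (ρ n z) * ‖G (x - w - z)‖ₑ) := by
          refine lintegral_congr fun w => ?_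
          rw [lintegral_const_mul _ (by fun_prop)]
      _ = ∫⁻ z, ∫⁻ w in ball (0 : RN N) δ, ‖w‖ₑ ^ (1 - (N : ℝ)) *
          (ENNReal.ofReal (ρ n z) * ‖G (x - w - z)‖ₑ) := by
          refine lintegral_lintegral_swap ?_
          apply Measurable.aemeasurable
          unfold Function.uncurry
          fun_prop
      _ = _ := by
          refine lintegral_congr fun z => ?_
          rw [hΦ, rieszPot, ← lintegral_const_mul _ (by fun_prop)]
          refine lintegral_congr fun w => ?_
          rw [sub_right_comm x w z]
          ring
  have hvlim := ae_tendsto_shrinkingBump_convolution h.1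
  filter_upwards [hvlim, ae_tendsto_shrinkingBump_convolution hΦi, hΦfin] with x h1 h2 h3
  have hR : Tendsto (fun n => ENNReal.ofReal (δ ^ (N : ℝ)) * ENNReal.ofReal
      ((ρ n ⋆[ContinuousLinearMap.lsmul ℝ ℝ, volume] fun y => (Φ y).toReal) x)) atTop
      (𝓝 (ENNReal.ofReal (δ ^ (N : ℝ)) * Φ x)) := by
    have := ENNReal.Tendsto.const_mul (a := ENNReal.ofReal (δ ^ (N : ℝ)))
      (ENNReal.tendsto_ofReal h2) (Or.inr ENNReal.ofReal_ne_top)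
    rwa [ENNReal.ofReal_toReal h3.ne] at this
  -- Fatou's lemma handles the left-hand side, so no convergence of the integrals of `v n` is
  -- needed.
  have hF : ∀ᵐ w, ‖u x - u (x - w)‖ₑ = liminf (fun n => ‖v n x - v n (x - w)‖ₑ) atTop := by
    filter_upwards [(quasiMeasurePreserving_sub_left_of_right_invariant volume x).ae hvlim]
      with w hw
    exact ((h1.sub hw).enorm.liminf_eq).symm
  rw [lintegral_congr_ae (ae_restrict_of_ae hF)]
  refine (lintegral_liminf_le fun n => ?_).trans ?_
  · have := (hvs n).continuous.measurable
    exact (measurable_const.sub (this.comp (measurable_const.sub measurable_id))).enorm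
  · rw [← hR.liminf_eq]
    exact liminf_le_liminf (Eventually.of_forall fun n => hvle n x)

end Mollification

/-! ### The subcritical embedding with variable exponents. -/

section Embedding

open Metric

variable {N : ℕ}

/-- The purpose of the restriction `δ ≤ 1`: a kernel that is at least `1` may be raised to larger
exponents, and integrals over the ball are bounded by potentials. -/
theorem one_le_enorm_rpow_of_mem_ball (hN : 0 < N) {δ : ℝ} (hδ : δ ≤ 1) {w : RN N}
    (hw : w ∈ ball (0 : RN N) δ) : 1 ≤ ‖w‖ₑ ^ (1 - (N : ℝ)) := by
  have hN' : (1 : ℝ) ≤ N := by exact_mod_cast hN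
  have h1 : ‖w‖ₑ ≤ 1 := by
    rw [mem_ball_zero_iff] at hw
    rw [← ofReal_norm]
    exact ENNReal.ofReal_le_one.2 (by linarith)
  have := ENNReal.rpow_le_one h1 (show 0 ≤ (N : ℝ) - 1 by linarith)
  rw [show 1 - (N : ℝ) = -(N - 1) by ring, ENNReal.rpow_neg]
  exact ENNReal.one_le_inv.2 this

/-- A pointwise form of Young's convolution inequality. -/
theorem rieszPot_rpow_le (hN : 0 < N) {δ : ℝ} (hδ : δ ≤ 1) {V : RN N → ℝ≥0∞}
    (hV : Measurable V) {P s κ : ℝ} (hP : 1 ≤ P) (hPs : P ≤ s)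
    (hκ : 1 ≤ κ * (1 / s + (1 - 1 / P))) (x : RN N) :
    rieszPot δ V x ^ s ≤
      (∫⁻ w in ball (0 : RN N) δ, (‖w‖ₑ ^ (1 - (N : ℝ))) ^ κ * V (x - w) ^ P) *
      (∫⁻ w in ball (0 : RN N) δ, V (x - w) ^ P) ^ (s / P - 1) *
      (∫⁻ w in ball (0 : RN N) δ, (‖w‖ₑ ^ (1 - (N : ℝ))) ^ κ) ^ (s - s / P) := by
  have hP0 : 0 < P := by linarith
  have hs0 : 0 < s := by linarith
  have hκ1 : 0 ≤ 1 - 1 / P := by rw [sub_nonneg, div_le_one hP0]; exact hP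
  have hPs' : 0 ≤ 1 / P - 1 / s := by
    rw [sub_nonneg]; exact one_div_le_one_div_of_le hP0 hPs
  have hκ0 : 0 ≤ κ := by
    by_contra! hc
    have : 0 ≤ 1 / s + (1 - 1 / P) := by positivity
    nlinarith
  -- Hölder with three factors, the weights `1 / s`, `1 / P - 1 / s` and `1 - 1 / P` summing to `1`.
  have hmain := ENNReal.lintegral_prod_norm_pow_le (μ := volume.restrict (ball (0 : RN N) δ))
    Finset.univ
    (f := ![fun w => (‖w‖ₑ ^ (1 - (N : ℝ))) ^ κ * V (x - w) ^ P, fun w => V (x - w) ^ P,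
      fun w => (‖w‖ₑ ^ (1 - (N : ℝ))) ^ κ]) (p := ![1 / s, 1 / P - 1 / s, 1 - 1 / P])
    (by
      intro i _
      fin_cases i
      · exact Measurable.aemeasurable (by simp; fun_prop)
      · exact Measurable.aemeasurable (by simp; fun_prop)
      · exact Measurable.aemeasurable (by simp; fun_prop))
    (by simp [Fin.sum_univ_three])
    (by
      intro i _
      fin_cases i
      · simp; positivity
      · simpa using hPs'
      · simpa using hκ1)
  simp only [Fin.prod_univ_three, Matrix.cons_val_zero, Matrix.cons_val_one, Matrix.cons_val] at hmain
  have hpt : rieszPot δ V x ≤ ∫⁻ w in ball (0 : RN N) δ,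
      ((‖w‖ₑ ^ (1 - (N : ℝ))) ^ κ * V (x - w) ^ P) ^ (1 / s) *
        (V (x - w) ^ P) ^ (1 / P - 1 / s) * ((‖w‖ₑ ^ (1 - (N : ℝ))) ^ κ) ^ (1 - 1 / P) := by
    refine setLIntegral_mono (by fun_prop) fun w hw => ?_
    set k := ‖w‖ₑ ^ (1 - (N : ℝ)) with hk
    have hk1 : 1 ≤ k := one_le_enorm_rpow_of_mem_ball hN hδ hw
    rw [ENNReal.mul_rpow_of_nonneg _ _ (by positivity)]
    simp only [← ENNReal.rpow_mul]
    have e1 : V (x - w) = V (x - w) ^ (P * (1 / s)) * V (x - w) ^ (P * (1 / P - 1 / s)) := by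
      rw [← ENNReal.rpow_add_of_nonneg _ _ (by positivity) (by positivity), ← mul_add,
        add_sub_cancel, mul_one_div_cancel hP0.ne', ENNReal.rpow_one]
    -- The exponents of `k` add up to `κ (1 / s + 1 - 1 / P) ≥ 1`; as `k ≥ 1`, an inequality
    -- suffices in place of the usual exact relation.
    have e2 : k ≤ k ^ (κ * (1 / s)) * k ^ (κ * (1 - 1 / P)) := by
      rw [← ENNReal.rpow_add_of_nonneg _ _ (by positivity) (by positivity), ← mul_add]
      nth_rewrite 1 [← ENNReal.rpow_one k]
      exact ENNReal.rpow_le_rpow_of_exponent_le hk1 hκ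
    calc k * V (x - w) ≤ (k ^ (κ * (1 / s)) * k ^ (κ * (1 - 1 / P))) *
          (V (x - w) ^ (P * (1 / s)) * V (x - w) ^ (P * (1 / P - 1 / s))) := by
            rw [← e1]; gcongr
      _ = _ := by ring
  refine (ENNReal.rpow_le_rpow (hpt.trans hmain) hs0.le).trans (le_of_eq ?_)
  rw [ENNReal.mul_rpow_of_nonneg _ _ hs0.le, ENNReal.mul_rpow_of_nonneg _ _ hs0.le]
  simp only [← ENNReal.rpow_mul]
  rw [one_div_mul_cancel hs0.ne', ENNReal.rpow_one,
    show (1 / P - 1 / s) * s = s / P - 1 by field_simp,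
    show (1 - 1 / P) * s = s - s / P by field_simp]

theorem lintegral_rieszKernel_rpow_lt_top (hN : 0 < N) {κ : ℝ} (hκ : κ * ((N : ℝ) - 1) < N)
    (δ : ℝ) : ∫⁻ w in ball (0 : RN N) δ, (‖w‖ₑ ^ (1 - (N : ℝ))) ^ κ < ⊤ := by
  have := lintegral_ball_enorm_rpow_lt_top hN hκ δ
  simp only [← ENNReal.rpow_mul]
  convert this using 4
  ring

theorem ENNReal.rpow_le_max_rpow {a : ℝ≥0∞} {t S : ℝ} (ht : 0 ≤ t) (htS : t ≤ S) :
    a ^ t ≤ max 1 a ^ S :=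
  (ENNReal.rpow_le_rpow (le_max_right 1 a) ht).trans
    (ENNReal.rpow_le_rpow_of_exponent_le (le_max_left 1 a) htS)

/-- At a given `x` the exponents `P` and `s` are constants, while `W` will be the fixed function `U
^ p`. The powers of `max 1 _` with exponent `S` remove the remaining dependence on `x`, so that the
bound can be integrated. -/
theorem rieszPot_rpow_le_of_le (hN : 0 < N) {δ : ℝ} (hδ : δ ≤ 1) {V W : RN N → ℝ≥0∞}
    (hV : Measurable V) {P s S κ : ℝ} (hP : 1 ≤ P) (hPs : P ≤ s) (hsS : s ≤ S)
    (hκ : 1 ≤ κ * (1 / s + (1 - 1 / P))) (x : RN N)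
    (hVW : ∀ᵐ w, w ∈ ball (0 : RN N) δ → V (x - w) ^ P ≤ W (x - w)) :
    rieszPot δ V x ^ s ≤
      (∫⁻ w in ball (0 : RN N) δ, (‖w‖ₑ ^ (1 - (N : ℝ))) ^ κ * W (x - w)) *
      max 1 (∫⁻ y, W y) ^ S *
      max 1 (∫⁻ w in ball (0 : RN N) δ, (‖w‖ₑ ^ (1 - (N : ℝ))) ^ κ) ^ S := by
  have hP0 : 0 < P := by linarith
  have hs0 : 0 < s := by linarith
  have hsP : 0 ≤ s / P - 1 := by rw [sub_nonneg, one_le_div hP0]; exact hPs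
  have hsP' : s / P ≤ s := div_le_self hs0.le hP
  have hVW' : ∀ᵐ w ∂(volume.restrict (ball (0 : RN N) δ)), V (x - w) ^ P ≤ W (x - w) := by
    rwa [ae_restrict_iff' measurableSet_ball]
  have h2 : ∫⁻ w in ball (0 : RN N) δ, V (x - w) ^ P ≤ ∫⁻ y, W y := by
    rw [← lintegral_sub_left_eq_self W x]
    exact (lintegral_mono_ae hVW').trans (setLIntegral_le_lintegral _ _)
  refine (rieszPot_rpow_le hN hδ hV hP hPs hκ x).trans ?_
  gcongr ?_ * ?_ * ?_
  · refine lintegral_mono_ae ?_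
    filter_upwards [hVW'] with w hw
    gcongr
  · exact (ENNReal.rpow_le_rpow h2 hsP).trans (ENNReal.rpow_le_max_rpow hsP (by linarith))
  · exact ENNReal.rpow_le_max_rpow (by linarith) (by linarith [div_nonneg hs0.le hP0.le])

/-- Boundedness of the Riesz potential between variable exponent modulars. -/
theorem lintegral_rieszPot_rpow_le (hN : 0 < N) {δ : ℝ} (hδ : δ ≤ 1) {p s : RN N → ℝ}
    (hpm : Measurable p) {κ pMax S : ℝ} (hκ0 : 0 ≤ κ) (hpMax : ∀ᵐ y, 1 ≤ p y ∧ p y ≤ pMax)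
    (hs : ∀ᵐ x, pMax ≤ s x ∧ s x ≤ S ∧ ∃ P, 1 ≤ P ∧ P ≤ pMax ∧
      1 ≤ κ * (1 / s x + (1 - 1 / P)) ∧ ∀ y ∈ ball x δ, P ≤ p y)
    {U : RN N → ℝ≥0∞} (hU : Measurable U) :
    ∫⁻ x, rieszPot δ U x ^ s x ≤ 2 ^ S *
      (2 * ((∫⁻ w in ball (0 : RN N) δ, (‖w‖ₑ ^ (1 - (N : ℝ))) ^ κ) * (∫⁻ y, U y ^ p y) *
      max 1 (∫⁻ y, U y ^ p y) ^ S *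
      max 1 (∫⁻ w in ball (0 : RN N) δ, (‖w‖ₑ ^ (1 - (N : ℝ))) ^ κ) ^ S)) := by
  set W : RN N → ℝ≥0∞ := fun y => U y ^ p y with hW
  have hWm : Measurable W := hU.pow hpm
  set D := ∫⁻ w in ball (0 : RN N) δ, (‖w‖ₑ ^ (1 - (N : ℝ))) ^ κ with hD
  -- Where `U ≤ 1` one has `U ^ pMax ≤ U ^ p`, and where `U > 1` one has `U ^ P ≤ U ^ p` for the
  -- local lower bound `P` of `p`. Each piece is thus treated with a constant exponent.
  set V₁ : RN N → ℝ≥0∞ := {y | U y ≤ 1}.indicator U with hV₁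
  set V₂ : RN N → ℝ≥0∞ := {y | U y ≤ 1}ᶜ.indicator U with hV₂
  have hset : MeasurableSet {y | U y ≤ 1} := measurableSet_le hU measurable_const
  have hV₁m : Measurable V₁ := hU.indicator hset
  have hV₂m : Measurable V₂ := hU.indicator hset.compl
  have hsplit : ∀ x, rieszPot δ U x = rieszPot δ V₁ x + rieszPot δ V₂ x := fun x => by
    unfold rieszPot
    rw [← lintegral_add_left (by fun_prop)]
    refine lintegral_congr fun w => ?_
    rw [← mul_add]
    congr 1
    exact (congrFun (indicator_self_add_compl {y | U y ≤ 1} U) (x - w)).symm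
  set Q : RN N → ℝ≥0∞ := fun x =>
    ∫⁻ w in ball (0 : RN N) δ, (‖w‖ₑ ^ (1 - (N : ℝ))) ^ κ * W (x - w) with hQ
  have hQint : ∫⁻ x, Q x = D * ∫⁻ y, W y := by
    simp only [hQ]
    rw [lintegral_lintegral_swap (by
      apply Measurable.aemeasurable
      unfold Function.uncurry
      fun_prop), hD, ← lintegral_mul_const _ (by fun_prop)]
    refine lintegral_congr fun w => ?_
    rw [lintegral_const_mul _ (by fun_prop), lintegral_sub_right_eq_self W w]
  have hpt : ∀ᵐ x, rieszPot δ U x ^ s x ≤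
      2 ^ S * (2 * (Q x * (max 1 (∫⁻ y, W y) ^ S * max 1 D ^ S))) := by
    filter_upwards [hs] with x ⟨h1, h2, P, hP1, hPmax, hPκ, hPp⟩
    have hpM1 : 1 ≤ pMax := hP1.trans hPmax
    -- The condition on `κ` becomes weaker as the exponent grows from `P` to `pMax`.
    have hκ' : 1 ≤ κ * (1 / s x + (1 - 1 / pMax)) := by
      refine hPκ.trans ?_
      gcongr
    have b1 : rieszPot δ V₁ x ^ s x ≤ Q x * max 1 (∫⁻ y, W y) ^ S * max 1 D ^ S := by
      refine rieszPot_rpow_le_of_le hN hδ hV₁m hpM1 h1 h2 hκ' x ?_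
      filter_upwards [(quasiMeasurePreserving_sub_left_of_right_invariant volume x).ae hpMax]
        with w hw _
      by_cases hm : U (x - w) ≤ 1
      · rw [hV₁, indicator_of_mem (show x - w ∈ {y | U y ≤ 1} from hm)]
        exact ENNReal.rpow_le_rpow_of_exponent_ge hm hw.2
      · rw [hV₁, indicator_of_notMem (show x - w ∉ {y | U y ≤ 1} from hm),
          ENNReal.zero_rpow_of_pos (by linarith)]
        exact zero_le
    have b2 : rieszPot δ V₂ x ^ s x ≤ Q x * max 1 (∫⁻ y, W y) ^ S * max 1 D ^ S := by
      refine rieszPot_rpow_le_of_le hN hδ hV₂m hP1 (hPmax.trans h1) h2 hPκ x ?_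
      refine Eventually.of_forall fun w hw => ?_
      by_cases hm : U (x - w) ≤ 1
      · rw [hV₂, indicator_of_notMem (show x - w ∉ {y | U y ≤ 1}ᶜ from fun h => h hm),
          ENNReal.zero_rpow_of_pos (by linarith)]
        exact zero_le
      · rw [hV₂, indicator_of_mem (show x - w ∈ {y | U y ≤ 1}ᶜ from hm)]
        refine ENNReal.rpow_le_rpow_of_exponent_le (not_le.1 hm).le (hPp _ ?_)
        simpa [mem_ball, dist_eq_norm] using hw
    rw [hsplit]
    refine (ENNReal.rpow_add_le_mul_rpow_add_rpow _ _ (by linarith)).trans ?_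
    calc (2 : ℝ≥0∞) ^ (s x - 1) * (rieszPot δ V₁ x ^ s x + rieszPot δ V₂ x ^ s x)
        ≤ 2 ^ S * (Q x * max 1 (∫⁻ y, W y) ^ S * max 1 D ^ S +
          Q x * max 1 (∫⁻ y, W y) ^ S * max 1 D ^ S) := by
          gcongr
          · norm_num
          · linarith
      _ = _ := by ring
  refine (lintegral_mono_ae hpt).trans (le_of_eq ?_)
  have hQm : Measurable Q := by
    apply Measurable.lintegral_prod_right'
      (f := fun q : RN N × RN N => (‖q.2‖ₑ ^ (1 - (N : ℝ))) ^ κ * W (q.1 - q.2))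
    fun_prop
  rw [lintegral_const_mul _ (by fun_prop), lintegral_const_mul _ (by fun_prop),
    lintegral_mul_const _ hQm, hQint]
  ring

/-- Average `‖u x‖ ≤ ‖u (x - w)‖ + ‖u x - u (x - w)‖` over `w` in the ball: the first term is below
the potential of `‖u‖` since the kernel is at least `1`, and the second is the oscillation estimate.
-/
theorem HasWeakGradient.ae_enorm_le_rieszPot (hN : 0 < N) {u : RN N → ℝ} {G : RN N → RN N}
    (h : HasWeakGradient u G) (hum : Measurable u) (hGm : Measurable G) {δ : ℝ} (hδ : 0 < δ)
    (hδ1 : δ ≤ 1) :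
    ∀ᵐ x, ‖u x‖ₑ ≤ (volume (ball (0 : RN N) δ))⁻¹ *
      rieszPot δ (fun y => ‖u y‖ₑ + ‖G y‖ₑ) x := by
  filter_upwards [h.ae_lintegral_ball_enorm_sub_le hN hGm hδ] with x hx
  have hv0 : volume (ball (0 : RN N) δ) ≠ 0 := (measure_ball_pos _ _ hδ).ne'
  have hv1 : volume (ball (0 : RN N) δ) ≠ ⊤ := measure_ball_lt_top.ne
  rw [mul_comm, ← div_eq_mul_inv, ENNReal.le_div_iff_mul_le (Or.inl hv0) (Or.inl hv1)]
  calc ‖u x‖ₑ * volume (ball (0 : RN N) δ) = ∫⁻ w in ball (0 : RN N) δ, ‖u x‖ₑ := by simp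
    _ ≤ ∫⁻ w in ball (0 : RN N) δ, (‖u (x - w)‖ₑ + ‖u x - u (x - w)‖ₑ) := by
        refine lintegral_mono fun w => ?_
        calc ‖u x‖ₑ = ‖u (x - w) + (u x - u (x - w))‖ₑ := by congr 1; ring
          _ ≤ _ := enorm_add_le _ _
    _ = (∫⁻ w in ball (0 : RN N) δ, ‖u (x - w)‖ₑ) +
        ∫⁻ w in ball (0 : RN N) δ, ‖u x - u (x - w)‖ₑ := lintegral_add_left (by fun_prop) _
    _ ≤ rieszPot δ (fun y => ‖u y‖ₑ) x + 1 * rieszPot δ (fun y => ‖G y‖ₑ) x := by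
        gcongr
        · refine setLIntegral_mono (by fun_prop) fun w hw => ?_
          exact le_mul_of_one_le_left' (one_le_enorm_rpow_of_mem_ball hN hδ1 hw)
        · refine hx.trans ?_
          gcongr
          exact ENNReal.ofReal_le_one.2 (Real.rpow_le_one hδ.le hδ1 (by positivity))
    _ = _ := by
        unfold rieszPot
        rw [one_mul, ← lintegral_add_left (by fun_prop)]
        simp only [mul_add]

/-- The subcritical Sobolev embedding, in terms of modulars. -/
theorem exists_modular_le_of_subcritical (hN : 0 < N) {p s : VarExponent N} {δ : ℝ} (hδ : 0 < δ)
    (hδ1 : δ ≤ 1) {κ pMax S : ℝ} (hκ0 : 0 ≤ κ) (hκ : κ * ((N : ℝ) - 1) < N)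
    (hpMax : ∀ᵐ y, p y ≤ pMax)
    (hs : ∀ᵐ x, pMax ≤ s x ∧ s x ≤ S ∧ ∃ P, 1 ≤ P ∧ P ≤ pMax ∧
      1 ≤ κ * (1 / s x + (1 - 1 / P)) ∧ ∀ y ∈ ball x δ, P ≤ p y)
    {M : ℝ≥0∞} (hM : M < ⊤) :
    ∃ C : ℝ≥0∞, C < ⊤ ∧ ∀ u : VarSobolev p, modular p u.fn ≤ M → modular p u.grad ≤ M →
      modular s u.fn ≤ C := by
  set D := ∫⁻ w in ball (0 : RN N) δ, (‖w‖ₑ ^ (1 - (N : ℝ))) ^ κ with hD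
  have hDtop : D < ⊤ := lintegral_rieszKernel_rpow_lt_top hN hκ δ
  set A : ℝ≥0∞ := 2 ^ pMax * (M + M) with hA
  have htwo : ∀ t : ℝ, (2 : ℝ≥0∞) ^ t < ⊤ := fun t =>
    (ENNReal.rpow_ne_top_of_ne_zero (by norm_num) (by norm_num)).lt_top
  have hmaxtop : ∀ {a : ℝ≥0∞} (t : ℝ), a < ⊤ → max 1 a ^ t < ⊤ := fun {a} t ha =>
    (ENNReal.rpow_ne_top_of_ne_zero (zero_lt_one.trans_le (le_max_left 1 a)).ne'
      (max_lt ENNReal.one_lt_top ha).ne).lt_top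
  have hAtop : A < ⊤ := ENNReal.mul_lt_top (htwo _) (ENNReal.add_lt_top.2 ⟨hM, hM⟩)
  set v := (volume (ball (0 : RN N) δ))⁻¹ with hv
  have hvtop : v < ⊤ := (ENNReal.inv_ne_top.2 (measure_ball_pos _ _ hδ).ne').lt_top
  refine ⟨max 1 v ^ S * (2 ^ S * (2 * (D * A * max 1 A ^ S * max 1 D ^ S))), ?_, ?_⟩
  · refine ENNReal.mul_lt_top (hmaxtop S hvtop) (ENNReal.mul_lt_top (htwo _)
      (ENNReal.mul_lt_top (by norm_num) ?_))
    exact ENNReal.mul_lt_top (ENNReal.mul_lt_top (ENNReal.mul_lt_top hDtop hAtop)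
      (hmaxtop S hAtop)) (hmaxtop S hDtop)
  intro u hu hG
  have hum : Measurable u.fn := u.toLp.stronglyMeasurable.measurable
  have hGm : Measurable u.grad := (VarSobolev.gradLp u).stronglyMeasurable.measurable
  set U : RN N → ℝ≥0∞ := fun y => ‖u.fn y‖ₑ + ‖u.grad y‖ₑ with hU
  have hUA : ∫⁻ y, U y ^ p y ≤ A := by
    calc ∫⁻ y, U y ^ p y ≤ ∫⁻ y, 2 ^ pMax * (‖u.fn y‖ₑ ^ p y + ‖u.grad y‖ₑ ^ p y) := by
          refine lintegral_mono_ae ?_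
          filter_upwards [p.one_le', hpMax] with y h1 h2
          refine (ENNReal.rpow_add_le_mul_rpow_add_rpow _ _ h1).trans ?_
          gcongr
          · norm_num
          · linarith
      _ = 2 ^ pMax * (modular p u.fn + modular p u.grad) := by
          rw [lintegral_const_mul' _ _ (htwo _).ne, lintegral_add_left'
            (aemeasurable_modular p hum.aestronglyMeasurable)]
          rfl
      _ ≤ A := by rw [hA]; gcongr
  have hmain := lintegral_rieszPot_rpow_le hN hδ1 p.measurable' hκ0
    (p.one_le'.and hpMax) hs (U := U) (by fun_prop)
  calc modular s u.fn ≤ ∫⁻ x, max 1 v ^ S * rieszPot δ U x ^ s x := by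
        refine lintegral_mono_ae ?_
        filter_upwards [u.hasWeakGradient.ae_enorm_le_rieszPot hN hum hGm hδ hδ1, s.one_le', hs]
          with x h1 h2 h3
        refine (ENNReal.rpow_le_rpow h1 (by linarith)).trans ?_
        rw [ENNReal.mul_rpow_of_nonneg _ _ (by linarith)]
        gcongr
        exact ENNReal.rpow_le_max_rpow (by linarith) h3.2.1
    _ = max 1 v ^ S * ∫⁻ x, rieszPot δ U x ^ s x :=
        lintegral_const_mul' _ _ (hmaxtop S hvtop).ne
    _ ≤ _ := by
        gcongr
        refine hmain.trans ?_
        by_cases hS : 0 ≤ S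
        · gcongr
        · obtain ⟨x, hx1, hx2⟩ := (hs.and s.one_le').exists
          linarith [hx1.2.1]

end Embedding

/-! ### Comparison of the norm with the modulars. -/

section NormModular

variable {N : ℕ} {F : Type*} [NormedAddCommGroup F] [NormedSpace ℝ F]

theorem modular_smul_le_max_rpow (h : VarExponent N) {S : ℝ} (hS : ∀ᵐ x, h x ≤ S)
    {w : RN N → F} (hw : AEStronglyMeasurable w volume) (c : RN N → ℝ) {K : ℝ≥0∞}
    (hc : ∀ x, ‖c x‖ₑ ≤ K) :
    modular h (fun x => c x • w x) ≤ max 1 K ^ S * modular h w := by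
  unfold modular
  rw [← lintegral_const_mul'' _ (aemeasurable_modular h hw)]
  refine lintegral_mono_ae ?_
  filter_upwards [h.one_le', hS] with x h1 h2
  rw [enorm_smul, ENNReal.mul_rpow_of_nonneg _ _ (by linarith)]
  gcongr
  exact (ENNReal.rpow_le_rpow (hc x) (by linarith)).trans
    (ENNReal.rpow_le_max_rpow (by linarith) h2)

/-- A gauge value below `1` places `w` in a contracted copy of the modular ball, which is contained
in that ball because it is balanced. -/
theorem modular_le_one_of_luxSeminorm_lt_one (h : VarExponent N) {w : VarLp h F}
    (hw : luxSeminorm h F w < 1) : modular h w.fn ≤ 1 := by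
  obtain ⟨b, hb0, hb, hmem⟩ := exists_lt_of_gauge_lt (absorbent_modularBall h) hw
  obtain ⟨v, hv, hvu⟩ := Set.mem_smul_set.1 hmem
  have := balanced_iff_smul_mem.1 (balanced_modularBall (F := F) h)
    (show ‖b‖ ≤ 1 by rw [Real.norm_of_nonneg hb0.le]; exact hb.le) hv
  rw [hvu] at this
  exact this

/-- By convexity dividing by `M ≥ 1` reduces the modular at least by the factor `M`, so `M` is
admissible in the infimum. -/
theorem luxNorm_le_of_modular_le (h : VarExponent N) {w : RN N → F}
    (hw : AEStronglyMeasurable w volume) {M : ℝ} (hM : 1 ≤ M)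
    (hwM : modular h w ≤ ENNReal.ofReal M) : luxNorm h w ≤ M := by
  have hM0 : 0 < M := by linarith
  refine csInf_le ⟨0, fun t ht => ht.1.le⟩ ⟨hM0, ?_⟩
  refine (modular_smul_le h hw (inv_nonneg.2 hM0.le) (inv_le_one_of_one_le₀ hM)).trans ?_
  calc ENNReal.ofReal M⁻¹ * modular h w ≤ ENNReal.ofReal M⁻¹ * ENNReal.ofReal M := by gcongr
    _ = 1 := by rw [← ENNReal.ofReal_mul (by positivity), inv_mul_cancel₀ hM0.ne',
        ENNReal.ofReal_one]

namespace VarSobolev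

variable {p : VarExponent N}

theorem luxSeminorm_toLp_le (u : VarSobolev p) : luxSeminorm p ℝ (toLp u) ≤ ‖u‖ := by
  rw [norm_eq_seminorm]
  linarith [apply_nonneg (luxSeminorm p (RN N)) (gradLp u)]

theorem luxSeminorm_gradLp_le (u : VarSobolev p) : luxSeminorm p (RN N) (gradLp u) ≤ ‖u‖ := by
  rw [norm_eq_seminorm]
  linarith [apply_nonneg (luxSeminorm p ℝ) (toLp u)]

theorem modular_fn_le_one {u : VarSobolev p} (hu : ‖u‖ < 1) : modular p u.fn ≤ 1 :=
  modular_le_one_of_luxSeminorm_lt_one p ((luxSeminorm_toLp_le u).trans_lt hu)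

theorem modular_grad_le_one {u : VarSobolev p} (hu : ‖u‖ < 1) : modular p u.grad ≤ 1 :=
  modular_le_one_of_luxSeminorm_lt_one p ((luxSeminorm_gradLp_le u).trans_lt hu)

/-- Dividing by `|R| + 1` moves `u` into the open unit ball, where the modulars are at most `1`;
scaling back costs a bounded factor because the exponent is essentially bounded. -/
theorem exists_modular_le_of_norm_le (R : ℝ) :
    ∃ C : ℝ≥0∞, C < ⊤ ∧ ∀ u : VarSobolev p, ‖u‖ ≤ R →
      modular p u.fn ≤ C ∧ modular p u.grad ≤ C := by
  obtain ⟨S, hS⟩ := p.bdd'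
  set T : ℝ := |R| + 1 with hT
  have hT0 : 0 < T := by positivity
  refine ⟨max 1 ‖T‖ₑ ^ S, ?_, fun u hu => ?_⟩
  · exact (ENNReal.rpow_ne_top_of_ne_zero (zero_lt_one.trans_le (le_max_left 1 _)).ne'
      (max_lt ENNReal.one_lt_top (by simp)).ne).lt_top
  set v := T⁻¹ • u with hv
  have huv : u = T • v := by rw [hv, smul_smul, mul_inv_cancel₀ hT0.ne', one_smul]
  have hvn : ‖v‖ < 1 := by
    rw [hv, norm_smul, Real.norm_of_nonneg (by positivity), inv_mul_lt_iff₀ hT0]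
    linarith [le_abs_self R]
  constructor
  · have e : u.fn =ᵐ[volume] fun x => T • v.fn x := by
      nth_rewrite 1 [huv]
      exact fn_smul T v
    rw [modular_congr p e]
    refine (modular_smul_le_max_rpow p hS (toLp v).aestronglyMeasurable _ fun _ => le_rfl).trans ?_
    exact mul_le_of_le_one_right' (modular_fn_le_one hvn)
  · have e : u.grad =ᵐ[volume] fun x => T • v.grad x := by
      nth_rewrite 1 [huv]
      rw [grad, map_smul]
      exact VarLp.fn_smul T (gradLp v)
    rw [modular_congr p e]
    refine (modular_smul_le_max_rpow p hS (gradLp v).aestronglyMeasurable _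
      fun _ => le_rfl).trans ?_
    exact mul_le_of_le_one_right' (modular_grad_le_one hvn)

theorem norm_le_of_modular_le {u : VarSobolev p} {M : ℝ} (hM : 1 ≤ M)
    (h1 : modular p u.fn ≤ ENNReal.ofReal M) (h2 : modular p u.grad ≤ ENNReal.ofReal M) :
    ‖u‖ ≤ 2 * M := by
  rw [norm_def]
  have e1 : luxNorm p u.fn ≤ M := luxNorm_le_of_modular_le p (toLp u).aestronglyMeasurable hM h1
  have e2 : luxNorm p u.grad ≤ M :=
    luxNorm_le_of_modular_le p (gradLp u).aestronglyMeasurable hM h2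
  linarith

end VarSobolev

end NormModular

/-! ### Consequences of the assumptions on the exponents. -/

section Exponents

open Metric

variable {N : ℕ}

/-- Subtracting integer parts moves every point into the unit cube, contained in the closed ball of
radius `√N`. -/
theorem IsZPeriodic.exists_le {h : RN N → ℝ} (hh : IsZPeriodic h) (hc : Continuous h) :
    ∃ R, ∀ x, h x ≤ R := by
  obtain ⟨R, hR⟩ := (isCompact_closedBall (0 : RN N) (√N)).exists_bound_of_continuousOn
    hc.continuousOn
  refine ⟨R, fun x => ?_⟩
  rw [← hh x fun i => -⌊x i⌋]
  refine (le_abs_self _).trans (hR _ ?_)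
  rw [mem_closedBall_zero_iff, EuclideanSpace.norm_eq]
  refine Real.sqrt_le_sqrt ?_
  calc ∑ i, ‖(x + latticePoint fun i => -⌊x i⌋) i‖ ^ 2 ≤ ∑ _i : Fin N, (1 : ℝ) := by
        refine Finset.sum_le_sum fun i _ => ?_
        have e : (x + latticePoint fun i => -⌊x i⌋) i = Int.fract (x i) := by
          simp [latticePoint, Int.fract, sub_eq_add_neg]
        rw [e, Real.norm_of_nonneg (Int.fract_nonneg _)]
        have := Int.fract_nonneg (x i)
        have := (Int.fract_lt_one (x i)).le
        nlinarith
    _ = N := by simp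

/-- Linearises the critical exponent: `1 / p^* = 1 / p - 1 / N` if `p x < N`. If `p x ≥ N`, already
`1 / p ≤ 1 / N`. -/
theorem one_div_sub_one_div_le_of_critExponent (hN : 0 < N) {p r : RN N → ℝ} {ε : ℝ} (hε : 0 < ε)
    {x : RN N} (hp : 0 < p x) (hr : 0 < r x) (h : (ε : EReal) ≤ critExponent p x - (r x : EReal)) :
    1 / p x - 1 / (r x + ε) ≤ 1 / N := by
  have hN' : (0 : ℝ) < N := by exact_mod_cast hN
  unfold critExponent at h
  split_ifs at h with hlt
  · rw [← EReal.coe_sub, EReal.coe_le_coe_iff] at h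
    have h1 : r x + ε ≤ N * p x / (N - p x) := by linarith
    have h2 : 1 / (N * p x / (N - p x)) ≤ 1 / (r x + ε) :=
      one_div_le_one_div_of_le (by positivity) h1
    have h3 : 1 / (N * p x / (N - p x)) = 1 / p x - 1 / N := by
      have : (N : ℝ) - p x ≠ 0 := by linarith
      field_simp
    linarith
  · have h1 : 1 / p x ≤ 1 / (N : ℝ) := one_div_le_one_div_of_le hN' (not_lt.1 hlt)
    have h2 : 0 ≤ 1 / (r x + ε) := by positivity
    linarith

/-- Under the standing assumptions, `W^{1,p(x)}` embeds into `L^{r(x)+ε}` for some `ε > 0`. -/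
theorem ExponentAssumptions.exists_embedding (hN : 0 < N) {p : VarExponent N} {q r : RN N → ℝ}
    (h : ExponentAssumptions p q r) :
    ∃ σ ε : ℝ, ∃ q' r' s : VarExponent N, 1 < σ ∧ 0 < ε ∧ q'.toFun = q ∧ r'.toFun = r ∧
      (∀ᵐ x, σ ≤ p x) ∧ (∀ᵐ x, p x ≤ q' x) ∧ (∀ᵐ x, q' x ≤ r' x) ∧ (∀ᵐ x, r' x + ε ≤ s x) ∧
      ∀ M : ℝ≥0∞, M < ⊤ → ∃ C : ℝ≥0∞, C < ⊤ ∧ ∀ u : VarSobolev p,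
        modular p u.fn ≤ M → modular p u.grad ≤ M → modular s u.fn ≤ C := by
  have hN' : (0 : ℝ) < N := by exact_mod_cast hN
  obtain ⟨Kp, hKp⟩ := h.lipschitz_p
  obtain ⟨Kq, hKq⟩ := h.lipschitz_q
  obtain ⟨Kr, hKr⟩ := h.lipschitz_r
  obtain ⟨R, hR⟩ := h.periodic_r.exists_le hKr.continuous
  obtain ⟨B, hB⟩ := p.bdd'
  have hσ := h.one_lt
  set σ := essInf p.toFun volume with hσdef
  set pMax := essSup p.toFun volume with hpMaxdef
  have hpσ : ∀ᵐ x, σ ≤ p x := ae_essInf_le (isBoundedUnder_of_eventually_ge p.one_le')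
  have hpM : ∀ᵐ x, p x ≤ pMax := ae_le_essSup (isBoundedUnder_of_eventually_le hB)
  have hqM : ∀ᵐ x, pMax < q x := by
    have : ∀ᵐ x, essInf q volume ≤ q x := ae_essInf_le
      (isBoundedUnder_of_eventually_ge (a := 0) (Eventually.of_forall fun x => (h.pos x).2.1.le))
    filter_upwards [this] with x hx
    exact h.p_lt_q.trans_le hx
  obtain ⟨ε₀, hε₀, hε₀'⟩ := EReal.lt_iff_exists_real_btwn.1 h.r_ll
  have hε₀ : 0 < ε₀ := by exact_mod_cast hε₀
  have hcrit : ∀ x, 1 / p x - 1 / (r x + ε₀) ≤ 1 / N := fun x =>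
    one_div_sub_one_div_le_of_critExponent hN hε₀ (h.pos x).1 (h.pos x).2.2
      (hε₀'.le.trans (iInf_le _ x))
  -- Half of the gap below `p^*` goes into the larger exponent `s = r + ε`; the other half leaves
  -- the margin `c` in `hgap`, uniform in `x` because `r ≤ R`.
  set ε := ε₀ / 2 with hε
  have hε0 : 0 < ε := by positivity
  have hR0 : 0 < R := (h.pos 0).2.2.trans_le (hR 0)
  set c := ε / (R + ε₀) ^ 2 with hc
  have hc0 : 0 < c := by positivity
  have hgap : ∀ x, 1 / p x - 1 / (r x + ε) ≤ 1 / N - c := fun x => by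
    have hr := (h.pos x).2.2
    have e1 : 1 / (r x + ε) - 1 / (r x + ε₀) = ε / ((r x + ε) * (r x + ε₀)) := by
      rw [div_sub_div _ _ (by positivity) (by positivity)]
      congr 1
      rw [hε]; ring
    have e2 : c ≤ ε / ((r x + ε) * (r x + ε₀)) := by
      rw [hc, sq]
      have := hR x
      gcongr
      linarith
    linarith [hcrit x]
  -- `m` bounds the variation of `p` on balls of radius `δ`: the bound `σ - 1` keeps `P = p x - Kp *
  -- δ` at least `1`, and `c / 2` makes `1 / P - 1 / p x ≤ c / 2`.
  set m := min (σ - 1) (c / 2) with hm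
  have hm0 : 0 < m := lt_min (by linarith) (by positivity)
  set δ := min 1 (m / (Kp + 1)) with hδ
  have hK0 : (0 : ℝ) ≤ Kp := Kp.2
  have hδ0 : 0 < δ := lt_min one_pos (by positivity)
  have hKδ : (Kp : ℝ) * δ ≤ m := by
    calc (Kp : ℝ) * δ ≤ (Kp + 1) * (m / (Kp + 1)) := by
          gcongr
          · linarith
          · exact min_le_right _ _
      _ = m := by field_simp
  have hden : 0 < 1 - 1 / (N : ℝ) + c / 2 := by
    have : 1 / (N : ℝ) ≤ 1 := by
      rw [div_le_one hN']; exact_mod_cast hN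
    linarith
  -- Since `1 / s + 1 - 1 / P ≥ 1 - 1 / N + c - c / 2`, this `κ` meets the Young condition, and the
  -- surplus `c / 2` makes `κ (N - 1) < N`, so the kernel to the power `κ` is integrable.
  set κ := 1 / (1 - 1 / (N : ℝ) + c / 2) with hκ
  have hκ0 : 0 ≤ κ := by positivity
  have hκN : κ * ((N : ℝ) - 1) < N := by
    rw [hκ, div_mul_eq_mul_div, one_mul, div_lt_iff₀ hden]
    have : (N : ℝ) * (1 - 1 / N + c / 2) = N - 1 + N * c / 2 := by field_simp
    rw [this]
    have : 0 < N * c / 2 := by positivity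
    linarith
  have hpq : ∀ᵐ x, p x ≤ q x := by
    filter_upwards [hpM, hqM] with x h1 h2
    linarith
  have hq1 : ∀ᵐ x, 1 ≤ q x := by
    filter_upwards [hpq, p.one_le'] with x h1 h2
    linarith
  have hr1 : ∀ᵐ x, 1 ≤ r x := by
    filter_upwards [hq1, h.q_le_r] with x h1 h2
    linarith
  let q' : VarExponent N := ⟨q, hKq.continuous.measurable, hq1, R, by
    filter_upwards [h.q_le_r] with x hx using hx.trans (hR x)⟩
  let r' : VarExponent N := ⟨r, hKr.continuous.measurable, hr1, R, Eventually.of_forall hR⟩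
  let s : VarExponent N := ⟨fun x => r x + ε, hKr.continuous.measurable.add_const ε, by
    filter_upwards [hr1] with x hx
    linarith, R + ε, Eventually.of_forall fun x => by linarith [hR x]⟩
  refine ⟨σ, ε, q', r', s, hσ, hε0, rfl, rfl, hpσ, hpq, h.q_le_r,
    Eventually.of_forall fun x => le_rfl, fun M hM => ?_⟩
  refine exists_modular_le_of_subcritical hN (S := R + ε) hδ0 (min_le_left _ _) hκ0 hκN hpM ?_ hM
  filter_upwards [hpσ, hpM, hqM, h.q_le_r] with x h1 h2 h3 h4
  have hsx : s x = r x + ε := rfl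
  rw [hsx]
  have hP1 : 1 ≤ p x - Kp * δ := by linarith [min_le_left (σ - 1) (c / 2)]
  have hKδ0 : 0 ≤ Kp * δ := by positivity
  refine ⟨by linarith, by linarith [hR x], p x - Kp * δ, hP1, by linarith, ?_, fun y hy => ?_⟩
  · have e1 : 1 / (p x - Kp * δ) - 1 / p x ≤ c / 2 := by
      have : 1 / (p x - Kp * δ) - 1 / p x = Kp * δ / ((p x - Kp * δ) * p x) := by
        rw [div_sub_div _ _ (by linarith) (by linarith)]
        congr 1; ring
      rw [this]
      calc Kp * δ / ((p x - Kp * δ) * p x) ≤ Kp * δ := by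
            refine div_le_self hKδ0 ?_
            nlinarith
        _ ≤ c / 2 := hKδ.trans (min_le_right _ _)
    rw [hκ, div_mul_eq_mul_div, one_mul, one_le_div hden]
    linarith [hgap x]
  · have := hKp.dist_le_mul y x
    rw [Real.dist_eq] at this
    have h5 : dist y x ≤ δ := (mem_ball.1 hy).le
    have h6 : |p y - p x| ≤ Kp * δ := this.trans (by gcongr)
    linarith [neg_abs_le (p y - p x)]

end Exponents

/-! ### Local compactness of the embedding. -/

section Compactness

open Metric

variable {N : ℕ} {F : Type*} [NormedAddCommGroup F] [NormedSpace ℝ F]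

/-- Pointwise `y ≤ 1 + y ^ p`, so bounded modulars give bounds in `L¹` on sets of finite measure. -/
theorem setLIntegral_enorm_le_add_modular (p : VarExponent N) (A : Set (RN N)) (w : RN N → F) :
    ∫⁻ x in A, ‖w x‖ₑ ≤ volume A + modular p w := by
  calc ∫⁻ x in A, ‖w x‖ₑ ≤ ∫⁻ x in A, (1 + ‖w x‖ₑ ^ p x) := by
        refine lintegral_mono_ae (ae_restrict_of_ae ?_)
        filter_upwards [p.one_le'] with x hx
        rcases le_total ‖w x‖ₑ 1 with h | h
        · exact h.trans le_self_add
        · refine le_trans ?_ le_add_self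
          nth_rewrite 1 [← ENNReal.rpow_one ‖w x‖ₑ]
          exact ENNReal.rpow_le_rpow_of_exponent_le h hx
    _ = volume A + ∫⁻ x in A, ‖w x‖ₑ ^ p x := by
        rw [lintegral_add_left measurable_const]; simp
    _ ≤ _ := by gcongr; exact setLIntegral_le_lintegral _ _

theorem setLIntegral_ball_sub_left (F : RN N → ℝ≥0∞) (x : RN N) (δ : ℝ) :
    ∫⁻ w in ball (0 : RN N) δ, F (x - w) = ∫⁻ y in ball x δ, F y := by
  rw [← lintegral_indicator measurableSet_ball, ← lintegral_indicator measurableSet_ball,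
    ← lintegral_sub_left_eq_self ((ball x δ).indicator F) x]
  refine lintegral_congr fun w => ?_
  simp [indicator, dist_eq_norm]

/-- Homogeneity of degree `1 - N` in dimension `N` leaves one factor `δ`. That factor is the source
of compactness. -/
theorem lintegral_rieszKernel_scaling {δ : ℝ} (hδ : 0 < δ) :
    ∫⁻ w in ball (0 : RN N) δ, ‖w‖ₑ ^ (1 - (N : ℝ)) =
      ENNReal.ofReal δ * ∫⁻ w in ball (0 : RN N) 1, ‖w‖ₑ ^ (1 - (N : ℝ)) := by
  rw [← lintegral_indicator measurableSet_ball, ← lintegral_indicator measurableSet_ball]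
  have h1 := lintegral_comp_smul_RN
    ((ball (0 : RN N) δ).indicator fun w => ‖w‖ₑ ^ (1 - (N : ℝ))) hδ
  have h2 : ∀ w : RN N, (ball (0 : RN N) δ).indicator (fun w => ‖w‖ₑ ^ (1 - (N : ℝ))) (δ • w) =
      ENNReal.ofReal (δ ^ (1 - (N : ℝ))) *
        (ball (0 : RN N) 1).indicator (fun w => ‖w‖ₑ ^ (1 - (N : ℝ))) w := fun w => by
    have hmem : δ • w ∈ ball (0 : RN N) δ ↔ w ∈ ball (0 : RN N) 1 := by
      rw [mem_ball_zero_iff, mem_ball_zero_iff, norm_smul, Real.norm_of_nonneg hδ.le,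
        mul_lt_iff_lt_one_right hδ]
    by_cases hw : w ∈ ball (0 : RN N) 1
    · rw [indicator_of_mem hw, indicator_of_mem (hmem.2 hw), enorm_smul,
        Real.enorm_of_nonneg hδ.le, ENNReal.mul_rpow_of_ne_top ENNReal.ofReal_ne_top (by simp),
        ENNReal.ofReal_rpow_of_pos hδ]
    · rw [indicator_of_notMem hw, indicator_of_notMem (fun h => hw (hmem.1 h)), mul_zero]
  simp only [h2] at h1
  rw [lintegral_const_mul' _ _ ENNReal.ofReal_ne_top] at h1
  have h3 : ENNReal.ofReal (δ ^ (N : ℝ)) * ENNReal.ofReal (δ ^ (-(N : ℝ))) = 1 := by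
    rw [← ENNReal.ofReal_mul (by positivity), ← Real.rpow_add hδ, add_neg_cancel, Real.rpow_zero,
      ENNReal.ofReal_one]
  have h4 : ENNReal.ofReal (δ ^ (N : ℝ)) * ENNReal.ofReal (δ ^ (1 - (N : ℝ))) =
      ENNReal.ofReal δ := by
    rw [← ENNReal.ofReal_mul (by positivity), ← Real.rpow_add hδ, add_sub_cancel, Real.rpow_one]
  rw [← h4, mul_assoc, h1, ← mul_assoc, h3, one_mul]

variable {p : VarExponent N}

theorem VarSobolev.integrableOn_fn (v : VarSobolev p) (x : RN N) (δ : ℝ) :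
    IntegrableOn v.fn (ball x δ) :=
  (v.hasWeakGradient.1.integrableOn_isCompact (isCompact_closedBall x δ)).mono_set
    ball_subset_closedBall

/-- The functionals on which weak convergence is evaluated to obtain pointwise convergence of means
over balls. -/
theorem VarSobolev.exists_clm_setIntegral (x : RN N) (δ : ℝ) :
    ∃ L : VarSobolev p →L[ℝ] ℝ, ∀ v, L v = ∫ y in ball x δ, v.fn y := by
  let L : VarSobolev p →ₗ[ℝ] ℝ :=
    { toFun := fun v => ∫ y in ball x δ, v.fn y
      map_add' := fun v w => by
        rw [← integral_add (v.integrableOn_fn x δ) (w.integrableOn_fn x δ)]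
        exact integral_congr_ae (ae_restrict_of_ae (VarSobolev.fn_add v w))
      map_smul' := fun a v => by
        rw [RingHom.id_apply, smul_eq_mul, ← integral_const_mul]
        exact integral_congr_ae (ae_restrict_of_ae (VarSobolev.fn_smul a v)) }
  have hb : ∀ v, ‖v‖ < 1 → |L v| ≤ (volume (ball x δ) + 1).toReal := fun v hv => by
    have h1 : ‖L v‖ₑ ≤ volume (ball x δ) + 1 :=
      (enorm_integral_le_lintegral_enorm _).trans ((setLIntegral_enorm_le_add_modular p _ _).trans
        (by gcongr; exact VarSobolev.modular_fn_le_one hv))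
    rw [← Real.norm_eq_abs, ← toReal_enorm]
    exact ENNReal.toReal_mono
      (ENNReal.add_lt_top.2 ⟨measure_ball_lt_top, ENNReal.one_lt_top⟩).ne h1
  exact ⟨L.mkContinuousOfExistsBound (L.exists_bound_of_abs_le_on_ball hb), fun v => rfl⟩

theorem measurable_setIntegral_ball {u : RN N → ℝ} (hu : Measurable u) (δ : ℝ) :
    Measurable fun x => ∫ y in ball x δ, u y := by
  have h1 : (fun x => ∫ y in ball x δ, u y) =
      fun x => ∫ y, {q : RN N × RN N | dist q.2 q.1 < δ}.indicator (fun q => u q.2) (x, y) := by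
    funext x
    rw [← integral_indicator measurableSet_ball]
    rfl
  rw [h1]
  refine StronglyMeasurable.measurable (StronglyMeasurable.integral_prod_right'
    (f := {q : RN N × RN N | dist q.2 q.1 < δ}.indicator fun q => u q.2) ?_)
  refine Measurable.stronglyMeasurable (Measurable.indicator (by fun_prop) ?_)
  exact measurableSet_lt (by fun_prop) measurable_const

/-- A Poincaré-type splitting into the mean over the ball, which weak convergence controls, and an
oscillation, which the gradient controls. -/
theorem VarSobolev.ae_volume_mul_enorm_le (hN : 0 < N) (v : VarSobolev p) {δ : ℝ} (hδ : 0 < δ) :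
    ∀ᵐ x, volume (ball (0 : RN N) δ) * ‖v.fn x‖ₑ ≤ ‖∫ y in ball x δ, v.fn y‖ₑ +
      ENNReal.ofReal (δ ^ (N : ℝ)) * rieszPot δ (fun y => ‖v.grad y‖ₑ) x := by
  filter_upwards [v.hasWeakGradient.ae_lintegral_ball_enorm_sub_le hN
    (VarSobolev.gradLp v).stronglyMeasurable.measurable hδ] with x hx
  rw [setLIntegral_ball_sub_left (fun y => ‖v.fn x - v.fn y‖ₑ)] at hx
  refine le_trans ?_ (add_le_add_right hx _)
  have hvol : volume (ball (0 : RN N) δ) = volume (ball x δ) :=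
    (Measure.addHaar_ball_center volume x δ).symm
  have hint := v.integrableOn_fn x δ
  have hconst : IntegrableOn (fun _ : RN N => v.fn x) (ball x δ) :=
    integrableOn_const measure_ball_lt_top.ne
  calc volume (ball (0 : RN N) δ) * ‖v.fn x‖ₑ = ‖∫ y in ball x δ, v.fn x‖ₑ := by
        rw [hvol, setIntegral_const, enorm_smul, Real.enorm_of_nonneg measureReal_nonneg,
          ofReal_measureReal measure_ball_lt_top.ne]
    _ = ‖(∫ y in ball x δ, v.fn y) + ∫ y in ball x δ, (v.fn x - v.fn y)‖ₑ := by
        rw [integral_sub hconst hint]; congr 1; ring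
    _ ≤ _ := (enorm_add_le _ _).trans (by gcongr; exact enorm_integral_le_lintegral_enorm _)

/-- Bounded sequences converging weakly to zero in `W^{1,p(x)}` converge to zero in `L¹_loc`. -/
theorem VarSobolev.tendsto_setLIntegral_ball (hN : 0 < N) {v : ℕ → VarSobolev p} {C : ℝ≥0∞}
    (hC : C < ⊤) (hv : ∀ n, modular p (v n).fn ≤ C ∧ modular p (v n).grad ≤ C)
    (hweak : ∀ L : VarSobolev p →L[ℝ] ℝ, Tendsto (fun n => L (v n)) atTop (𝓝 0)) (R : ℝ) :
    Tendsto (fun n => ∫⁻ x in ball (0 : RN N) R, ‖(v n).fn x‖ₑ) atTop (𝓝 0) := by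
  set I := volume (ball (0 : RN N) (R + 1)) + C with hI
  have hItop : I < ⊤ := ENNReal.add_lt_top.2 ⟨measure_ball_lt_top, hC⟩
  set κ := ∫⁻ w in ball (0 : RN N) 1, ‖w‖ₑ ^ (1 - (N : ℝ)) with hκ
  have hκtop : κ < ⊤ := by
    have := lintegral_ball_enorm_rpow_lt_top hN (a := (N : ℝ) - 1) (by linarith) 1
    simpa using this
  set Ω := volume (ball (0 : RN N) 1) with hΩ
  have hΩ0 : Ω ≠ 0 := (measure_ball_pos _ _ one_pos).ne'
  have hΩtop : Ω ≠ ⊤ := measure_ball_lt_top.ne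
  have hsub : ∀ {δ : ℝ}, δ ≤ 1 → ∀ {x}, x ∈ ball (0 : RN N) R →
      ball x δ ⊆ ball (0 : RN N) (R + 1) := fun {δ} hδ {x} hx => by
    refine ball_subset_ball' ?_
    rw [mem_ball] at hx
    linarith
  rw [ENNReal.tendsto_nhds_zero]
  intro ε hε
  -- This is the oscillation contribution after division by the volume `δ ^ N * Ω` of the ball. Fix
  -- `δ` making it at most `ε / 2` for all `n` at once; only then let `n` tend to infinity.
  have hlim : Tendsto (fun δ : ℝ => Ω⁻¹ * (ENNReal.ofReal δ * κ * I)) (𝓝 0) (𝓝 0) := by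
    have h1 : Tendsto (fun δ : ℝ => ENNReal.ofReal δ) (𝓝 0) (𝓝 0) := by
      simpa using ENNReal.tendsto_ofReal (tendsto_id (x := 𝓝 (0 : ℝ)))
    have h2 := ENNReal.Tendsto.mul_const h1 (b := κ * I)
      (Or.inr (ENNReal.mul_lt_top hκtop hItop).ne)
    have h3 := ENNReal.Tendsto.const_mul h2 (a := Ω⁻¹) (Or.inr (ENNReal.inv_ne_top.2 hΩ0))
    simpa [mul_assoc] using h3
  have hev := ((ENNReal.tendsto_nhds_zero.1 hlim (ε / 2) (ENNReal.half_pos hε.ne')).filter_mono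
    (nhdsWithin_le_nhds (s := Ioi 0)))
  have hev1 : ∀ᶠ δ : ℝ in 𝓝[>] 0, δ < 1 :=
    (gt_mem_nhds one_pos).filter_mono nhdsWithin_le_nhds
  obtain ⟨δ, ⟨hδε, hδ1⟩, hδ0⟩ := ((hev.and hev1).and self_mem_nhdsWithin).exists
  have hδ0 : 0 < δ := hδ0
  set A : ℕ → RN N → ℝ≥0∞ := fun n x => ‖∫ y in ball x δ, (v n).fn y‖ₑ with hA
  have hAm : ∀ n, Measurable (A n) := fun n =>
    (measurable_setIntegral_ball (VarSobolev.toLp (v n)).stronglyMeasurable.measurable δ).enorm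
  -- At fixed `δ` the integrals over balls tend to `0` at every `x` and are bounded by `I`, so
  -- dominated convergence applies.
  have hAlim : Tendsto (fun n => ∫⁻ x in ball (0 : RN N) R, A n x) atTop (𝓝 0) := by
    have := tendsto_lintegral_of_dominated_convergence (μ := volume.restrict (ball (0 : RN N) R))
      (F := A) (f := fun _ => 0) (fun _ => I) hAm (fun n => ?_) ?_ (Eventually.of_forall fun x => ?_)
    · simpa using this
    · filter_upwards [ae_restrict_mem measurableSet_ball] with x hx
      calc A n x ≤ ∫⁻ y in ball x δ, ‖(v n).fn y‖ₑ := enorm_integral_le_lintegral_enorm _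
        _ ≤ ∫⁻ y in ball (0 : RN N) (R + 1), ‖(v n).fn y‖ₑ := lintegral_mono_set (hsub hδ1.le hx)
        _ ≤ I := (setLIntegral_enorm_le_add_modular p _ _).trans (add_le_add le_rfl (hv n).1)
    · rw [lintegral_const]
      exact (ENNReal.mul_lt_top hItop (by simpa using measure_ball_lt_top)).ne
    · obtain ⟨L, hL⟩ := VarSobolev.exists_clm_setIntegral (p := p) x δ
      have := (hweak L).enorm
      simpa [hL] using this
  set V := volume (ball (0 : RN N) δ) with hV
  have hVeq : V = ENNReal.ofReal (δ ^ (N : ℝ)) * Ω := by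
    rw [hV, Measure.addHaar_ball_of_pos volume _ hδ0, finrank_euclideanSpace_fin, Real.rpow_natCast]
  have hV0 : V ≠ 0 := (measure_ball_pos _ _ hδ0).ne'
  have hVtop : V ≠ ⊤ := measure_ball_lt_top.ne
  have hAlim' : Tendsto (fun n => V⁻¹ * ∫⁻ x in ball (0 : RN N) R, A n x) atTop (𝓝 0) := by
    simpa using ENNReal.Tendsto.const_mul hAlim (a := V⁻¹) (Or.inr (ENNReal.inv_ne_top.2 hV0))
  filter_upwards [ENNReal.tendsto_nhds_zero.1 hAlim' (ε / 2) (ENNReal.half_pos hε.ne')] with n hn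
  have hGm : Measurable (v n).grad := (VarSobolev.gradLp (v n)).stronglyMeasurable.measurable
  have hkey : V * ∫⁻ x in ball (0 : RN N) R, ‖(v n).fn x‖ₑ ≤
      (∫⁻ x in ball (0 : RN N) R, A n x) +
        ENNReal.ofReal (δ ^ (N : ℝ)) * (ENNReal.ofReal δ * κ * I) := by
    rw [← lintegral_const_mul' _ _ hVtop]
    calc ∫⁻ x in ball (0 : RN N) R, V * ‖(v n).fn x‖ₑ
        ≤ ∫⁻ x in ball (0 : RN N) R, (A n x +
          ENNReal.ofReal (δ ^ (N : ℝ)) * rieszPot δ (fun y => ‖(v n).grad y‖ₑ) x) :=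
          lintegral_mono_ae (ae_restrict_of_ae ((v n).ae_volume_mul_enorm_le hN hδ0))
      _ = (∫⁻ x in ball (0 : RN N) R, A n x) + ENNReal.ofReal (δ ^ (N : ℝ)) *
          ∫⁻ x in ball (0 : RN N) R, rieszPot δ (fun y => ‖(v n).grad y‖ₑ) x := by
          rw [lintegral_add_left (hAm n), lintegral_const_mul' _ _ ENNReal.ofReal_ne_top]
      _ ≤ _ := by
          gcongr
          refine (setLIntegral_ball_rieszPot_le δ R (by fun_prop) 0).trans ?_
          rw [lintegral_rieszKernel_scaling hδ0]
          gcongr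
          calc ∫⁻ x in ball (0 : RN N) (R + δ), ‖(v n).grad x‖ₑ
              ≤ ∫⁻ x in ball (0 : RN N) (R + 1), ‖(v n).grad x‖ₑ :=
                lintegral_mono_set (ball_subset_ball (by linarith))
            _ ≤ I := (setLIntegral_enorm_le_add_modular p _ _).trans (add_le_add le_rfl (hv n).2)
  have hD0 : ENNReal.ofReal (δ ^ (N : ℝ)) ≠ 0 := by
    simp only [ne_eq, ENNReal.ofReal_eq_zero, not_le]; positivity
  calc ∫⁻ x in ball (0 : RN N) R, ‖(v n).fn x‖ₑ
      = V⁻¹ * (V * ∫⁻ x in ball (0 : RN N) R, ‖(v n).fn x‖ₑ) := by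
        rw [← mul_assoc, ENNReal.inv_mul_cancel hV0 hVtop, one_mul]
    _ ≤ V⁻¹ * ((∫⁻ x in ball (0 : RN N) R, A n x) +
        ENNReal.ofReal (δ ^ (N : ℝ)) * (ENNReal.ofReal δ * κ * I)) := by gcongr
    _ = V⁻¹ * (∫⁻ x in ball (0 : RN N) R, A n x) + Ω⁻¹ * (ENNReal.ofReal δ * κ * I) := by
        rw [mul_add, ← mul_assoc V⁻¹ (ENNReal.ofReal _)]
        congr 2
        rw [hVeq, ENNReal.mul_inv (Or.inl hD0) (Or.inl ENNReal.ofReal_ne_top), mul_right_comm,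
          ENNReal.inv_mul_cancel hD0 ENNReal.ofReal_ne_top, one_mul]
    _ ≤ ε / 2 + ε / 2 := add_le_add hn hδε
    _ = ε := ENNReal.add_halves ε

/-- Local convergence in subcritical modulars. -/
theorem tendsto_setLIntegral_rpow_of_tendsto {s t : VarExponent N} {ε : ℝ} (hε : 0 < ε)
    (hts : ∀ᵐ x, t x + ε ≤ s x) {w : ℕ → RN N → F} {C : ℝ≥0∞} (hC : C < ⊤)
    (hwm : ∀ n, AEStronglyMeasurable (w n) volume)
    (hw : ∀ n, modular s (w n) ≤ C) {A : Set (RN N)}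
    (hlim : Tendsto (fun n => ∫⁻ x in A, ‖w n x‖ₑ) atTop (𝓝 0)) :
    Tendsto (fun n => ∫⁻ x in A, ‖w n x‖ₑ ^ t x) atTop (𝓝 0) := by
  obtain ⟨S, hS⟩ := s.bdd'
  rw [ENNReal.tendsto_nhds_zero]
  intro γ hγ
  have h1 : Tendsto (fun η : ℝ => ENNReal.ofReal η * C) (𝓝 0) (𝓝 0) := by
    have : Tendsto (fun δ : ℝ => ENNReal.ofReal δ) (𝓝 0) (𝓝 0) := by
      simpa using ENNReal.tendsto_ofReal (tendsto_id (x := 𝓝 (0 : ℝ)))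
    simpa using ENNReal.Tendsto.mul_const this (b := C) (Or.inr hC.ne)
  have hev := ((ENNReal.tendsto_nhds_zero.1 h1 (γ / 2) (ENNReal.half_pos hγ.ne')).filter_mono
    (nhdsWithin_le_nhds (s := Ioi 0)))
  obtain ⟨η, hη, hη0⟩ := (hev.and self_mem_nhdsWithin).exists
  -- Interpolation: the high power carries the small factor `η` and has bounded modular, while the
  -- first power tends to `0` in the mean.
  obtain ⟨D, hD, hint⟩ := exists_rpow_le_add (S := S) hε (show 0 < η from hη0)
  have hη0 : 0 < η := hη0
  have hlim' : Tendsto (fun n => ENNReal.ofReal D * ∫⁻ x in A, ‖w n x‖ₑ) atTop (𝓝 0) := by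
    simpa using ENNReal.Tendsto.const_mul hlim (a := ENNReal.ofReal D)
      (Or.inr ENNReal.ofReal_ne_top)
  filter_upwards [ENNReal.tendsto_nhds_zero.1 hlim' (γ / 2) (ENNReal.half_pos hγ.ne')] with n hn
  calc ∫⁻ x in A, ‖w n x‖ₑ ^ t x
      ≤ ∫⁻ x in A, (ENNReal.ofReal η * ‖w n x‖ₑ ^ s x + ENNReal.ofReal D * ‖w n x‖ₑ) := by
        refine lintegral_mono_ae (ae_restrict_of_ae ?_)
        filter_upwards [hts, hS, t.one_le'] with x h1 h2 h3
        rw [← ofReal_norm, ENNReal.ofReal_rpow_of_nonneg (norm_nonneg _) (by linarith),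
          ENNReal.ofReal_rpow_of_nonneg (norm_nonneg _) (by linarith),
          ← ENNReal.ofReal_mul hη0.le, ← ENNReal.ofReal_mul hD,
          ← ENNReal.ofReal_add (by positivity) (by positivity)]
        exact ENNReal.ofReal_le_ofReal (hint _ _ _ h3 h1 h2 (norm_nonneg _))
    _ = ENNReal.ofReal η * (∫⁻ x in A, ‖w n x‖ₑ ^ s x) +
        ENNReal.ofReal D * ∫⁻ x in A, ‖w n x‖ₑ := by
        rw [lintegral_add_left' (((aemeasurable_modular s (hwm n)).const_mul _).restrict),
          lintegral_const_mul' _ _ ENNReal.ofReal_ne_top,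
          lintegral_const_mul' _ _ ENNReal.ofReal_ne_top]
    _ ≤ ENNReal.ofReal η * C + ENNReal.ofReal D * ∫⁻ x in A, ‖w n x‖ₑ := by
        gcongr
        exact (setLIntegral_le_lintegral _ _).trans (hw n)
    _ ≤ γ / 2 + γ / 2 := add_le_add hη hn
    _ = γ := ENNReal.add_halves γ

end Compactness

/-! ### Cutoffs, subsequences and boundedness. -/

section Cutoff

open Metric

variable {N : ℕ}

theorem gradient_apply_coord {χ : RN N → ℝ} (x : RN N) (i : Fin N) :
    gradient χ x i = fderiv ℝ χ x (EuclideanSpace.single i 1) := by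
  have h := InnerProductSpace.toDual_symm_apply (𝕜 := ℝ) (E := RN N)
    (x := EuclideanSpace.single i (1 : ℝ)) (y := fderiv ℝ χ x)
  rw [EuclideanSpace.inner_single_right] at h
  simpa [gradient] using h

theorem continuous_gradient {χ : RN N → ℝ} (hχ : ContDiff ℝ ∞ χ) : Continuous (gradient χ) :=
  (InnerProductSpace.toDual ℝ (RN N)).symm.continuous.comp (hχ.continuous_fderiv (by simp))

/-- The product rule for weak gradients. -/
theorem HasWeakGradient.smooth_mul {u : RN N → ℝ} {G : RN N → RN N} (h : HasWeakGradient u G)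
    {χ : RN N → ℝ} (hχ : ContDiff ℝ ∞ χ) :
    HasWeakGradient (fun x => χ x * u x) (fun x => χ x • G x + u x • gradient χ x) := by
  refine ⟨h.1.continuous_smul hχ.continuous, (h.2.1.continuous_smul hχ.continuous).add
    (h.1.smul_continuous (continuous_gradient hχ)), fun φ hφ hφc i => ?_⟩
  set e : RN N := EuclideanSpace.single i 1
  -- Testing the weak gradient of `u` with `χ φ` produces the term with `∇χ` through the classical
  -- product rule.
  have hψ : ContDiff ℝ ∞ (fun x => χ x * φ x) := hχ.mul hφ
  have hψc : HasCompactSupport (fun x => χ x * φ x) := hφc.mul_left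
  have key := h.2.2 _ hψ hψc i
  have hd : ∀ x, fderiv ℝ (fun x => χ x * φ x) x e =
      χ x * fderiv ℝ φ x e + φ x * fderiv ℝ χ x e := fun x => by
    rw [fderiv_fun_mul (hχ.differentiable (by simp) x) (hφ.differentiable (by simp) x)]
    simp
  have hi1 : Integrable fun x => u x * fderiv ℝ (fun x => χ x * φ x) x e :=
    integrable_mul_fderiv h.1 i hψ hψc
  have hi2 : Integrable fun x => u x * (fderiv ℝ χ x e * φ x) :=
    h.1.integrable_smul_right_of_hasCompactSupport
      (((hχ.continuous_fderiv (by simp)).clm_apply continuous_const).mul hφ.continuous)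
      hφc.mul_left
  have hi3 : Integrable fun x => G x i * (χ x * φ x) := integrable_coord_mul h.2.1 i hψ hψc
  calc ∫ x, χ x * u x * fderiv ℝ φ x e
      = ∫ x, (u x * fderiv ℝ (fun x => χ x * φ x) x e - u x * (fderiv ℝ χ x e * φ x)) := by
        refine integral_congr_ae (Eventually.of_forall fun x => ?_)
        simp only [hd]
        ring
    _ = -((∫ x, G x i * (χ x * φ x)) + ∫ x, u x * (fderiv ℝ χ x e * φ x)) := by
        rw [integral_sub hi1 hi2, key]
        ring
    _ = _ := by
        rw [← integral_add hi3 hi2]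
        congr 1
        refine integral_congr_ae (Eventually.of_forall fun x => ?_)
        simp only [PiLp.add_apply, PiLp.smul_apply, gradient_apply_coord, smul_eq_mul]
        ring

variable {p : VarExponent N}

theorem modular_add_le {F : Type*} [NormedAddCommGroup F] [NormedSpace ℝ F] (h : VarExponent N)
    {S : ℝ} (hS : ∀ᵐ x, h x ≤ S) {a b : RN N → F} (ha : AEStronglyMeasurable a volume) :
    modular h (fun x => a x + b x) ≤ 2 ^ S * (modular h a + modular h b) := by
  unfold modular
  rw [← lintegral_add_left' (aemeasurable_modular h ha), ← lintegral_const_mul' _ _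
    (ENNReal.rpow_ne_top_of_ne_zero (by norm_num) (by norm_num))]
  refine lintegral_mono_ae ?_
  filter_upwards [h.one_le', hS] with x h1 h2
  refine (ENNReal.rpow_le_rpow (enorm_add_le _ _) (by linarith)).trans ?_
  refine (ENNReal.rpow_add_le_mul_rpow_add_rpow _ _ h1).trans ?_
  gcongr
  · norm_num
  · linarith

/-- Multiplication by a smooth cutoff function on `W^{1,p(x)}`. -/
theorem VarSobolev.exists_cutoff {χ : RN N → ℝ} (hχ : ContDiff ℝ ∞ χ) (hχ1 : ∀ x, |χ x| ≤ 1)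
    {D : ℝ≥0∞} (hDtop : D < ⊤) (hD : ∀ x, ‖gradient χ x‖ₑ ≤ D) {C : ℝ≥0∞} (hC : C < ⊤) :
    ∃ B : ℝ, ∀ v : VarSobolev p, modular p v.fn ≤ C → modular p v.grad ≤ C →
      ∃ w : VarSobolev p, ‖w‖ ≤ B ∧ w.fn =ᵐ[volume] (fun x => χ x * v.fn x) ∧
        w.grad =ᵐ[volume] fun x => χ x • v.grad x + v.fn x • gradient χ x := by
  obtain ⟨S, hS⟩ := p.bdd'
  have htwo : (2 : ℝ≥0∞) ^ S < ⊤ :=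
    (ENNReal.rpow_ne_top_of_ne_zero (by norm_num) (by norm_num)).lt_top
  have hDS : max 1 D ^ S < ⊤ :=
    (ENNReal.rpow_ne_top_of_ne_zero (zero_lt_one.trans_le (le_max_left 1 D)).ne'
      (max_lt ENNReal.one_lt_top hDtop).ne).lt_top
  -- The summand `1` ensures `Q ≥ 1`, as required to pass from modulars to the norm.
  set Q : ℝ≥0∞ := C + 2 ^ S * (C + max 1 D ^ S * C) + 1 with hQ
  have hQtop : Q < ⊤ := by
    refine ENNReal.add_lt_top.2 ⟨ENNReal.add_lt_top.2 ⟨hC, ENNReal.mul_lt_top htwo ?_⟩,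
      ENNReal.one_lt_top⟩
    exact ENNReal.add_lt_top.2 ⟨hC, ENNReal.mul_lt_top hDS hC⟩
  have hQ1 : 1 ≤ Q := le_add_self
  refine ⟨2 * Q.toReal, fun v h1 h2 => ?_⟩
  have hχe : ∀ x, ‖χ x‖ₑ ≤ 1 := fun x => by
    rw [← ofReal_norm]; exact ENNReal.ofReal_le_one.2 (hχ1 x)
  have hum := (toLp v).aestronglyMeasurable
  have hGm := (gradLp v).aestronglyMeasurable
  have hfm : AEStronglyMeasurable (fun x => χ x * v.fn x) volume :=
    hχ.continuous.aestronglyMeasurable.mul hum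
  have hg1m : AEStronglyMeasurable (fun x => χ x • v.grad x) volume :=
    hχ.continuous.aestronglyMeasurable.smul hGm
  have hgm : AEStronglyMeasurable (fun x => χ x • v.grad x + v.fn x • gradient χ x) volume :=
    hg1m.add (hum.smul (continuous_gradient hχ).aestronglyMeasurable)
  have m1 : modular p (fun x => χ x * v.fn x) ≤ C := by
    refine (modular_smul_le_max_rpow p hS hum χ hχe).trans ?_
    rw [max_self, ENNReal.one_rpow, one_mul]
    exact h1
  have m2 : modular p (fun x => χ x • v.grad x) ≤ C := by
    refine (modular_smul_le_max_rpow p hS hGm χ hχe).trans ?_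
    rw [max_self, ENNReal.one_rpow, one_mul]
    exact h2
  have m3 : modular p (fun x => v.fn x • gradient χ x) ≤ max 1 D ^ S * C := by
    have e : modular p (fun x => v.fn x • gradient χ x) =
        modular p (fun x => ‖gradient χ x‖ • v.fn x) := by
      unfold modular
      refine lintegral_congr fun x => ?_
      rw [enorm_smul, enorm_smul, enorm_norm, mul_comm]
    rw [e]
    refine (modular_smul_le_max_rpow p hS hum _ (fun x => ?_)).trans (by gcongr; exact h1)
    rw [enorm_norm]
    exact hD x
  have m4 : modular p (fun x => χ x • v.grad x + v.fn x • gradient χ x) ≤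
      2 ^ S * (C + max 1 D ^ S * C) :=
    (modular_add_le p hS hg1m).trans (by gcongr)
  have b1 : modular p (fun x => χ x * v.fn x) ≤ Q :=
    m1.trans (le_add_right (le_add_right le_rfl))
  have b2 : modular p (fun x => χ x • v.grad x + v.fn x • gradient χ x) ≤ Q :=
    m4.trans (le_add_right le_add_self)
  have hf := AEEqFun.coeFn_mk (fun x => χ x * v.fn x) hfm
  have hg := AEEqFun.coeFn_mk (fun x => χ x • v.grad x + v.fn x • gradient χ x) hgm
  have hmemf : AEEqFun.mk (fun x => χ x * v.fn x) hfm ∈ varLpSubmodule p ℝ :=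
    (modular_congr p hf).trans_lt (b1.trans_lt hQtop)
  have hmemg : AEEqFun.mk (fun x => χ x • v.grad x + v.fn x • gradient χ x) hgm ∈
      varLpSubmodule p (RN N) :=
    (modular_congr p hg).trans_lt (b2.trans_lt hQtop)
  have hwg := v.hasWeakGradient.smooth_mul hχ
  let w : VarSobolev p := ⟨AEEqFun.mk (fun x => χ x * v.fn x) hfm, hmemf, _, hmemg,
    hwg.congr hf.symm hg.symm⟩
  have hwf : w.fn =ᵐ[volume] fun x => χ x * v.fn x := hf
  -- `grad` is a chosen representative, so uniqueness of weak gradients is needed to identify it.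
  have hwG : w.grad =ᵐ[volume] fun x => χ x • v.grad x + v.fn x • gradient χ x :=
    (w.hasWeakGradient.congr hwf EventuallyEq.rfl).unique hwg
  refine ⟨w, norm_le_of_modular_le ?_ ?_ ?_, hwf, hwG⟩
  · rw [← ENNReal.toReal_one]
    exact ENNReal.toReal_mono hQtop.ne hQ1
  · rw [modular_congr p hwf, ENNReal.ofReal_toReal hQtop.ne]; exact b1
  · rw [modular_congr p hwG, ENNReal.ofReal_toReal hQtop.ne]; exact b2

/-- Extraction of an almost everywhere convergent subsequence from local `L¹` convergence. -/
theorem exists_seq_ae_tendsto_of_tendsto_setLIntegral {Ψ : ℕ → RN N → ℝ≥0∞}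
    (hm : ∀ n, AEMeasurable (Ψ n) volume)
    (h : ∀ R : ℕ, Tendsto (fun n => ∫⁻ x in ball (0 : RN N) R, Ψ n x) atTop (𝓝 0)) :
    ∃ φ : ℕ → ℕ, StrictMono φ ∧ ∀ᵐ x, Tendsto (fun n => Ψ (φ n) x) atTop (𝓝 0) := by
  -- Diagonal choice: the `n`-th selected term has integral at most `2⁻ⁿ` over the ball of radius
  -- `n`. The series of these truncations is integrable, so its terms tend to `0` almost everywhere,
  -- and each point lies in all large balls.
  have hpos : ∀ R : ℕ, 0 < ((2 : ℝ≥0∞)⁻¹) ^ R := fun R => ENNReal.pow_pos (by simp) R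
  obtain ⟨φ, hφ, hle⟩ := extraction_forall_of_eventually
    fun R => ENNReal.tendsto_nhds_zero.1 (h R) _ (hpos R)
  refine ⟨φ, hφ, ?_⟩
  have hmi : ∀ n : ℕ, AEMeasurable ((ball (0 : RN N) n).indicator (Ψ (φ n))) volume := fun n =>
    (hm _).indicator measurableSet_ball
  have hsum : ∫⁻ x, ∑' n : ℕ, (ball (0 : RN N) n).indicator (Ψ (φ n)) x ≠ ⊤ := by
    rw [lintegral_tsum hmi]
    refine ne_top_of_le_ne_top ?_ (ENNReal.tsum_le_tsum (g := fun n : ℕ => (2 : ℝ≥0∞)⁻¹ ^ n)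
      fun n => ?_)
    · rw [ENNReal.tsum_geometric]; simp
    · rw [lintegral_indicator measurableSet_ball]; exact hle n
  filter_upwards [ae_lt_top' (AEMeasurable.tsum hmi) hsum] with x hx
  have h0 := ENNReal.tendsto_atTop_zero_of_tsum_ne_top hx.ne
  refine h0.congr' ?_
  obtain ⟨m, hmx⟩ := exists_nat_gt ‖x‖
  filter_upwards [eventually_ge_atTop m] with n hn
  rw [indicator_of_mem]
  rw [mem_ball_zero_iff]
  exact hmx.trans_le (by exact_mod_cast hn)

/-- Uniform boundedness applied to the images in the bidual: the domain of these operators is the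
dual, which is complete whether or not `X` is. -/
theorem exists_norm_le_of_weak_tendsto {X : Type*} [NormedAddCommGroup X] [NormedSpace ℝ X]
    {u : ℕ → X} {u₀ : X} (h : ∀ L : X →L[ℝ] ℝ, Tendsto (fun n => L (u n)) atTop (𝓝 (L u₀))) :
    ∃ B, ∀ n, ‖u n‖ ≤ B := by
  obtain ⟨B, hB⟩ := banach_steinhaus (g := fun n => NormedSpace.inclusionInDoubleDual ℝ X (u n))
    (fun L => by
      obtain ⟨C, hC⟩ := ((h L).norm).bddAbove_range
      exact ⟨C, fun n => hC ⟨n, rfl⟩⟩)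
  refine ⟨B, fun n => ?_⟩
  have := hB n
  rwa [show ‖NormedSpace.inclusionInDoubleDual ℝ X (u n)‖ = ‖u n‖ from
    (NormedSpace.inclusionInDoubleDualLi ℝ).norm_map (u n)] at this

end Cutoff

/-! ### The derivative of the energy and the monotonicity argument. -/

section MainArgument

open Metric

variable {N : ℕ} {F : Type*} [NormedAddCommGroup F] [InnerProductSpace ℝ F]

/-- The pairing `∫ c ⟨‖w‖ ^ (s - 2) w, b⟩`. -/
noncomputable def powPairing (c s : RN N → ℝ) (w b : RN N → F) : ℝ :=
  ∫ x, c x * inner ℝ (powMap (s x) (w x)) (b x)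

theorem powPairing_congr (c s : RN N → ℝ) (w : RN N → F) {b b' : RN N → F}
    (h : b =ᵐ[volume] b') : powPairing c s w b = powPairing c s w b' :=
  integral_congr_ae (h.mono fun x hx => by simp only [hx])

/-- The inclusion of `W^{1,p(x)}` into `L^{t(x)}`. -/
noncomputable def VarSobolev.embed {p t : VarExponent N}
    (h : ∀ u : VarSobolev p, modular t u.fn < ⊤) : VarSobolev p →ₗ[ℝ] VarLp t ℝ where
  toFun u := ⟨u.1, h u⟩
  map_add' _ _ := rfl
  map_smul' _ _ := rfl

/-- Values at most `1` are compared using the smaller exponent `p`, values above `1` using the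
larger exponent `s`. -/
theorem modular_le_add_of_between {p t s : VarExponent N} (hpt : ∀ᵐ x, p x ≤ t x)
    (hts : ∀ᵐ x, t x ≤ s x) {w : RN N → F} (hw : AEStronglyMeasurable w volume) :
    modular t w ≤ modular p w + modular s w := by
  unfold modular
  rw [← lintegral_add_left' (aemeasurable_modular p hw)]
  refine lintegral_mono_ae ?_
  filter_upwards [hpt, hts] with x h1 h2
  rcases le_total ‖w x‖ₑ 1 with h | h
  · exact (ENNReal.rpow_le_rpow_of_exponent_ge h h1).trans le_self_add
  · exact (ENNReal.rpow_le_rpow_of_exponent_le h h2).trans le_add_self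

theorem integral_norm_rpow_le_toReal {t : VarExponent N} {w : RN N → F}
    (hw : AEStronglyMeasurable w volume) {C : ℝ≥0∞} (hC : C < ⊤) (h : modular t w ≤ C) :
    ∫ x, ‖w x‖ ^ t x ≤ C.toReal := by
  rw [integral_norm_rpow_eq_toReal t hw]
  exact ENNReal.toReal_mono hC.ne h

theorem VarSobolev.integral_norm_fn_rpow_le_one {p : VarExponent N} {v : VarSobolev p}
    (hv : ‖v‖ < 1) : ∫ x, ‖v.fn x‖ ^ p x ≤ 1 := by
  have h := integral_norm_rpow_le_toReal (toLp v).aestronglyMeasurable ENNReal.one_lt_top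
    (modular_fn_le_one hv)
  rw [ENNReal.toReal_one] at h
  exact h

theorem VarSobolev.integral_norm_grad_rpow_le_one {p : VarExponent N} {v : VarSobolev p}
    (hv : ‖v‖ < 1) : ∫ x, ‖v.grad x‖ ^ p x ≤ 1 := by
  have h := integral_norm_rpow_le_toReal (gradLp v).aestronglyMeasurable ENNReal.one_lt_top
    (modular_grad_le_one hv)
  rw [ENNReal.toReal_one] at h
  exact h

/-- The derivative of the energy functional, with coefficients `a` and `b`. -/
noncomputable def energyDeriv (p q r : VarExponent N) (a b : RN N → ℝ) (lam : ℝ)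
    (u v : VarSobolev p) : ℝ :=
  powPairing (fun _ => 1) p u.grad v.grad + powPairing (fun _ => 1) p u.fn v.fn
    - lam * powPairing a q u.fn v.fn - powPairing b r u.fn v.fn

variable {p q r : VarExponent N} {σ : ℝ} {a b : RN N → ℝ} {Ka Kb : ℝ}

/-- The energy is a combination of four integrals covered by `hasFDerivAt_integral_mul_norm_rpow`,
for the gradient map, the inclusion in `L^p`, and the embeddings in `L^q` and `L^r`; `B` supplies
boundedness of the embeddings on the unit ball. -/
theorem exists_hasFDerivAt_energy (hσ : 1 < σ) (hp : ∀ᵐ x, σ ≤ p x) (hq : ∀ᵐ x, σ ≤ q x)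
    (hr : ∀ᵐ x, σ ≤ r x) (hqm : ∀ u : VarSobolev p, modular q u.fn < ⊤)
    (hrm : ∀ u : VarSobolev p, modular r u.fn < ⊤) {B : ℝ}
    (hqB : ∀ v : VarSobolev p, ‖v‖ < 1 → ∫ x, ‖v.fn x‖ ^ q x ≤ B)
    (hrB : ∀ v : VarSobolev p, ‖v‖ < 1 → ∫ x, ‖v.fn x‖ ^ r x ≤ B)
    {f g : RN N → ℝ} {k : ℕ} (hg : Measurable fun x => g ((k : ℝ)⁻¹ • x))
    (hgK : ∀ x, |g ((k : ℝ)⁻¹ • x)| ≤ Ka) (hf : Measurable fun x => f ((k : ℝ)⁻¹ • x))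
    (hfK : ∀ x, |f ((k : ℝ)⁻¹ • x)| ≤ Kb) (lam : ℝ) (u : VarSobolev p) :
    ∃ L : VarSobolev p →L[ℝ] ℝ, HasFDerivAt (energy p q r f g lam k) L u ∧
      ∀ v, L v = energyDeriv p q r (fun x => g ((k : ℝ)⁻¹ • x)) (fun x => f ((k : ℝ)⁻¹ • x))
        lam u v := by
  have h1K : ∀ x : RN N, |(fun _ => (1 : ℝ)) x| ≤ 1 := fun x => by simp
  have hGb : ∀ v : VarSobolev p, ‖v‖ < 1 → ∫ x, ‖(VarSobolev.gradLp v).fn x‖ ^ p x ≤ 1 :=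
    fun v hv => VarSobolev.integral_norm_grad_rpow_le_one hv
  have hFb : ∀ v : VarSobolev p, ‖v‖ < 1 → ∫ x, ‖(VarSobolev.toLp v).fn x‖ ^ p x ≤ 1 :=
    fun v hv => VarSobolev.integral_norm_fn_rpow_le_one hv
  obtain ⟨L₁, hL₁⟩ := exists_clm_integral_mul_inner_powMap hσ hp measurable_const h1K
    VarSobolev.gradLp hGb (VarSobolev.gradLp u)
  obtain ⟨L₂, hL₂⟩ := exists_clm_integral_mul_inner_powMap hσ hp measurable_const h1K
    VarSobolev.toLp hFb (VarSobolev.toLp u)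
  obtain ⟨L₃, hL₃⟩ := exists_clm_integral_mul_inner_powMap hσ hq hg hgK
    (VarSobolev.embed hqm) hqB (VarSobolev.embed hqm u)
  obtain ⟨L₄, hL₄⟩ := exists_clm_integral_mul_inner_powMap hσ hr hf hfK
    (VarSobolev.embed hrm) hrB (VarSobolev.embed hrm u)
  have d₁ := hasFDerivAt_integral_mul_norm_rpow hσ hp measurable_const h1K
    VarSobolev.gradLp hGb u L₁ hL₁
  have d₂ := hasFDerivAt_integral_mul_norm_rpow hσ hp measurable_const h1K
    VarSobolev.toLp hFb u L₂ hL₂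
  have d₃ := hasFDerivAt_integral_mul_norm_rpow hσ hq hg hgK
    (VarSobolev.embed hqm) hqB u L₃ hL₃
  have d₄ := hasFDerivAt_integral_mul_norm_rpow hσ hr hf hfK
    (VarSobolev.embed hrm) hrB u L₄ hL₄
  refine ⟨L₁ + L₂ - lam • L₃ - L₄, ?_, fun v => ?_⟩
  · refine HasFDerivAt.congr_of_eventuallyEq (((d₁.add d₂).sub (d₃.const_mul lam)).sub d₄)
      (Eventually.of_forall fun w => ?_)
    simp only [Pi.add_apply, Pi.sub_apply]
    rw [← integral_add (integrable_mul_norm_rpow_div hσ hp measurable_const h1K _)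
      (integrable_mul_norm_rpow_div hσ hp measurable_const h1K _)]
    simp only [← mul_add]
    rfl
  · change L₁ v + L₂ v - lam * L₃ v - L₄ v = _
    rw [hL₁, hL₂, hL₃, hL₄]
    rfl

/-- Globalises local convergence for functions cut off to `A`; used with `d = χ v` and `d = v • ∇χ`.
-/
theorem tendsto_integral_rpow_of_local {t : VarExponent N} {A : Set (RN N)}
    (hA : MeasurableSet A) {w : ℕ → RN N → ℝ} {d : ℕ → RN N → F} {K : ℝ≥0∞} (hK : K < ⊤)
    (hwA : ∀ n, ∀ x ∈ A, ‖d n x‖ₑ ≤ K * ‖w n x‖ₑ) (hwA' : ∀ n, ∀ x ∉ A, d n x = 0)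
    (hlim : Tendsto (fun n => ∫⁻ x in A, ‖w n x‖ₑ ^ t x) atTop (𝓝 0))
    (hd : ∀ n, AEStronglyMeasurable (d n) volume) :
    Tendsto (fun n => ∫ x, ‖d n x‖ ^ t x) atTop (𝓝 0) := by
  obtain ⟨S, hS⟩ := t.bdd'
  have hKS : max 1 K ^ S ≠ ⊤ :=
    ENNReal.rpow_ne_top_of_ne_zero (zero_lt_one.trans_le (le_max_left 1 K)).ne'
      (max_lt ENNReal.one_lt_top hK).ne
  have hle : ∀ n, modular t (d n) ≤ max 1 K ^ S * ∫⁻ x in A, ‖w n x‖ₑ ^ t x := fun n => by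
    rw [← lintegral_const_mul' _ _ hKS, ← lintegral_indicator hA]
    refine lintegral_mono_ae ?_
    filter_upwards [t.one_le', hS] with x h1 h2
    by_cases hx : x ∈ A
    · rw [indicator_of_mem hx]
      refine (ENNReal.rpow_le_rpow (hwA n x hx) (by linarith)).trans ?_
      rw [ENNReal.mul_rpow_of_nonneg _ _ (by linarith)]
      gcongr
      exact ENNReal.rpow_le_max_rpow (by linarith) h2
    · rw [hwA' n x hx, enorm_zero, ENNReal.zero_rpow_of_pos (by linarith)]
      exact zero_le
  have h0 : Tendsto (fun n => modular t (d n)) atTop (𝓝 0) := by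
    refine tendsto_of_tendsto_of_tendsto_of_le_of_le tendsto_const_nhds ?_ (fun _ => zero_le) hle
    simpa using ENNReal.Tendsto.const_mul hlim (a := max 1 K ^ S) (Or.inr hKS)
  have h1 := (ENNReal.tendsto_toReal ENNReal.zero_ne_top).comp h0
  rw [ENNReal.toReal_zero] at h1
  refine h1.congr fun n => ?_
  rw [integral_norm_rpow_eq_toReal t (hd n)]
  rfl

theorem VarSobolev.grad_sub (u v : VarSobolev p) :
    (u - v).grad =ᵐ[volume] fun x => u.grad x - v.grad x := by
  have h : gradLp (u - v) = gradLp u + (-1 : ℝ) • gradLp v := by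
    rw [map_sub, neg_one_smul, sub_eq_add_neg]
  rw [grad, h]
  filter_upwards [VarLp.fn_add (gradLp u) ((-1 : ℝ) • gradLp v),
    VarLp.fn_smul (-1 : ℝ) (gradLp v)] with x h1 h2
  rw [h1, Pi.add_apply, h2, Pi.smul_apply, neg_one_smul, ← sub_eq_add_neg]
  rfl

theorem VarSobolev.fn_sub (u v : VarSobolev p) :
    (u - v).fn =ᵐ[volume] fun x => u.fn x - v.fn x := by
  have h : toLp (u - v) = toLp u + (-1 : ℝ) • toLp v := by
    rw [map_sub, neg_one_smul, sub_eq_add_neg]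
  rw [fn, h]
  filter_upwards [VarLp.fn_add (toLp u) ((-1 : ℝ) • toLp v),
    VarLp.fn_smul (-1 : ℝ) (toLp v)] with x h1 h2
  rw [h1, Pi.add_apply, h2, Pi.smul_apply, neg_one_smul, ← sub_eq_add_neg]
  rfl

/-- Testing the equation with `χ (u n - u₀)`. -/
theorem tendsto_setLIntegral_inner_powMap_sub (hσ : 1 < σ) (hp : ∀ᵐ x, σ ≤ p x)
    (hq : ∀ᵐ x, σ ≤ q x) (hr : ∀ᵐ x, σ ≤ r x) (haK : ∀ x, |a x| ≤ Ka) (hbK : ∀ x, |b x| ≤ Kb)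
    (lam : ℝ) {u : ℕ → VarSobolev p} {u₀ : VarSobolev p} {C : ℝ≥0∞} (hC : C < ⊤)
    (hup : ∀ n, modular p (u n).fn ≤ C) (huG : ∀ n, modular p (u n).grad ≤ C)
    (huq : ∀ n, modular q (u n).fn ≤ C) (hur : ∀ n, modular r (u n).fn ≤ C)
    (hvp : ∀ n, modular p (u n - u₀).fn ≤ C) (hvG : ∀ n, modular p (u n - u₀).grad ≤ C)
    (hvq : ∀ n, modular q (u n - u₀).fn ≤ C) (hvr : ∀ n, modular r (u n - u₀).fn ≤ C)
    (hlp : ∀ R, Tendsto (fun n => ∫⁻ x in ball (0 : RN N) R, ‖(u n - u₀).fn x‖ₑ ^ p x) atTop (𝓝 0))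
    (hlq : ∀ R, Tendsto (fun n => ∫⁻ x in ball (0 : RN N) R, ‖(u n - u₀).fn x‖ₑ ^ q x) atTop (𝓝 0))
    (hlr : ∀ R, Tendsto (fun n => ∫⁻ x in ball (0 : RN N) R, ‖(u n - u₀).fn x‖ₑ ^ r x) atTop (𝓝 0))
    (hweak : ∀ L : VarSobolev p →L[ℝ] ℝ, Tendsto (fun n => L (u n - u₀)) atTop (𝓝 0))
    (hdual : ∀ (w : ℕ → VarSobolev p) (B : ℝ), (∀ n, ‖w n‖ ≤ B) →
      Tendsto (fun n => energyDeriv p q r a b lam (u n) (w n)) atTop (𝓝 0)) (R : ℝ) :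
    Tendsto (fun n => ∫⁻ x in ball (0 : RN N) R, ENNReal.ofReal (inner ℝ
      (powMap (p x) ((u n).grad x) - powMap (p x) (u₀.grad x)) ((u n).grad x - u₀.grad x)))
      atTop (𝓝 0) := by
  -- The absolute value keeps the radii positive for every real `R`. The support lies in the ball
  -- `A` of radius `|R| + 3`, outside which both `χ` and its gradient vanish.
  let χb : ContDiffBump (0 : RN N) := ⟨|R| + 1, |R| + 2, by positivity, by linarith⟩
  set χ : RN N → ℝ := ⇑χb with hχdef
  have hχ : ContDiff ℝ ∞ χ := χb.contDiff
  have hχc : HasCompactSupport χ := χb.hasCompactSupport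
  have hχ0 : ∀ x, 0 ≤ χ x := fun x => χb.nonneg
  have hχ1 : ∀ x, |χ x| ≤ 1 := fun x => by
    rw [abs_of_nonneg (hχ0 x)]; exact χb.le_one
  have hχR : ∀ x ∈ ball (0 : RN N) R, χ x = 1 := fun x hx => by
    refine χb.one_of_mem_closedBall ?_
    rw [mem_ball_zero_iff] at hx
    rw [mem_closedBall_zero_iff]
    exact hx.le.trans ((le_abs_self R).trans (by simp [χb]))
  set A : Set (RN N) := ball (0 : RN N) (|R| + 3) with hA
  have htsup : ∀ x ∉ A, x ∉ tsupport χ := fun x hx h => hx (by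
    rw [hχdef, χb.tsupport_eq, mem_closedBall_zero_iff] at h
    rw [hA, mem_ball_zero_iff]
    have : χb.rOut = |R| + 2 := rfl
    linarith)
  have hχA : ∀ x ∉ A, χ x = 0 := fun x hx => image_eq_zero_of_notMem_tsupport (htsup x hx)
  have hgA : ∀ x ∉ A, gradient χ x = 0 := fun x hx => by
    have : fderiv ℝ χ x = 0 := image_eq_zero_of_notMem_tsupport
      (fun h => htsup x hx (tsupport_fderiv_subset ℝ h))
    rw [gradient, this, map_zero]
  obtain ⟨D, hD⟩ : ∃ D : ℝ, ∀ x, ‖gradient χ x‖ ≤ D := by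
    obtain ⟨D, hD⟩ := (isCompact_closedBall (0 : RN N) (|R| + 3)).exists_bound_of_continuousOn
      (continuous_gradient hχ).continuousOn
    have hD0 : 0 ≤ D := (norm_nonneg _).trans (hD 0 (by simp; positivity))
    refine ⟨D, fun x => ?_⟩
    by_cases hx : x ∈ A
    · exact hD x (ball_subset_closedBall hx)
    · rw [hgA x hx, norm_zero]; exact hD0
  have hDe : ∀ x, ‖gradient χ x‖ₑ ≤ ENNReal.ofReal D := fun x => by
    rw [← ofReal_norm]; exact ENNReal.ofReal_le_ofReal (hD x)
  set v : ℕ → VarSobolev p := fun n => u n - u₀ with hv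
  obtain ⟨B, hB⟩ := VarSobolev.exists_cutoff (p := p) hχ hχ1 ENNReal.ofReal_lt_top hDe hC
  choose w hwB hwf hwG using fun n => hB (v n) (hvp n) (hvG n)
  have hE := hdual w B hwB
  have h1K : ∀ x : RN N, |(fun _ => (1 : ℝ)) x| ≤ 1 := fun x => by simp
  have hum : ∀ n, AEStronglyMeasurable (u n).fn volume := fun n =>
    (VarSobolev.toLp (u n)).aestronglyMeasurable
  have hvm : ∀ n, AEStronglyMeasurable (v n).fn volume := fun n =>
    (VarSobolev.toLp (v n)).aestronglyMeasurable
  have hGm : ∀ n, AEStronglyMeasurable (u n).grad volume := fun n =>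
    (VarSobolev.gradLp (u n)).aestronglyMeasurable
  -- the lower order terms
  have hχvm : ∀ n, AEStronglyMeasurable (fun x => χ x * (v n).fn x) volume := fun n =>
    hχ.continuous.aestronglyMeasurable.mul (hvm n)
  have hlow : ∀ (t : VarExponent N) (c : RN N → ℝ) (K : ℝ), (∀ᵐ x, σ ≤ t x) →
      (∀ x, |c x| ≤ K) → (∀ n, modular t (u n).fn ≤ C) → (∀ n, modular t (v n).fn ≤ C) →
      (∀ R, Tendsto (fun n => ∫⁻ x in ball (0 : RN N) R, ‖(v n).fn x‖ₑ ^ t x) atTop (𝓝 0)) →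
      Tendsto (fun n => powPairing c t (u n).fn (w n).fn) atTop (𝓝 0) := by
    intro t c K ht hc hut hvt hlt
    obtain ⟨S, hS⟩ := t.bdd'
    have hle : ∀ x, ‖χ x‖ₑ ≤ 1 := fun x => by
      rw [← ofReal_norm]; exact ENNReal.ofReal_le_one.2 (hχ1 x)
    have := tendsto_integral_mul_inner_powMap_zero hσ ht hc
      (w := fun n => (u n).fn) (b := fun n x => χ x * (v n).fn x)
      (fun n => (integrable_norm_rpow_iff t (hum n)).2 ((hut n).trans_lt hC))
      (fun n => integral_norm_rpow_le_toReal (hum n) hC (hut n))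
      (fun n => (integrable_norm_rpow_iff t (hχvm n)).2 (by
        refine (modular_smul_le_max_rpow t hS (hvm n) χ hle).trans_lt ?_
        rw [max_self, ENNReal.one_rpow, one_mul]
        exact (hvt n).trans_lt hC))
      (tendsto_integral_rpow_of_local measurableSet_ball ENNReal.one_lt_top
        (w := fun n => (v n).fn) (A := A)
        (fun n x _ => by rw [enorm_mul]; gcongr; exact hle x)
        (fun n x hx => by simp only [hχA x hx, zero_mul]) (hlt _) hχvm)
    exact this.congr fun n => (powPairing_congr c t _ (hwf n)).symm
  have l1 := hlow p (fun _ => 1) 1 hp h1K hup hvp hlp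
  have l2 := hlow q a Ka hq haK huq hvq hlq
  have l3 := hlow r b Kb hr hbK hur hvr hlr
  -- the term with the gradient of the cutoff function
  have hvgm : ∀ n, AEStronglyMeasurable (fun x => (v n).fn x • gradient χ x) volume := fun n =>
    (hvm n).smul (continuous_gradient hχ).aestronglyMeasurable
  obtain ⟨S, hS⟩ := p.bdd'
  have hGi : ∀ n, Integrable fun x => ‖(u n).grad x‖ ^ p x := fun n =>
    (VarSobolev.gradLp (u n)).integrable_norm_rpow
  have hvgi : ∀ n, Integrable fun x => ‖(v n).fn x • gradient χ x‖ ^ p x := fun n => by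
    refine (integrable_norm_rpow_iff p (hvgm n)).2 ?_
    have e : modular p (fun x => (v n).fn x • gradient χ x) =
        modular p (fun x => ‖gradient χ x‖ • (v n).fn x) := by
      unfold modular
      refine lintegral_congr fun x => ?_
      rw [enorm_smul, enorm_smul, enorm_norm, mul_comm]
    rw [e]
    refine (modular_smul_le_max_rpow p hS (hvm n) _ (K := ENNReal.ofReal D) fun x => ?_).trans_lt
      (ENNReal.mul_lt_top ?_ ((hvp n).trans_lt hC))
    · rw [enorm_norm]; exact hDe x
    · exact (ENNReal.rpow_ne_top_of_ne_zero (zero_lt_one.trans_le (le_max_left 1 _)).ne'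
        (max_lt ENNReal.one_lt_top ENNReal.ofReal_lt_top).ne).lt_top
  have l4 : Tendsto (fun n => powPairing (fun _ => 1) p (u n).grad
      (fun x => (v n).fn x • gradient χ x)) atTop (𝓝 0) :=
    tendsto_integral_mul_inner_powMap_zero hσ hp h1K hGi
      (fun n => integral_norm_rpow_le_toReal (hGm n) hC (huG n)) hvgi
      (tendsto_integral_rpow_of_local measurableSet_ball (K := ENNReal.ofReal D)
        ENNReal.ofReal_lt_top (w := fun n => (v n).fn) (A := A)
        (fun n x _ => by rw [enorm_smul, mul_comm]; gcongr; exact hDe x)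
        (fun n x hx => by simp only [hgA x hx, smul_zero]) (hlp _) hvgm)
  -- the term with the fixed gradient
  obtain ⟨L, hL⟩ := exists_clm_integral_mul_inner_powMap hσ hp hχ.continuous.measurable hχ1
    (VarSobolev.gradLp (h := p)) (fun v hv => VarSobolev.integral_norm_grad_rpow_le_one hv)
    (VarSobolev.gradLp u₀)
  have l5 := hweak L
  set Φ : ℕ → RN N → ℝ := fun n x => inner ℝ
    (powMap (p x) ((u n).grad x) - powMap (p x) (u₀.grad x)) ((u n).grad x - u₀.grad x) with hΦ
  have hi : ∀ (c : RN N → ℝ) (y z : VarLp p (RN N)), Measurable c → (∀ x, |c x| ≤ 1) →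
      Integrable fun x => c x * inner ℝ (powMap (p x) (y.fn x)) (z.fn x) := fun c y z hc hc1 =>
    integrable_mul_inner_powMap hσ hp hc hc1 y.aestronglyMeasurable y.integrable_norm_rpow
      z.aestronglyMeasurable z.integrable_norm_rpow
  have hi1 : ∀ n, Integrable fun x => χ x *
      inner ℝ (powMap (p x) ((u n).grad x)) ((v n).grad x) := fun n =>
    hi χ (VarSobolev.gradLp (u n)) (VarSobolev.gradLp (v n)) hχ.continuous.measurable hχ1
  have hi2 : ∀ n, Integrable fun x => χ x *
      inner ℝ (powMap (p x) (u₀.grad x)) ((v n).grad x) := fun n =>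
    hi χ (VarSobolev.gradLp u₀) (VarSobolev.gradLp (v n)) hχ.continuous.measurable hχ1
  have hi3 : ∀ n, Integrable fun x => (1 : ℝ) * inner ℝ (powMap (p x) ((u n).grad x))
      ((v n).fn x • gradient χ x) := fun n =>
    integrable_mul_inner_powMap hσ hp measurable_const h1K (hGm n) (hGi n) (hvgm n) (hvgi n)
  have hΦe : ∀ n, (fun x => χ x * Φ n x) =ᵐ[volume] fun x =>
      χ x * inner ℝ (powMap (p x) ((u n).grad x)) ((v n).grad x) -
        χ x * inner ℝ (powMap (p x) (u₀.grad x)) ((v n).grad x) := fun n => by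
    filter_upwards [VarSobolev.grad_sub (u n) u₀] with x hx
    simp only [hΦ, hv, hx]
    rw [inner_sub_left, mul_sub]
  have hΦi : ∀ n, Integrable fun x => χ x * Φ n x := fun n =>
    ((hi1 n).sub (hi2 n)).congr (hΦe n).symm
  -- The derivative tested with `w n`, solved for the leading gradient term through `∇(χ v) = χ ∇v +
  -- v ∇χ`. Each term on the right has been shown to tend to `0`.
  have hsplit : ∀ n, ∫ x, χ x * Φ n x = energyDeriv p q r a b lam (u n) (w n)
      - powPairing (fun _ => 1) p (u n).grad (fun x => (v n).fn x • gradient χ x)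
      - powPairing (fun _ => 1) p (u n).fn (w n).fn + lam * powPairing a q (u n).fn (w n).fn
      + powPairing b r (u n).fn (w n).fn - L (v n) := by
    intro n
    have e1 : powPairing (fun _ => 1) p (u n).grad (w n).grad =
        (∫ x, χ x * inner ℝ (powMap (p x) ((u n).grad x)) ((v n).grad x)) +
          powPairing (fun _ => 1) p (u n).grad (fun x => (v n).fn x • gradient χ x) := by
      rw [powPairing_congr _ _ _ (hwG n), powPairing, powPairing,
        ← integral_add (hi1 n) (hi3 n)]
      refine integral_congr_ae (Eventually.of_forall fun x => ?_)
      simp only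
      rw [inner_add_right, real_inner_smul_right]
      ring
    rw [integral_congr_ae (hΦe n), integral_sub (hi1 n) (hi2 n), energyDeriv, e1, hL]
    simp only [VarSobolev.grad]
    ring
  have hlim : Tendsto (fun n => ∫ x, χ x * Φ n x) atTop (𝓝 0) := by
    simp only [hsplit]
    simpa only [sub_zero, add_zero, mul_zero] using
      ((((hE.sub l4).sub l1).add (l2.const_mul lam)).add l3).sub l5
  have hΦ0 : ∀ n, ∀ᵐ x, 0 ≤ Φ n x := fun n => by
    filter_upwards [hp] with x hx
    exact inner_powMap_sub_nonneg (by linarith) _ _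
  have hlim' := ENNReal.tendsto_ofReal hlim
  rw [ENNReal.ofReal_zero] at hlim'
  -- Monotonicity makes `Φ n` nonnegative, so its integral over the ball, where `χ = 1`, is at most
  -- the integral weighted by `χ`.
  refine tendsto_of_tendsto_of_tendsto_of_le_of_le tendsto_const_nhds hlim' (fun _ => zero_le)
    fun n => ?_
  simp only
  rw [ofReal_integral_eq_lintegral_ofReal (hΦi n)
    ((hΦ0 n).mono fun x hx => mul_nonneg (hχ0 x) hx)]
  refine le_trans ?_ (setLIntegral_le_lintegral (ball (0 : RN N) R) _)
  refine setLIntegral_mono_ae' measurableSet_ball (Eventually.of_forall fun x hx => ?_)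
  rw [hχR x hx, one_mul]

/-- Each pairing converges by `tendsto_integral_mul_inner_powMap_of_ae`. The test function is fixed,
so its own integrability controls the behaviour at infinity and no global compactness of `u n` is
required. -/
theorem tendsto_energyDeriv_of_ae (hσ : 1 < σ) (hp : ∀ᵐ x, σ ≤ p x) (hq : ∀ᵐ x, σ ≤ q x)
    (hr : ∀ᵐ x, σ ≤ r x) (hqm : ∀ u : VarSobolev p, modular q u.fn < ⊤)
    (hrm : ∀ u : VarSobolev p, modular r u.fn < ⊤) (ha : Measurable a) (haK : ∀ x, |a x| ≤ Ka)
    (hb : Measurable b) (hbK : ∀ x, |b x| ≤ Kb) (lam : ℝ) {u : ℕ → VarSobolev p}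
    {u₀ : VarSobolev p} {C : ℝ≥0∞} (hC : C < ⊤)
    (hup : ∀ n, modular p (u n).fn ≤ C) (huG : ∀ n, modular p (u n).grad ≤ C)
    (huq : ∀ n, modular q (u n).fn ≤ C) (hur : ∀ n, modular r (u n).fn ≤ C)
    (hfn : ∀ᵐ x, Tendsto (fun n => (u n).fn x) atTop (𝓝 (u₀.fn x)))
    (hgrad : ∀ᵐ x, Tendsto (fun n => (u n).grad x) atTop (𝓝 (u₀.grad x))) (v : VarSobolev p) :
    Tendsto (fun n => energyDeriv p q r a b lam (u n) v) atTop
      (𝓝 (energyDeriv p q r a b lam u₀ v)) := by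
  have h1K : ∀ x : RN N, |(fun _ => (1 : ℝ)) x| ≤ 1 := fun x => by simp
  have hum : ∀ n, AEStronglyMeasurable (u n).fn volume := fun n =>
    (VarSobolev.toLp (u n)).aestronglyMeasurable
  have l1 := tendsto_integral_mul_inner_powMap_of_ae hσ hp measurable_const h1K
    (w := fun n => VarSobolev.gradLp (u n)) (w₀ := VarSobolev.gradLp u₀)
    (fun n => integral_norm_rpow_le_toReal (VarSobolev.gradLp (u n)).aestronglyMeasurable hC
      (huG n)) hgrad (VarSobolev.gradLp v)
  have l2 := tendsto_integral_mul_inner_powMap_of_ae hσ hp measurable_const h1K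
    (w := fun n => VarSobolev.toLp (u n)) (w₀ := VarSobolev.toLp u₀)
    (fun n => integral_norm_rpow_le_toReal (hum n) hC (hup n)) hfn (VarSobolev.toLp v)
  have l3 := tendsto_integral_mul_inner_powMap_of_ae hσ hq ha haK
    (w := fun n => VarSobolev.embed hqm (u n)) (w₀ := VarSobolev.embed hqm u₀)
    (fun n => integral_norm_rpow_le_toReal (hum n) hC (huq n)) hfn (VarSobolev.embed hqm v)
  have l4 := tendsto_integral_mul_inner_powMap_of_ae hσ hr hb hbK
    (w := fun n => VarSobolev.embed hrm (u n)) (w₀ := VarSobolev.embed hrm u₀)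
    (fun n => integral_norm_rpow_le_toReal (hum n) hC (hur n)) hfn (VarSobolev.embed hrm v)
  exact ((l1.add l2).sub (l3.const_mul lam)).sub l4

theorem isWeakSolution_of_energyDeriv_eq_zero (hσ : 1 < σ) (hp : ∀ᵐ x, σ ≤ p x)
    (hq : ∀ᵐ x, σ ≤ q x) (hr : ∀ᵐ x, σ ≤ r x) (hqm : ∀ u : VarSobolev p, modular q u.fn < ⊤)
    (hrm : ∀ u : VarSobolev p, modular r u.fn < ⊤)
    {f g : RN N → ℝ} {k : ℕ} (hg : Measurable fun x => g ((k : ℝ)⁻¹ • x))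
    (hgK : ∀ x, |g ((k : ℝ)⁻¹ • x)| ≤ Ka) (hf : Measurable fun x => f ((k : ℝ)⁻¹ • x))
    (hfK : ∀ x, |f ((k : ℝ)⁻¹ • x)| ≤ Kb) {lam : ℝ} {u : VarSobolev p}
    (h : ∀ v, energyDeriv p q r (fun x => g ((k : ℝ)⁻¹ • x)) (fun x => f ((k : ℝ)⁻¹ • x))
      lam u v = 0) : IsWeakSolution p q r f g lam k u := by
  have h1K : ∀ x : RN N, |(fun _ => (1 : ℝ)) x| ≤ 1 := fun x => by simp
  intro v
  have hscalar : ∀ c s y z : ℝ, c * inner ℝ (powMap s y) z = c * |y| ^ (s - 2) * y * z := by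
    intro c s y z
    simp [powMap]
    ring
  have i1 := integrable_mul_inner_powMap hσ hp measurable_const h1K
    (VarSobolev.gradLp u).aestronglyMeasurable (VarSobolev.gradLp u).integrable_norm_rpow
    (VarSobolev.gradLp v).aestronglyMeasurable (VarSobolev.gradLp v).integrable_norm_rpow
  have i2 := integrable_mul_inner_powMap hσ hp measurable_const h1K
    (VarSobolev.toLp u).aestronglyMeasurable (VarSobolev.toLp u).integrable_norm_rpow
    (VarSobolev.toLp v).aestronglyMeasurable (VarSobolev.toLp v).integrable_norm_rpow
  have i3 := integrable_mul_inner_powMap hσ hq hg hgK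
    (VarSobolev.embed hqm u).aestronglyMeasurable (VarSobolev.embed hqm u).integrable_norm_rpow
    (VarSobolev.embed hqm v).aestronglyMeasurable (VarSobolev.embed hqm v).integrable_norm_rpow
  have i4 := integrable_mul_inner_powMap hσ hr hf hfK
    (VarSobolev.embed hrm u).aestronglyMeasurable (VarSobolev.embed hrm u).integrable_norm_rpow
    (VarSobolev.embed hrm v).aestronglyMeasurable (VarSobolev.embed hrm v).integrable_norm_rpow
  have e12 : (fun x => ‖u.grad x‖ ^ (p x - 2) * inner ℝ (u.grad x) (v.grad x)
      + |u.fn x| ^ (p x - 2) * u.fn x * v.fn x) = fun x =>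
      1 * inner ℝ (powMap (p x) (u.grad x)) (v.grad x) +
        1 * inner ℝ (powMap (p x) (u.fn x)) (v.fn x) := by
    funext x
    rw [hscalar, one_mul, one_mul, powMap, real_inner_smul_left]
  have e3 : (fun x => g ((k : ℝ)⁻¹ • x) * |u.fn x| ^ (q x - 2) * u.fn x * v.fn x) = fun x =>
      g ((k : ℝ)⁻¹ • x) * inner ℝ (powMap (q x) (u.fn x)) (v.fn x) := by
    funext x
    rw [hscalar]
  have e4 : (fun x => f ((k : ℝ)⁻¹ • x) * |u.fn x| ^ (r x - 2) * u.fn x * v.fn x) = fun x =>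
      f ((k : ℝ)⁻¹ • x) * inner ℝ (powMap (r x) (u.fn x)) (v.fn x) := by
    funext x
    rw [hscalar]
  rw [e12, e3, e4]
  refine ⟨i1.add i2, i3, i4, ?_⟩
  have h0 := h v
  simp only [energyDeriv, powPairing] at h0
  have h5 : ∫ x, (1 * inner ℝ (powMap (p x) (u.grad x)) (v.grad x) +
      1 * inner ℝ (powMap (p x) (u.fn x)) (v.fn x)) = _ := integral_add i1 i2
  rw [h5]
  change _ + _ = _
  simp only [VarSobolev.grad, VarSobolev.fn] at h0 ⊢
  linarith

end MainArgument

/-! ### Bounds for the weights, and the conclusion. -/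

theorem GAssumptions.exists_abs_le {N k : ℕ} {g : RN N → ℝ} (hg : GAssumptions k g) :
    ∃ K, ∀ x, |g ((k : ℝ)⁻¹ • x)| ≤ K := by
  have hc : Continuous fun x : RN N => g ((k : ℝ)⁻¹ • x) :=
    hg.continuous.comp (continuous_const_smul _)
  have hev := hg.tendsto.eventually (Metric.ball_mem_nhds (0 : ℝ) one_pos)
  rw [Metric.cobounded_eq_cocompact] at hev
  obtain ⟨T, hT, hTsub⟩ := mem_cocompact.1 hev
  obtain ⟨K, hK⟩ := hT.exists_bound_of_continuousOn hc.continuousOn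
  refine ⟨max 1 K, fun x => ?_⟩
  by_cases hx : x ∈ T
  · exact (hK x hx).trans (le_max_right _ _)
  · have : g ((k : ℝ)⁻¹ • x) ∈ Metric.ball (0 : ℝ) 1 := hTsub hx
    rw [mem_ball_zero_iff] at this
    exact this.le.trans (le_max_left _ _)

theorem FAssumptions.abs_le_one {N : ℕ} {f : RN N → ℝ} (hf : FAssumptions f) (x : RN N) :
    |f x| ≤ 1 := by
  obtain ⟨ℓ, a, -, -, ha⟩ := hf.max_points
  rw [abs_of_nonneg (hf.nonneg x), ← (ha 0).1]
  exact (ha 0).2 x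

theorem mainTheorem3 {N : ℕ} (hN : 0 < N)
    (p : VarExponent N) (q r : RN N → ℝ) (hpqr : ExponentAssumptions p q r)
    (lam : ℝ) (hlam : 0 ≤ lam) (k : ℕ) (hk : 0 < k)
    (f g : RN N → ℝ) (hg : GAssumptions k g) (hf : FAssumptions f)
    (u : ℕ → VarSobolev p) (u₀ : VarSobolev p)
    (hweak : ∀ L : VarSobolev p →L[ℝ] ℝ, Tendsto (fun n => L (u n)) atTop (𝓝 (L u₀)))
    (hJ : Tendsto (fun n => fderiv ℝ (energy p q r f g lam k) (u n)) atTop (𝓝 0)) :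
    (∃ φ : ℕ → ℕ, StrictMono φ ∧
      ∀ᵐ x, Tendsto (fun n => (u (φ n)).grad x) atTop (𝓝 (u₀.grad x))) ∧
    HasFDerivAt (energy p q r f g lam k) (0 : VarSobolev p →L[ℝ] ℝ) u₀ ∧
    IsWeakSolution p q r f g lam k u₀ := by
  obtain ⟨σ, ε, q, r, s, hσ, hε, rfl, rfl, hp, hpq, hqr, hrs, hemb⟩ := hpqr.exists_embedding hN
  have hq : ∀ᵐ x, σ ≤ q x := by filter_upwards [hp, hpq] with x h1 h2 using h1.trans h2
  have hr : ∀ᵐ x, σ ≤ r x := by filter_upwards [hq, hqr] with x h1 h2 using h1.trans h2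
  have hpr : ∀ᵐ x, p x ≤ r x := by filter_upwards [hpq, hqr] with x h1 h2 using h1.trans h2
  have hrs' : ∀ᵐ x, r x ≤ s x := by filter_upwards [hrs] with x h1; linarith
  have hqs : ∀ᵐ x, q x + ε ≤ s x := by filter_upwards [hqr, hrs] with x h1 h2; linarith
  have hqs' : ∀ᵐ x, q x ≤ s x := by filter_upwards [hqs] with x h1; linarith
  have hps : ∀ᵐ x, p x + ε ≤ s x := by filter_upwards [hpq, hqs] with x h1 h2; linarith
  have hm : ∀ v : VarSobolev p, AEStronglyMeasurable v.fn volume := fun v =>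
    (VarSobolev.toLp v).aestronglyMeasurable
  have hGm : ∀ v : VarSobolev p, AEStronglyMeasurable v.grad volume := fun v =>
    (VarSobolev.gradLp v).aestronglyMeasurable
  -- all the modulars are bounded on bounded sets
  have hbdd : ∀ R : ℝ, ∃ C : ℝ≥0∞, C < ⊤ ∧ ∀ v : VarSobolev p, ‖v‖ ≤ R →
      (modular p v.fn ≤ C ∧ modular p v.grad ≤ C) ∧ modular q v.fn ≤ C ∧ modular r v.fn ≤ C ∧
        modular s v.fn ≤ C := fun R => by
    obtain ⟨C₁, hC₁, h₁⟩ := VarSobolev.exists_modular_le_of_norm_le (p := p) R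
    obtain ⟨C₂, hC₂, h₂⟩ := hemb C₁ hC₁
    refine ⟨C₁ + C₂, ENNReal.add_lt_top.2 ⟨hC₁, hC₂⟩, fun v hv => ?_⟩
    have hs := h₂ v (h₁ v hv).1 (h₁ v hv).2
    exact ⟨⟨(h₁ v hv).1.trans le_self_add, (h₁ v hv).2.trans le_self_add⟩,
      (modular_le_add_of_between hpq hqs' (hm v)).trans (add_le_add (h₁ v hv).1 hs),
      (modular_le_add_of_between hpr hrs' (hm v)).trans (add_le_add (h₁ v hv).1 hs),
      hs.trans le_add_self⟩
  have hqm : ∀ v : VarSobolev p, modular q v.fn < ⊤ := fun v => by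
    obtain ⟨C, hC, h⟩ := hbdd ‖v‖
    exact (h v le_rfl).2.1.trans_lt hC
  have hrm : ∀ v : VarSobolev p, modular r v.fn < ⊤ := fun v => by
    obtain ⟨C, hC, h⟩ := hbdd ‖v‖
    exact (h v le_rfl).2.2.1.trans_lt hC
  obtain ⟨C₁, hC₁, hunit⟩ := hbdd 1
  obtain ⟨Ka, hgK⟩ := hg.exists_abs_le
  have hfK : ∀ x, |f ((k : ℝ)⁻¹ • x)| ≤ 1 := fun x => hf.abs_le_one _
  have hgm : Measurable fun x : RN N => g ((k : ℝ)⁻¹ • x) :=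
    (hg.continuous.comp (continuous_const_smul _)).measurable
  have hfm : Measurable fun x : RN N => f ((k : ℝ)⁻¹ • x) :=
    (hf.continuous.comp (continuous_const_smul _)).measurable
  choose L hL hLe using exists_hasFDerivAt_energy hσ hp hq hr hqm hrm
    (fun v hv => integral_norm_rpow_le_toReal (hm v) hC₁ (hunit v hv.le).2.1)
    (fun v hv => integral_norm_rpow_le_toReal (hm v) hC₁ (hunit v hv.le).2.2.1)
    hgm hgK hfm hfK lam
  -- the sequence is bounded
  obtain ⟨B, hB⟩ := exists_norm_le_of_weak_tendsto hweak
  obtain ⟨C, hC, hbd⟩ := hbdd (B + ‖u₀‖)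
  have hu := fun n => hbd (u n) ((hB n).trans (le_add_of_nonneg_right (norm_nonneg _)))
  have hv := fun n => hbd (u n - u₀)
    ((norm_sub_le _ _).trans (add_le_add_left (hB n) _))
  have hweak0 : ∀ L : VarSobolev p →L[ℝ] ℝ, Tendsto (fun n => L (u n - u₀)) atTop (𝓝 0) :=
    fun L => by simpa only [map_sub, sub_self] using (hweak L).sub_const (L u₀)
  have hl1 := VarSobolev.tendsto_setLIntegral_ball hN hC (fun n => (hv n).1) hweak0
  -- Norm convergence of the derivatives permits test functions that vary with `n`, provided they
  -- stay bounded.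
  have hdual : ∀ (w : ℕ → VarSobolev p) (B : ℝ), (∀ n, ‖w n‖ ≤ B) →
      Tendsto (fun n => energyDeriv p q r (fun x => g ((k : ℝ)⁻¹ • x))
        (fun x => f ((k : ℝ)⁻¹ • x)) lam (u n) (w n)) atTop (𝓝 0) := fun w B hw => by
    have hJn := hJ.norm.mul_const B
    rw [norm_zero, zero_mul] at hJn
    refine squeeze_zero_norm (fun n => ?_) hJn
    rw [← hLe, (hL (u n)).fderiv]
    exact (L (u n)).le_of_opNorm_le_of_le le_rfl (hw n)
  have hmono := tendsto_setLIntegral_inner_powMap_sub hσ hp hq hr hgK hfK lam hC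
    (fun n => (hu n).1.1) (fun n => (hu n).1.2) (fun n => (hu n).2.1) (fun n => (hu n).2.2.1)
    (fun n => (hv n).1.1) (fun n => (hv n).1.2) (fun n => (hv n).2.1) (fun n => (hv n).2.2.1)
    (fun R => tendsto_setLIntegral_rpow_of_tendsto hε hps hC (fun n => hm _)
      (fun n => (hv n).2.2.2) (hl1 R))
    (fun R => tendsto_setLIntegral_rpow_of_tendsto hε hqs hC (fun n => hm _)
      (fun n => (hv n).2.2.2) (hl1 R))
    (fun R => tendsto_setLIntegral_rpow_of_tendsto hε hrs hC (fun n => hm _)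
      (fun n => (hv n).2.2.2) (hl1 R)) hweak0 hdual
  -- a subsequence along which the functions and their gradients converge almost everywhere
  have hΦm : ∀ n, AEMeasurable (fun x => ENNReal.ofReal (inner ℝ
      (powMap (p x) ((u n).grad x) - powMap (p x) (u₀.grad x)) ((u n).grad x - u₀.grad x)))
      volume := fun n =>
    ((((aestronglyMeasurable_powMap p (hGm (u n))).sub
      (aestronglyMeasurable_powMap p (hGm u₀))).inner
        ((hGm (u n)).sub (hGm u₀))).aemeasurable).ennreal_ofReal
  -- Summing the monotonicity integrand and `‖u n - u₀‖ₑ` lets a single extraction serve both the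
  -- gradients and the functions.
  obtain ⟨φ, hφ, hae⟩ := exists_seq_ae_tendsto_of_tendsto_setLIntegral
    (Ψ := fun n x => ENNReal.ofReal (inner ℝ
      (powMap (p x) ((u n).grad x) - powMap (p x) (u₀.grad x)) ((u n).grad x - u₀.grad x)) +
        ‖(u n - u₀).fn x‖ₑ) (fun n => (hΦm n).add (hm _).enorm) (fun R => by
      have := (hmono R).add (hl1 R)
      rw [add_zero] at this
      refine this.congr fun n => ?_
      rw [lintegral_add_left' (hΦm n).restrict])
  have hgrad : ∀ᵐ x, Tendsto (fun n => (u (φ n)).grad x) atTop (𝓝 (u₀.grad x)) := by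
    filter_upwards [hp, hae] with x hx h
    have hx1 : 1 < p x := by linarith
    refine tendsto_of_inner_powMap_sub hx1 ?_
    have h0 := tendsto_of_tendsto_of_tendsto_of_le_of_le tendsto_const_nhds h
      (fun _ => zero_le) (fun _ => le_self_add)
    have h1 := (ENNReal.tendsto_toReal ENNReal.zero_ne_top).comp h0
    rw [ENNReal.toReal_zero] at h1
    exact h1.congr fun n => ENNReal.toReal_ofReal (inner_powMap_sub_nonneg hx1 _ _)
  have hfn : ∀ᵐ x, Tendsto (fun n => (u (φ n)).fn x) atTop (𝓝 (u₀.fn x)) := by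
    filter_upwards [hae, ae_all_iff.2 fun n => VarSobolev.fn_sub (u (φ n)) u₀] with x h hx
    have h0 := tendsto_of_tendsto_of_tendsto_of_le_of_le tendsto_const_nhds h
      (fun _ => zero_le) (fun _ => le_add_self)
    rw [tendsto_iff_edist_tendsto_0]
    refine h0.congr fun n => ?_
    rw [hx n, edist_eq_enorm_sub]
  -- Two limits of the same sequence: the derivative at `u₀` by almost everywhere convergence, and
  -- `0` by hypothesis.
  have hzero : ∀ v, energyDeriv p q r (fun x => g ((k : ℝ)⁻¹ • x))
      (fun x => f ((k : ℝ)⁻¹ • x)) lam u₀ v = 0 := fun v =>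
    tendsto_nhds_unique
      (tendsto_energyDeriv_of_ae hσ hp hq hr hqm hrm hgm hgK hfm hfK lam hC
        (fun n => (hu (φ n)).1.1) (fun n => (hu (φ n)).1.2) (fun n => (hu (φ n)).2.1)
        (fun n => (hu (φ n)).2.2.1) hfn hgrad v)
      ((hdual (fun _ => v) ‖v‖ fun _ => le_rfl).comp hφ.tendsto_atTop)
  refine ⟨⟨φ, hφ, hgrad⟩, ?_,
    isWeakSolution_of_energyDeriv_eq_zero hσ hp hq hr hqm hrm hgm hgK hfm hfK hzero⟩
  have hL0 : L u₀ = 0 := by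
    ext v
    rw [hLe, hzero]
    rfl
  exact hL0 ▸ hL u₀
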